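/- **Model.** A network is a finite connected simple graph $G=(V,E)$ with $|V|\ge 2$, distinct vertex identifiers in $\{0,\dots,|V|^k\}$ for some constant $k$, and a distinguished leader vertex. Initially each vertex knows only its own identifier, the identifiers of its neighbours, and whether it is the leader. Time proceeds in synchronous rounds; in each round every vertex reads the messages its neighbours sent in the previous round, tosses finitely many private fair coins, performs an arbitrary local computation and sends at most one message to each neighbour. All messages must have $O(\log|V|)$ bits. A vertex may halt with a local result; the time of a run is the number of rounds until all vertices have halted, and its message complexity is the total number of messages sent. Let $\mathcal D$ be the diameter and $\Delta$ the maximum degree of $G$. The implied constants below depend only on $k$; the algorithms do not depend on $k$. **Notions.** A cut vertex is a vertex whose deletion disconnects $G$. For edges $e,f$ write $e\sim f$ if $e=f$ or some cycle of $G$ contains both; the classes of $\sim$ are the blocks. Let $T$ be a spanning tree rooted at a vertex $r$, with parent function $p$ and preorder numbering $pre$; let $desc(v)$ be the number of descendants of $v$ (including $v$), and let $low(v)$ and $high(v)$ be the least and the greatest value of $pre$ on the set consisting of the descendants of $v$ and all vertices joined to a descendant of $v$ by a non-tree edge. Put $\{w,v\}\sim_0\{v,p(v)\}$ if $\{w,v\}\in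 E\setminus T$ and ($pre(w)<pre(v)$ or $pre(w)\ge pre(v)+desc(v)$); put $\{v,p(v)\}\sim_0\{p(v),p(p(v))\}$ if $low(v)<pre(p(v))$ or $high(v)\ge pre(p(v))+desc(p(v))$; no other pairs are related by $\sim_0$. **Theorem.** 1. There is a Las Vegas distributed algorithm that computes all cut vertices and all blocks: whenever all vertices have halted, each vertex knows whether it is a cut vertex, and both ends of each edge store the same label of that edge, two edges having equal labels if and only if they lie in the same block. Its expected time is $O(\mathcal D+\Delta/\log|V|)$ and its expected number of messages is $O(|E|(1+\Delta/\log|V|))$. 2. For every finite connected graph $G$, every rooted spanning tree $T$ of $G$ and every preorder numbering of $T$: (a) whenever $e\sim_0 f$, the edges $e$ and $f$ have a common end; (b) the reflexive symmetric transitive closure of $\sim_0$ is $\sim$; (c) for every equivalence relation $\approx$ on $E$, $\sim$ refines $\approx$ if and only if for every vertex $v$ and all neighbours $u,w$ of $v$, $\{u,v\}\sim_0\{v,w\}$ implies $\{u,v\}\approx\{v,w\}$. 3. There is a distributed algorithm that, in every run, takes $O(\mathcal D)$ time and $O(|E|)$ messages and computes such a relation $\sim_0$, for some spanning tree rooted at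 the leader and some preorder numbering of it: at termination each vertex $v$ knows, for all its neighbours $u,w$, whether $\{u,v\}\sim_0\{v,w\}$. -/

import Mathlib

open MeasureTheory
open scoped ENNReal

/-! ### Synchronous message passing with private coins (the CONGEST model) -/

/-- What a vertex knows at the start: its own identifier, the identifiers of its neighbours, and
whether it is the leader. In particular neither the number of vertices, nor the maximum degree, nor
the diameter is known. -/
structure LocalView where
  ident : ℕ
  nbrs : Finset ℕ
  isLeader : Bool

/-- A message is a string of bits. -/
abbrev Message := List Bool

/-- A randomized synchronous distributed algorithm: one program, run by every vertex of every
network. In each round a vertex in state `s` that has not halted reads the messages that its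
neighbours sent in the previous round (a function of the neighbour's identifier), tosses
`coins s` private fair coins, and determines its next state and at most one message for each of its
neighbours (a function of the neighbour's identifier). A vertex has halted, with local result `o`,
once its state `s` satisfies `output s = some o`. Local computation and memory are unbounded. -/
structure DistAlg (Out : Type) where
  State : Type
  init : LocalView → State
  coins : State → ℕ
  step : State → (ℕ → Option Message) → List Bool → State × (ℕ → Option Message)
  output : State → Option Out

/-- The data that turns a graph into a network: distinct identifiers and a leader. -/
structure Network (V : Type*) where
  ident : V ↪ ℕ
  leader : V

/-- A snapshot between two rounds: the states of all vertices, and the messages of the last round;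
`msg u v` is the message sent by `u` to `v`, if there is one. -/
structure DistConfig (V : Type*) (State : Type) where
  state : V → State
  msg : V → V → Option Message

/-- The outcomes of all coins: `ω (v, t, i)` is the `i`-th coin of vertex `v` in round `t`. -/
abbrev Coins (V : Type*) := V × ℕ × ℕ → Bool

/-- All coins are fair and independent. -/
noncomputable def coinMeasure (V : Type*) : Measure (Coins V) :=
  Measure.infinitePi fun _ => (PMF.uniformOfFintype Bool).toMeasure

namespace DistAlg

variable {V : Type*} [Fintype V] {Out : Type}

/-- The initial knowledge of the vertex `v`. -/
def view (G : SimpleGraph V) [DecidableRel G.Adj] [DecidableEq V] (N : Network V) (v : V) :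
    LocalView where
  ident := N.ident v
  nbrs := (G.neighborFinset v).map N.ident
  isLeader := decide (v = N.leader)

/-- The messages that arrive at `v`, listed by the identifier of the sender. -/
noncomputable def inbox (N : Network V) (msg : V → V → Option Message) (v : V) :
    ℕ → Option Message :=
  fun i => (Function.partialInv N.ident i).bind fun u => msg u v

/-- One round. Messages travel only along edges. A halted vertex keeps its state and is silent. -/
noncomputable def round (A : DistAlg Out) (G : SimpleGraph V) [DecidableRel G.Adj] (N : Network V)
    (coin : V → ℕ → Bool) (c : DistConfig V A.State) : DistConfig V A.State :=
  let res : V → A.State × (ℕ → Option Message) := fun v =>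
    A.step (c.state v) (inbox N c.msg v) ((List.range (A.coins (c.state v))).map (coin v))
  { state := fun v => if (A.output (c.state v)).isSome then c.state v else (res v).1
    msg := fun v u =>
      if (A.output (c.state v)).isNone ∧ G.Adj v u then (res v).2 (N.ident u) else none }

/-- The snapshot after `t` rounds. -/
noncomputable def config (A : DistAlg Out) (G : SimpleGraph V) [DecidableRel G.Adj] [DecidableEq V]
    (N : Network V) (ω : Coins V) : ℕ → DistConfig V A.State
  | 0 => { state := fun v => A.init (view G N v), msg := fun _ _ => none }
  | t + 1 => A.round G N (fun v i => ω (v, t, i)) (A.config G N ω t)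

/-- After `t` rounds every vertex has halted, and `out v` is the local result of `v`. -/
def HaltsWith (A : DistAlg Out) (G : SimpleGraph V) [DecidableRel G.Adj] [DecidableEq V]
    (N : Network V) (ω : Coins V) (t : ℕ) (out : V → Out) : Prop :=
  ∀ v, A.output ((A.config G N ω t).state v) = some (out v)

/-- The number of rounds until every vertex has halted (`∞` if this never happens). -/
noncomputable def time (A : DistAlg Out) (G : SimpleGraph V) [DecidableRel G.Adj] [DecidableEq V]
    (N : Network V) (ω : Coins V) : ℝ≥0∞ :=
  ⨅ (t : ℕ) (_ : ∃ out, A.HaltsWith G N ω t out), (t : ℝ≥0∞)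

/-- The total number of messages sent. -/
noncomputable def messages (A : DistAlg Out) (G : SimpleGraph V) [DecidableRel G.Adj]
    [DecidableEq V] (N : Network V) (ω : Coins V) : ℝ≥0∞ :=
  ∑' t : ℕ,
    ((Finset.univ.filter fun p : V × V => ((A.config G N ω t).msg p.1 p.2).isSome).card : ℝ≥0∞)

/-- Under all outcomes of the coins, every message has at most `B` bits. -/
def MessageSizeLE (A : DistAlg Out) (G : SimpleGraph V) [DecidableRel G.Adj] [DecidableEq V]
    (N : Network V) (B : ℝ) : Prop :=
  ∀ (ω : Coins V) (t : ℕ) (u v : V) (m : Message),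
    (A.config G N ω t).msg u v = some m → (m.length : ℝ) ≤ B

/-- The expected number of rounds. (After `t` rounds a run depends on finitely many coins, so the
integrand is measurable.) -/
noncomputable def expectedTime (A : DistAlg Out) (G : SimpleGraph V) [DecidableRel G.Adj]
    [DecidableEq V] (N : Network V) : ℝ≥0∞ :=
  ∫⁻ ω, A.time G N ω ∂(coinMeasure V)

/-- The expected total number of messages. -/
noncomputable def expectedMessages (A : DistAlg Out) (G : SimpleGraph V) [DecidableRel G.Adj]
    [DecidableEq V] (N : Network V) : ℝ≥0∞ :=
  ∫⁻ ω, A.messages G N ω ∂(coinMeasure V)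

end DistAlg

/-! ### Cut vertices and blocks -/

/-- The graph is disconnected after deletion of `v`. -/
def IsCutVertex {V : Type*} (G : SimpleGraph V) (v : V) : Prop :=
  ¬ (G.induce ({v}ᶜ : Set V)).Preconnected

/-- The block relation on edges: equal, or on a common cycle. Its classes are the blocks. -/
def SameBlock {V : Type*} (G : SimpleGraph V) (e f : G.edgeSet) : Prop :=
  e = f ∨ ∃ (u : V) (c : G.Walk u u), c.IsCycle ∧ (e : Sym2 V) ∈ c.edges ∧ (f : Sym2 V) ∈ c.edges

/-- The edge joining two adjacent vertices. -/
def edgeOf {V : Type*} {G : SimpleGraph V} {u v : V} (h : G.Adj u v) : G.edgeSet :=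
  ⟨s(u, v), h⟩

/-- The local result of a vertex: whether it is a cut vertex, and for each of its edges, given by
the identifier of the other end, a block label. -/
structure BlockOutput where
  isCut : Bool
  label : ℕ → ℕ

/-- Every vertex knows whether it is a cut vertex, both ends of an edge store the same label for
it (the case of the same edge traversed in the two directions), and two edges have the same label
exactly if they are in the same block. -/
structure CorrectBlockOutput {V : Type*} (G : SimpleGraph V) (N : Network V)
    (out : V → BlockOutput) : Prop where
  cut : ∀ v, (out v).isCut = true ↔ IsCutVertex G v
  block : ∀ (u v x y : V) (h : G.Adj u v) (k : G.Adj x y),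
    (out u).label (N.ident v) = (out x).label (N.ident y) ↔ SameBlock G (edgeOf h) (edgeOf k)

/-! ### The generating relation of a preordered rooted spanning tree -/

section Tree

variable {V : Type*} (G T : SimpleGraph V) (r : V) (pre : V → ℕ)

/-- `p` is the parent of `v` in the tree `T` rooted at `r`. -/
def IsParent (v p : V) : Prop :=
  T.Adj v p ∧ T.dist r v = T.dist r p + 1

/-- `w` is a descendant of `v` (every vertex is a descendant of itself). -/
def IsDesc (w v : V) : Prop :=
  Relation.ReflTransGen (IsParent T r) w v

/-- `T` is a spanning tree of `G`, and `pre` numbers its vertices `0, 1, 2, …` in preorder, starting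
from the root `r`: a vertex comes before its children, and the subtree of a child is exhausted
before the next child is visited. -/
structure IsPreorderedSpanningTree : Prop where
  le : T ≤ G
  isTree : T.IsTree
  bijOn : Set.BijOn pre Set.univ (Set.Iio (Nat.card V))
  parent_lt : ∀ v p, IsParent T r v p → pre p < pre v
  sibling_lt : ∀ p a b, IsParent T r a p → IsParent T r b p → pre a < pre b →
    ∀ w, IsDesc T r w a → pre w < pre b

/-- The number of descendants. -/
noncomputable def descCount (v : V) : ℕ :=
  Set.ncard {w | IsDesc T r w v}

/-- The descendants of `v` and all vertices joined to a descendant of `v` by a non-tree edge. -/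
def subtreeNbhd (v : V) : Set V :=
  {x | IsDesc T r x v ∨ ∃ d, IsDesc T r d v ∧ G.Adj d x ∧ ¬ T.Adj d x}

/-- The least preorder number in the subtree neighbourhood. -/
noncomputable def lowNum (v : V) : ℕ :=
  sInf (pre '' subtreeNbhd G T r v)

/-- The greatest preorder number in the subtree neighbourhood. -/
noncomputable def highNum (v : V) : ℕ :=
  sSup (pre '' subtreeNbhd G T r v)

/-- A non-tree edge `{w, v}` is related to the edge from `v` to its parent if `w` is not a
descendant of `v`. -/
def Sim1 (e f : G.edgeSet) : Prop :=
  ∃ w v p, (e : Sym2 V) = s(w, v) ∧ (f : Sym2 V) = s(v, p) ∧ IsParent T r v p ∧ ¬ T.Adj w v ∧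
    (pre w < pre v ∨ pre v + descCount T r v ≤ pre w)

/-- The edge from `v` to its parent `p` is related to the edge from `p` to its parent `q` if the
subtree neighbourhood of `v` is not contained in the descendants of `p`. -/
def Sim2 (e f : G.edgeSet) : Prop :=
  ∃ v p q, (e : Sym2 V) = s(v, p) ∧ (f : Sym2 V) = s(p, q) ∧ IsParent T r v p ∧ IsParent T r p q ∧
    (lowNum G T r pre v < pre p ∨ pre p + descCount T r p ≤ highNum G T r pre v)

/-- The generating relation. -/
def Sim0 (e f : G.edgeSet) : Prop :=
  Sim1 G T r pre e f ∨ Sim2 G T r pre e f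

end Tree

/-- `out v i j` tells whether the generating relation, for one preordered spanning tree rooted at
the leader, holds from the edge at `v` whose other end has identifier `i` to the edge at `v` whose
other end has identifier `j`. -/
def CorrectSim0Output {V : Type*} (G : SimpleGraph V) (N : Network V)
    (out : V → ℕ → ℕ → Bool) : Prop :=
  ∃ (T : SimpleGraph V) (pre : V → ℕ), IsPreorderedSpanningTree G T N.leader pre ∧
    ∀ (u v w : V) (h : G.Adj u v) (k : G.Adj v w),
      out v (N.ident u) (N.ident w) = true ↔ Sim0 G T N.leader pre (edgeOf h) (edgeOf k)

/-! Blocks are compared with connectivity after deletion of a vertex. Two edges `uv` and `vw` lie in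
one block exactly if `u` and `w` are joined in `G - v` (`sameBlock_iff_avoids`), and such local
pairs generate the block relation (`eqvGen_local_iff_sameBlock`), because consecutive edges of a
cycle form local pairs.

The relation `Sim0`. Its pairs are local pairs (`exists_avoids_of_sim0`). Conversely, follow a walk
in `G - v` from `u` to `w` and watch the tree edge at `v` that points to the current vertex. It
changes only when the walk uses a non-tree edge between two branches at `v`. Such an edge is
equivalent to both tree edges, since a non-tree edge that leaves a subtree is linked by `Sim0`,
level by level, to the tree edge above that subtree (`eqvGen_of_leaves`). Hence an equivalence
relation contains the block relation iff it contains `Sim0`, and this can be tested at each vertex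
separately. Preorder numbers turn membership in a subtree into membership in an interval, so `Sim0`
is computable from numbers of size at most `|V|`.

The algorithms. Flooding from the leader, a convergecast and a broadcast build a breadth-first
search tree with a preorder numbering; one more convergecast yields `low` and `high`, hence `Sim0`.
In such a tree a non-tree edge never joins a vertex to an ancestor.

For the blocks, every non-tree edge receives a random vector over the field with two elements, and
every tree edge the sum of the vectors of all non-tree edges leaving the subtree below it. For a set
`S` of children of `v`, the vectors of the tree edges to `S` add up to the sum over the non-tree
edges leaving the union of the subtrees (`sum_flow`). This is zero if there are no such edges and
uniformly distributed otherwise. From its zero-sum sets `v` reads off which children are joined to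
each other in `G - v` and which are joined to the outside of its subtree, and edge labels are passed
down accordingly.

The error is one-sided: accidental zero sums only destroy links. So equal labels imply a common
block whatever the coins (`sameBlock_of_edgeLab_eq`). The converse is what the local test of `Sim0`
verifies (`edgeLab_eq_of_sameBlock`), and trials are repeated until every vertex is satisfied. There
are at most `|V| * 2 ^ Δ` sets of siblings, and the vectors are long enough for a union bound to
give failure probability at most one half, independently in each trial (`measure_not_good_le`,
`Good.check`); the expected cost is that of two trials (`lintegral_attempts_le`). All vertices
receive the same verdict and halt in the same round, so everything is computed in a run that ignores
halting (`Program.ideal`). -/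

/-! ### Blocks and connectivity after deletion of a vertex -/

section Blocks

variable {V : Type*} {G : SimpleGraph V}

/-- `u` and `w` are joined by a walk that avoids `v`. -/
def Avoids (G : SimpleGraph V) (v : V) : V → V → Prop :=
  Relation.ReflTransGen fun a b => G.Adj a b ∧ a ≠ v ∧ b ≠ v

theorem Avoids.symm {v u w : V} (h : Avoids G v u w) : Avoids G v w u := by
  induction h with
  | refl => exact .refl
  | tail _ hbc ih => exact Relation.ReflTransGen.head ⟨hbc.1.symm, hbc.2.2, hbc.2.1⟩ ih

theorem Avoids.trans {v a b c : V} (h : Avoids G v a b) (k : Avoids G v b c) : Avoids G v a c :=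
  Relation.ReflTransGen.trans h k

theorem Avoids.exists_walk {v u w : V} (hu : u ≠ v) (h : Avoids G v u w) :
    ∃ p : G.Walk u w, v ∉ p.support := by
  induction h with
  | refl => exact ⟨SimpleGraph.Walk.nil, by simpa using hu.symm⟩
  | tail _ hbc ih =>
    obtain ⟨p, hp⟩ := ih
    refine ⟨p.concat hbc.1, ?_⟩
    rw [SimpleGraph.Walk.support_concat]
    simp only [List.mem_append, List.mem_singleton, not_or]
    exact ⟨hp, hbc.2.2.symm⟩

theorem avoids_of_walk {v : V} : ∀ {u w : V} (p : G.Walk u w), v ∉ p.support → Avoids G v u w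
  | _, _, .nil, _ => .refl
  | _, _, .cons h p, hv => by
    simp only [SimpleGraph.Walk.support_cons, List.mem_cons, not_or] at hv
    refine Relation.ReflTransGen.head ⟨h, fun e => hv.1 e.symm, fun e => hv.2 ?_⟩
      (avoids_of_walk p hv.2)
    rw [← e]; exact p.start_mem_support

theorem isCutVertex_iff {v : V} :
    IsCutVertex G v ↔ ∃ u w, u ≠ v ∧ w ≠ v ∧ ¬ Avoids G v u w := by
  have key : ∀ a b : ({v}ᶜ : Set V),
      (G.induce ({v}ᶜ : Set V)).Reachable a b ↔ Avoids G v a b := by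
    intro a b
    constructor
    · rintro ⟨p⟩
      induction p with
      | nil => exact .refl
      | @cons x y _ h _ ih =>
        exact Relation.ReflTransGen.head ⟨h, x.2, y.2⟩ ih
    · intro h
      obtain ⟨a, ha⟩ := a
      obtain ⟨b, hb⟩ := b
      change Avoids G v a b at h
      induction h with
      | refl => rfl
      | tail _ hbc ih =>
        have hb' := hbc.2.1
        exact (ih hb').trans (SimpleGraph.Adj.reachable (by exact hbc.1))
  unfold IsCutVertex SimpleGraph.Preconnected
  push Not
  constructor
  · rintro ⟨a, b, h⟩
    exact ⟨a, b, a.2, b.2, fun h' => h ((key a b).2 h')⟩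
  · rintro ⟨u, w, hu, hw, h⟩
    exact ⟨⟨u, hu⟩, ⟨w, hw⟩, fun h' => h ((key _ _).1 h')⟩

/-- The initial segment of a walk up to its first vertex in `S`, as a path. -/
theorem exists_isPath_first_mem (S : Set V) :
    ∀ {w u : V} (p : G.Walk w u), u ∈ S →
      ∃ z ∈ S, ∃ q : G.Walk w z, q.IsPath ∧ (∀ x ∈ q.support, x ∈ p.support) ∧
        ∀ x ∈ q.support, x ∈ S → x = z
  | w, _, .nil, hu => ⟨w, hu, .nil, by simp, by simp, by simp⟩
  | w, _, .cons (v := w') h p, hu => by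
    classical
    by_cases hw : w ∈ S
    · exact ⟨w, hw, .nil, by simp, by simp, by simp⟩
    · obtain ⟨z, hz, q, -, hq, hqS⟩ := exists_isPath_first_mem S p hu
      refine ⟨z, hz, (SimpleGraph.Walk.cons h q).bypass, SimpleGraph.Walk.bypass_isPath _, ?_, ?_⟩
      · intro x hx
        have := SimpleGraph.Walk.support_bypass_subset_support _ hx
        simp only [SimpleGraph.Walk.support_cons, List.mem_cons] at this ⊢
        exact this.imp id (hq x)
      · intro x hx hxS
        have := SimpleGraph.Walk.support_bypass_subset_support _ hx
        simp only [SimpleGraph.Walk.support_cons, List.mem_cons] at this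
        rcases this with rfl | hx'
        · exact absurd hxS hw
        · exact hqS x hx' hxS

theorem edgeOf_comm {u v : V} (h : G.Adj u v) : edgeOf h.symm = edgeOf h :=
  Subtype.ext Sym2.eq_swap

theorem SameBlock.symm {e f : G.edgeSet} (h : SameBlock G e f) : SameBlock G f e := by
  rcases h with rfl | ⟨u, c, hc, he, hf⟩
  · exact .inl rfl
  · exact .inr ⟨u, c, hc, hf, he⟩

/-- Adjacent edges are in the same block if their other ends are connected after deletion of the
common end; more generally the block of `uv` can be continued along such edges. -/
theorem SameBlock.step {e : G.edgeSet} {u v w : V} (h : G.Adj u v) (k : G.Adj v w)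
    (he : SameBlock G e (edgeOf h)) (ha : Avoids G v u w) : SameBlock G e (edgeOf k) := by
  classical
  obtain ⟨p, hp⟩ := ha.symm.exists_walk k.ne'
  by_cases huw : u = w
  · subst huw
    rwa [← edgeOf_comm k] 
  rcases he with rfl | ⟨x, c, hc, hec, huvc⟩
  · right
    have hq : v ∉ p.bypass.support := fun hx =>
      hp (SimpleGraph.Walk.support_bypass_subset_support _ hx)
    -- The cycle goes from `v` to `w`, along a path avoiding `v` to `u`, and back to `v`.
    refine ⟨v, (SimpleGraph.Walk.cons k p.bypass).concat h, ?_, ?_, ?_⟩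
    · rw [SimpleGraph.Walk.concat_cons, SimpleGraph.Walk.cons_isCycle_iff]
      refine ⟨(SimpleGraph.Walk.bypass_isPath p).concat hq h, ?_⟩
      rw [SimpleGraph.Walk.edges_concat]
      simp only [List.concat_eq_append, List.mem_append, List.mem_singleton, not_or]
      refine ⟨fun hx => hq (SimpleGraph.Walk.fst_mem_support_of_mem_edges _ hx), ?_⟩
      simp [huw, eq_comm]
      grind
    · simp [edgeOf, SimpleGraph.Walk.edges_concat]
    · simp [edgeOf, SimpleGraph.Walk.edges_concat]
  · right
    have hv : v ∈ c.support := SimpleGraph.Walk.snd_mem_support_of_mem_edges _ huvc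
    have huc : u ∈ c.support := SimpleGraph.Walk.fst_mem_support_of_mem_edges _ huvc
    -- With the cycle `C` based at `v`, let `z` be the first vertex of `C` on the walk from `w` to
    -- `u`. The vertices `v` and `z` cut `C` into two arcs, one of which contains `e`. This arc,
    -- closed up through `w`, is a cycle containing `e` and `vw`.
    have key : ∀ (C : G.Walk v v), C.IsCycle → (e : Sym2 V) ∈ C.edges → u ∈ C.support →
        ∃ (u : V) (c : G.Walk u u), c.IsCycle ∧ (e : Sym2 V) ∈ c.edges ∧
          ((edgeOf k : G.edgeSet) : Sym2 V) ∈ c.edges := by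
      intro C hC heC huC
      obtain ⟨z, hz, q, hq, hqp, hqz⟩ :=
        exists_isPath_first_mem {x | x ∈ C.support} p huC
      have hz' : z ∈ C.support := hz
      have hvq : v ∉ q.support := fun hx => hp (hqp v hx)
      have hzv : z ≠ v := by
        rintro rfl
        exact hvq q.end_mem_support
      have fin : ∀ B : G.Walk z v, B.IsPath → (∀ x ∈ B.support, x ∈ C.support) →
          (e : Sym2 V) ∈ B.edges → ∃ (u : V) (c : G.Walk u u), c.IsCycle ∧
            (e : Sym2 V) ∈ c.edges ∧ ((edgeOf k : G.edgeSet) : Sym2 V) ∈ c.edges := by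
        intro B hB hBC heB
        -- Two single edges do not close up to a cycle; in that case `e` turns out to be `vw`.
        by_cases hl : 1 < (SimpleGraph.Walk.cons k q).length ∨ 1 < B.length
        · refine ⟨v, (SimpleGraph.Walk.cons k q).append B,
            SimpleGraph.Walk.IsPath.isCycle_append (hq.cons hvq) hB ?_ hl, ?_, ?_⟩
          · intro x hx hxB
            simp only [SimpleGraph.Walk.support_cons, List.tail_cons] at hx
            have hxz := hqz x hx (hBC x (List.mem_of_mem_tail hxB))
            subst hxz
            have := hB.support_nodup
            rw [← SimpleGraph.Walk.cons_tail_support] at this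
            exact (List.nodup_cons.1 this).1 hxB
          · simp [heB]
          · simp [edgeOf]
        · push Not at hl
          -- then `q` is trivial and `B` is the edge `vw` itself
          have hq0 : q.length = 0 := by
            have := hl.1
            simp at this
            simpa using this
          have hzw : w = z := SimpleGraph.Walk.eq_of_length_eq_zero hq0
          subst hzw
          have hB1 : B.length = 1 := by
            have : B.length ≠ 0 := fun h0 => hzv (SimpleGraph.Walk.eq_of_length_eq_zero h0)
            omega
          have : (e : Sym2 V) = s(v, w) := by
            cases B with
            | nil => simp at hB1
            | cons hh B' =>
              have h0 : B'.length = 0 := by simpa using hB1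
              obtain rfl := SimpleGraph.Walk.eq_of_length_eq_zero h0
              have : B' = .nil := by
                cases B' with
                | nil => rfl
                | cons => simp at h0
              subst this
              simp at heB
              rw [heB, Sym2.eq_swap]
          exact ⟨v, C, hC, heC, by change s(v, w) ∈ C.edges; rw [← this]; exact heC⟩
      have hsplit : (e : Sym2 V) ∈ (C.takeUntil z hz').edges ∨
          (e : Sym2 V) ∈ (C.dropUntil z hz').edges := by
        rw [← List.mem_append, ← SimpleGraph.Walk.edges_append, SimpleGraph.Walk.take_spec]
        exact heC
      rcases hsplit with h1 | h1
      · refine fin (C.takeUntil z hz').reverse (hC.isPath_takeUntil hz').reverse ?_ (by simpa using h1)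
        intro x hx
        rw [SimpleGraph.Walk.support_reverse, List.mem_reverse] at hx
        exact SimpleGraph.Walk.support_takeUntil_subset_support _ _ hx
      · refine fin (C.dropUntil z hz') ?_ (fun x hx => ?_) h1
        · refine SimpleGraph.Walk.IsCycle.isPath_of_append_right (p := C.takeUntil z hz') ?_ ?_
          · exact SimpleGraph.Walk.not_nil_of_ne hzv.symm
          · rwa [SimpleGraph.Walk.take_spec]
        · exact SimpleGraph.Walk.support_dropUntil_subset_support _ _ hx
    refine key (c.rotate v hv) (hc.rotate hv) ?_ ?_
    · exact (SimpleGraph.Walk.rotate_edges c v hv).perm.mem_iff.2 hec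
    · have h1 : s(u, v) ∈ (c.rotate v hv).edges :=
        (SimpleGraph.Walk.rotate_edges c v hv).perm.mem_iff.2 huvc
      exact SimpleGraph.Walk.fst_mem_support_of_mem_edges _ h1

theorem SameBlock.of_avoids {u v w : V} (h : G.Adj u v) (k : G.Adj v w) (ha : Avoids G v u w) :
    SameBlock G (edgeOf h) (edgeOf k) :=
  SameBlock.step h k (.inl rfl) ha

/-- Rotated to start at `z`, the cycle is an edge `zb` followed by a path `p` back to `z`. The
neighbours of `z` on it are `b` and the penultimate vertex of `p`, and `p` without its last edge
joins them away from `z`. -/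
theorem SimpleGraph.Walk.IsCycle.avoids {x : V} {c : G.Walk x x} (hc : c.IsCycle)
    {y z t : V} (hy : s(y, z) ∈ c.edges) (ht : s(z, t) ∈ c.edges) : Avoids G z y t := by
  classical
  have hz : z ∈ c.support := SimpleGraph.Walk.fst_mem_support_of_mem_edges _ ht
  have hC := hc.rotate hz
  have hy' : s(z, y) ∈ (c.rotate z hz).edges :=
    (SimpleGraph.Walk.rotate_edges c z hz).perm.mem_iff.2 (by rwa [Sym2.eq_swap])
  have ht' : s(z, t) ∈ (c.rotate z hz).edges :=
    (SimpleGraph.Walk.rotate_edges c z hz).perm.mem_iff.2 ht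
  generalize c.rotate z hz = C at hC hy' ht'
  cases C with
  | nil => simp at ht'
  | @cons _ b _ k p =>
    have hp : p.IsPath := ((SimpleGraph.Walk.cons_isCycle_iff p k).1 hC).1
    have hpen : Avoids G z b p.penultimate := by
      refine avoids_of_walk p.dropLast fun hzd => ?_
      have hn : ¬ p.Nil := SimpleGraph.Walk.not_nil_of_ne k.ne'
      have h1 := hp.support_nodup
      rw [← SimpleGraph.Walk.concat_dropLast (SimpleGraph.Walk.adj_penultimate hn),
        SimpleGraph.Walk.support_concat, List.nodup_append'] at h1
      exact h1.2.2 hzd (by simp)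
    have pen : ∀ {t : V}, s(z, t) ∈ p.edges → t = p.penultimate := fun h1 =>
      hp.eq_penultimate_of_mem_edges h1
    simp only [SimpleGraph.Walk.edges_cons, List.mem_cons, Sym2.congr_right] at hy' ht'
    rcases hy' with rfl | hy' <;> rcases ht' with rfl | ht'
    · exact .refl
    · rw [pen ht']; exact hpen
    · rw [pen hy']; exact hpen.symm
    · rw [pen ht', pen hy']; exact .refl

/-- Relations that contain the local pairs contain the block relation. -/
theorem SameBlock.rel_of_local {R : G.edgeSet → G.edgeSet → Prop} (hR : Equivalence R)
    (hloc : ∀ (u v w : V) (h : G.Adj u v) (k : G.Adj v w), Avoids G v u w →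
      R (edgeOf h) (edgeOf k)) {e f : G.edgeSet} (hef : SameBlock G e f) : R e f := by
  classical
  rcases hef with rfl | ⟨x, c, hc, he, hf⟩
  · exact hR.refl _
  have shared : ∀ {y z t : V}, s(y, z) ∈ c.edges → s(z, t) ∈ c.edges → Avoids G z y t :=
    fun hy ht => hc.avoids hy ht
  -- Consecutive edges of the cycle are related, hence all of them are related to the first one.
  have along : ∀ {a d : V} (q : G.Walk a d), (∀ g ∈ q.edges, g ∈ c.edges) →
      ∀ g : G.edgeSet, (g : Sym2 V) ∈ q.edges → ∀ (a' : V) (k : G.Adj a' a),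
        s(a', a) ∈ c.edges → R (edgeOf k) g := by
    intro a d q
    induction q with
    | nil => intro _ g hg; simp at hg
    | cons h q ih =>
      intro hq g hg a' k hk
      have h1 := hloc _ _ _ k h (shared hk (hq _ (by simp)))
      rw [SimpleGraph.Walk.edges_cons, List.mem_cons] at hg
      rcases hg with hg | hg
      · rwa [show g = edgeOf h from Subtype.ext hg]
      · exact hR.trans h1 (ih (fun g hg => hq g (by simp [hg])) g hg _ h (hq _ (by simp)))
  cases c with
  | nil => simp at he
  | cons h q =>
    have first : ∀ g : G.edgeSet, (g : Sym2 V) ∈ (SimpleGraph.Walk.cons h q).edges →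
        R (edgeOf h) g := by
      intro g hg
      rw [SimpleGraph.Walk.edges_cons, List.mem_cons] at hg
      rcases hg with hg | hg
      · rw [show g = edgeOf h from Subtype.ext hg]; exact hR.refl _
      · exact along q (fun g hg => by simp [hg]) g hg _ h (by simp)
    exact hR.trans (hR.symm (first e he)) (first f hf)

/-- The local pairs generate the block relation. -/
theorem eqvGen_local_iff_sameBlock {e f : G.edgeSet} :
    Relation.EqvGen (fun e f : G.edgeSet => ∃ (u v w : V) (h : G.Adj u v) (k : G.Adj v w),
      e = edgeOf h ∧ f = edgeOf k ∧ Avoids G v u w) e f ↔ SameBlock G e f := by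
  constructor
  · intro h
    -- Comparing the sets of edges in a common block with `e` and with `f` makes transitivity of
    -- `SameBlock` unnecessary; it is a consequence of this theorem.
    have : ∀ g, SameBlock G g e ↔ SameBlock G g f := by
      induction h with
      | rel e f h =>
        obtain ⟨u, v, w, h, k, rfl, rfl, ha⟩ := h
        intro g
        refine ⟨fun hg => hg.step h k ha, fun hg => ?_⟩
        have := SameBlock.step k.symm h.symm (e := g) (by rwa [edgeOf_comm k]) ha.symm
        rwa [edgeOf_comm] at this
      | refl => exact fun _ => .rfl
      | symm _ _ _ ih => exact fun g => (ih g).symm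
      | trans _ _ _ _ _ ih1 ih2 => exact fun g => (ih1 g).trans (ih2 g)
    exact (this e).1 (.inl rfl)
  · exact SameBlock.rel_of_local (Relation.EqvGen.is_equivalence _)
      fun u v w h k ha => .rel _ _ ⟨u, v, w, h, k, rfl, rfl, ha⟩

theorem sameBlock_equivalence : Equivalence (SameBlock G) where
  refl _ := .inl rfl
  symm := SameBlock.symm
  trans h k := by
    rw [← eqvGen_local_iff_sameBlock] at *
    exact h.trans _ _ _ k

theorem SameBlock.trans {e f g : G.edgeSet} (h : SameBlock G e f) (k : SameBlock G f g) :
    SameBlock G e g :=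
  sameBlock_equivalence.trans h k

/-- Two edges at `v` are in the same block exactly if their other ends are connected after
deletion of `v`. -/
theorem sameBlock_iff_avoids {u v w : V} (h : G.Adj u v) (k : G.Adj v w) :
    SameBlock G (edgeOf h) (edgeOf k) ↔ Avoids G v u w := by
  refine ⟨?_, SameBlock.of_avoids h k⟩
  rintro (he | ⟨x, c, hc, hy, ht⟩)
  · have : s(u, v) = s(v, w) := congrArg Subtype.val he
    rw [Sym2.eq_swap, Sym2.congr_right] at this
    rw [this]; exact .refl
  · exact hc.avoids hy ht

end Blocks

/-! ### Rooted spanning trees and preorder numberings -/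

section Tree

variable {V : Type*} {G T : SimpleGraph V} {r : V} {pre : V → ℕ}

theorem IsDesc.refl (T : SimpleGraph V) (r v : V) : IsDesc T r v v := Relation.ReflTransGen.refl

theorem IsDesc.trans {a b c : V} (h : IsDesc T r a b) (k : IsDesc T r b c) : IsDesc T r a c :=
  Relation.ReflTransGen.trans h k

theorem IsParent.isDesc {v p : V} (h : IsParent T r v p) : IsDesc T r v p :=
  Relation.ReflTransGen.single h

theorem IsDesc.dist_le {w v : V} (h : IsDesc T r w v) : T.dist r v ≤ T.dist r w := by
  induction h with
  | refl => exact le_rfl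
  | tail _ h ih => have := h.2; omega

theorem IsDesc.eq_of_dist_le {w v : V} (h : IsDesc T r w v) (hd : T.dist r w ≤ T.dist r v) :
    w = v := by
  rcases Relation.ReflTransGen.cases_head h with h | ⟨p, hp, h⟩
  · exact h
  · have := hp.2; have := IsDesc.dist_le h; omega

theorem IsParent.not_isDesc {v p : V} (h : IsParent T r v p) : ¬ IsDesc T r p v := fun k => by
  have := k.dist_le; have := h.2; omega

/-- Two parents would extend to two geodesics from the root to `v`, whereas paths in a tree are
unique. -/
theorem IsParent.unique (hT : T.IsTree) {v p q : V} (hp : IsParent T r v p)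
    (hq : IsParent T r v q) : p = q := by
  obtain ⟨P, hP⟩ := hT.connected.exists_walk_length_eq_dist r p
  obtain ⟨Q, hQ⟩ := hT.connected.exists_walk_length_eq_dist r q
  have h1 : (P.concat hp.1.symm).IsPath :=
    SimpleGraph.Walk.isPath_of_length_eq_dist _ (by
      rw [SimpleGraph.Walk.length_concat, hP]; exact hp.2.symm)
  have h2 : (Q.concat hq.1.symm).IsPath :=
    SimpleGraph.Walk.isPath_of_length_eq_dist _ (by
      rw [SimpleGraph.Walk.length_concat, hQ]; exact hq.2.symm)
  have := (hT.isAcyclic.subsingleton_path r v).elim ⟨_, h1⟩ ⟨_, h2⟩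
  exact (SimpleGraph.Walk.concat_inj (congrArg Subtype.val this)).1

theorem exists_isParent (hT : T.IsTree) {v : V} (hv : v ≠ r) : ∃ p, IsParent T r v p := by
  obtain ⟨P, hP⟩ := hT.connected.exists_walk_length_eq_dist v r
  cases P with
  | nil => exact absurd rfl hv
  | @cons _ p _ h P =>
    refine ⟨p, h, ?_⟩
    have h1 := SimpleGraph.dist_le P
    have h2 := hT.connected.dist_triangle (u := r) (v := p) (w := v)
    rw [SimpleGraph.dist_eq_one_iff_adj.2 h.symm] at h2
    rw [SimpleGraph.Walk.length_cons, SimpleGraph.dist_comm] at hP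
    rw [SimpleGraph.dist_comm] at h1
    omega

theorem not_isParent_root {p : V} : ¬ IsParent T r r p := fun h => by
  have := h.2; simp at this

theorem isParent_or_of_adj (hT : T.IsTree) {u v : V} (h : T.Adj u v) :
    IsParent T r u v ∨ IsParent T r v u :=
  (hT.dist_eq_dist_add_one_of_adj r h).imp (fun k => ⟨h, k⟩) fun k => ⟨h.symm, k⟩

theorem isDesc_root (hT : T.IsTree) (v : V) : IsDesc T r v r := by
  induction hn : T.dist r v using Nat.strong_induction_on generalizing v with
  | _ n ih =>
    by_cases hv : v = r
    · rw [hv]; exact .refl _ _ _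
    · obtain ⟨p, hp⟩ := exists_isParent hT hv
      exact hp.isDesc.trans (ih _ (by have := hp.2; omega) p rfl)

theorem IsDesc.total (hT : T.IsTree) {w a b : V} (ha : IsDesc T r w a) (hb : IsDesc T r w b) :
    IsDesc T r a b ∨ IsDesc T r b a :=
  Relation.ReflTransGen.total_of_right_unique (fun _ _ _ h k => h.unique hT k) ha hb

theorem IsDesc.of_parent (hT : T.IsTree) {w v p : V} (h : IsDesc T r w v) (hwv : w ≠ v)
    (hp : IsParent T r w p) : IsDesc T r p v := by
  rcases Relation.ReflTransGen.cases_head h with h | ⟨q, hq, h⟩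
  · exact absurd h hwv
  · rwa [hp.unique hT hq]

/-- A proper descendant of `v` is a descendant of a child of `v`. -/
theorem IsDesc.exists_child {w v : V} (h : IsDesc T r w v) (hwv : w ≠ v) :
    ∃ c, IsParent T r c v ∧ IsDesc T r w c := by
  rcases Relation.ReflTransGen.cases_tail h with h | ⟨c, h, hc⟩
  · exact absurd h.symm hwv
  · exact ⟨c, hc, h⟩

/-- The place where the path from `v` to the root enters the path from `w` to the root. -/
theorem exists_split (hT : T.IsTree) {v w : V} (hw : ¬ IsDesc T r w v) :
    ∃ z p, IsDesc T r v z ∧ IsParent T r z p ∧ ¬ IsDesc T r w z ∧ IsDesc T r w p := by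
  have hwr : IsDesc T r w r := isDesc_root hT w
  revert hw
  induction isDesc_root hT v using Relation.ReflTransGen.head_induction_on with
  | refl => exact fun hw => absurd hwr hw
  | @head a b hab _ ih =>
    intro hw
    by_cases hwb : IsDesc T r w b
    · exact ⟨a, b, .refl _ _ _, hab, hw, hwb⟩
    · obtain ⟨z, p, h1, h2⟩ := ih hwb
      exact ⟨z, p, hab.isDesc.trans h1, h2⟩

theorem child_eq_of_isDesc (hT : T.IsTree) {x a b v : V} (ha : IsParent T r a v)
    (hb : IsParent T r b v) (hxa : IsDesc T r x a) (hxb : IsDesc T r x b) : a = b := by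
  rcases hxa.total hT hxb with k | k
  · exact k.eq_of_dist_le (by rw [ha.2, hb.2])
  · exact (k.eq_of_dist_le (by rw [ha.2, hb.2])).symm

/-- A walk in the tree from a non-descendant of `p` to a proper ancestor of `p` avoids `p`. -/
theorem avoids_of_isDesc (hG : T ≤ G) {x a p : V} (h : IsDesc T r x a)
    (hx : ∀ y, IsDesc T r x y → IsDesc T r y a → y ≠ p) : Avoids G p x a := by
  induction h with
  | refl => exact .refl
  | @tail b c hb hc ih =>
    refine Relation.ReflTransGen.tail (ih fun y hy hyb => hx y hy (hyb.trans hc.isDesc)) ?_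
    exact ⟨hG hc.1, hx b hb hc.isDesc, hx c (IsDesc.trans hb hc.isDesc) (.refl _ _ _)⟩

/-- Both vertices climb to the root, and only descendants of `p` meet `p` on the way. -/
theorem avoids_of_not_isDesc (hT : T.IsTree) (hG : T ≤ G) {x y p : V} (hx : ¬ IsDesc T r x p)
    (hy : ¬ IsDesc T r y p) : Avoids G p x y := by
  have key : ∀ z, ¬ IsDesc T r z p → Avoids G p z r := fun z hz =>
    avoids_of_isDesc hG (isDesc_root hT z) fun w hw _ hwp => hz (hwp ▸ hw)
  exact (key x hx).trans (key y hy).symm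

/-- Two descendants of a child of `p` are connected without `p`. -/
theorem avoids_of_isDesc_child (hG : T ≤ G) {x y c p : V} (hc : IsParent T r c p)
    (hx : IsDesc T r x c) (hy : IsDesc T r y c) : Avoids G p x y := by
  have key : ∀ z, IsDesc T r z c → Avoids G p z c := fun z hz =>
    avoids_of_isDesc hG hz fun w _ hw hwp => hc.not_isDesc (hwp ▸ hw)
  exact (key x hx).trans (key y hy).symm

/-! ### Subtrees as preorder intervals, and generation of the blocks. -/

namespace IsPreorderedSpanningTree

variable (h : IsPreorderedSpanningTree G T r pre)
include h

theorem pre_le {w v : V} (hd : IsDesc T r w v) : pre v ≤ pre w := by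
  induction hd with
  | refl => exact le_rfl
  | tail _ hc ih => exact (h.parent_lt _ _ hc).le.trans ih

theorem pre_injective : Function.Injective pre := fun a b hab =>
  h.bijOn.injOn (Set.mem_univ a) (Set.mem_univ b) hab

/-- A vertex that is not a descendant of `v` comes before or after all descendants of `v`. -/
theorem lt_or_lt_of_not_isDesc {w v : V} (hw : ¬ IsDesc T r w v) :
    (∀ x, IsDesc T r x v → pre w < pre x) ∨ ∀ x, IsDesc T r x v → pre x < pre w := by
  -- Here `p` is the first ancestor of `v` above `w`. Either `w = p`, which precedes its whole
  -- subtree, or `w` lies below a sibling `b` of `z`, and the order of `z` and `b` decides.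
  obtain ⟨z, p, hvz, hzp, hwz, hwp⟩ := exists_split h.isTree hw
  by_cases hwp' : w = p
  · subst hwp'
    exact .inl fun x hx => (h.parent_lt _ _ hzp).trans_le (h.pre_le (hx.trans hvz))
  · obtain ⟨b, hb, hwb⟩ := hwp.exists_child hwp'
    have hne : pre z ≠ pre b := fun e => hwz (h.pre_injective e ▸ hwb)
    rcases hne.lt_or_gt with hlt | hlt
    · exact .inr fun x hx =>
        (h.sibling_lt p z b hzp hb hlt x (hx.trans hvz)).trans_le (h.pre_le hwb)
    · exact .inl fun x hx =>
        (h.sibling_lt p b z hb hzp hlt w hwb).trans_le (h.pre_le (hx.trans hvz))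

/-- All numbers from `pre v` to that of a descendant belong to descendants, because other vertices
come before or after the whole subtree. Counting gives the upper bound; counting also shows that a
vertex after the subtree has number at least `pre v + descCount T r v`. -/
theorem isDesc_iff [Finite V] {w v : V} :
    IsDesc T r w v ↔ pre v ≤ pre w ∧ pre w < pre v + descCount T r v := by
  have hfin : {x | IsDesc T r x v}.Finite := Set.toFinite _
  have hmem : pre v ∈ pre '' {x | IsDesc T r x v} := ⟨v, .refl _ _ _, rfl⟩
  have hcard : (pre '' {x | IsDesc T r x v}).ncard = descCount T r v :=
    Set.ncard_image_of_injective _ h.pre_injective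
  constructor
  · intro hd
    refine ⟨h.pre_le hd, ?_⟩
    have hsub : Set.Icc (pre v) (pre w) ⊆ pre '' {x | IsDesc T r x v} := by
      intro k hk
      obtain ⟨x, -, rfl⟩ := h.bijOn.surjOn (a := k)
        (lt_of_le_of_lt hk.2 (h.bijOn.mapsTo (Set.mem_univ w)))
      refine ⟨x, ?_, rfl⟩
      by_contra hx
      rcases h.lt_or_lt_of_not_isDesc hx with h1 | h1
      · exact absurd (h1 v (.refl _ _ _)) (not_lt.2 hk.1)
      · exact absurd (h1 w hd) (not_lt.2 hk.2)
    have := Set.ncard_le_ncard hsub (hfin.image _)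
    rw [hcard, Set.ncard_eq_toFinset_card'] at this
    simp at this
    omega
  · rintro ⟨h1, h2⟩
    by_contra hw
    rcases h.lt_or_lt_of_not_isDesc hw with h3 | h3
    · exact absurd (h3 v (.refl _ _ _)) (not_lt.2 h1)
    · have hsub : pre '' {x | IsDesc T r x v} ⊆ Set.Ico (pre v) (pre w) := by
        rintro _ ⟨x, hx, rfl⟩
        exact ⟨h.pre_le hx, h3 x hx⟩
      have := Set.ncard_le_ncard hsub (Set.finite_Ico _ _)
      rw [hcard, Set.ncard_eq_toFinset_card'] at this
      simp at this
      omega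

theorem not_isDesc_iff [Finite V] {w v : V} :
    ¬ IsDesc T r w v ↔ pre w < pre v ∨ pre v + descCount T r v ≤ pre w := by
  rw [h.isDesc_iff]; omega

/-- The condition on `low` and `high` says that the subtree neighbourhood of `v` is not contained in
the subtree of `p`. -/
theorem low_high_iff [Finite V] {v p : V} :
    (lowNum G T r pre v < pre p ∨ pre p + descCount T r p ≤ highNum G T r pre v) ↔
      ∃ x ∈ subtreeNbhd G T r v, ¬ IsDesc T r x p := by
  have hne : (pre '' subtreeNbhd G T r v).Nonempty :=
    ⟨_, Set.mem_image_of_mem _ (.inl (.refl _ _ _))⟩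
  have hb : BddAbove (pre '' subtreeNbhd G T r v) := (Set.toFinite _).bddAbove
  constructor
  · rintro (h1 | h1)
    · obtain ⟨x, hx, hx'⟩ := Nat.sInf_mem hne
      exact ⟨x, hx, h.not_isDesc_iff.2 (.inl (hx'.trans_lt h1))⟩
    · obtain ⟨x, hx, hx'⟩ := Nat.sSup_mem hne hb
      exact ⟨x, hx, h.not_isDesc_iff.2 (.inr (h1.trans_eq hx'.symm))⟩
  · rintro ⟨x, hx, hxp⟩
    rcases h.not_isDesc_iff.1 hxp with h1 | h1
    · exact .inl ((Nat.sInf_le (Set.mem_image_of_mem pre hx)).trans_lt h1)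
    · exact .inr (h1.trans (le_csSup hb (Set.mem_image_of_mem pre hx)))

/-- A local form of the generating relation. -/
theorem exists_avoids_of_sim0 [Finite V] {e f : G.edgeSet} (hef : Sim0 G T r pre e f) :
    ∃ (u v w : V) (a : G.Adj u v) (b : G.Adj v w), e = edgeOf a ∧ f = edgeOf b ∧
      Avoids G v u w := by
  rcases hef with ⟨w, v, p, he, hf, hp, -, hw⟩ | ⟨v, p, q, he, hf, hp, hq, hlh⟩
  · have ha : G.Adj w v := by have := e.2; rwa [he] at this
    refine ⟨w, v, p, ha, h.le hp.1, Subtype.ext he, Subtype.ext hf, ?_⟩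
    exact avoids_of_not_isDesc h.isTree h.le (h.not_isDesc_iff.2 hw) hp.not_isDesc
  · refine ⟨v, p, q, h.le hp.1, h.le hq.1, Subtype.ext he, Subtype.ext hf, ?_⟩
    -- A walk from `v` to `q` away from `p`: inside the subtree of `v` to `d`, along the non-tree
    -- edge to `x` outside the subtree of `p`, and through the root to `q`.
    obtain ⟨x, hx, hxp⟩ := h.low_high_iff.1 hlh
    rcases hx with hx | ⟨d, hd, hdx, -⟩
    · exact absurd (hx.trans hp.isDesc) hxp
    · refine (avoids_of_isDesc_child h.le hp (.refl _ _ _) hd).trans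
        (Relation.ReflTransGen.head ⟨hdx, ?_, ?_⟩
          (avoids_of_not_isDesc h.isTree h.le hxp hq.not_isDesc))
      · rintro rfl; exact hp.not_isDesc hd
      · rintro rfl; exact hxp (.refl _ _ _)

/-- A non-tree edge that leaves the subtree of `c` is equivalent to the edge from `c` to its
parent. -/
theorem eqvGen_of_leaves [Finite V] {x y c p : V} (hxy : G.Adj x y) (hT : ¬ T.Adj x y)
    (hx : IsDesc T r x c) (hy : ¬ IsDesc T r y c) (hp : IsParent T r c p) :
    Relation.EqvGen (Sim0 G T r pre) (edgeOf hxy) (edgeOf (h.le hp.1)) := by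
  induction hx generalizing p with
  | refl =>
    refine .rel _ _ (.inl ⟨y, x, p, Sym2.eq_swap, rfl, hp, fun k => hT k.symm, ?_⟩)
    exact h.not_isDesc_iff.1 hy
  | @tail b c hb hbc ih =>
    -- The same edge `xy` leaves the subtree of `c` as well, so it witnesses the `Sim2` pair formed
    -- by the edges above `b` and above `c`.
    refine .trans _ _ _ (ih (fun k => hy (k.trans hbc.isDesc)) hbc) (.rel _ _ (.inr ?_))
    exact ⟨b, c, p, rfl, rfl, hbc, hp, h.low_high_iff.2 ⟨y, .inr ⟨x, hb, hxy, hT⟩, hy⟩⟩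

/-- The tree edge at `v` towards another vertex `x`. -/
def IsTreeEdgeTowards (T : SimpleGraph V) (r v x : V) (e : G.edgeSet) : Prop :=
  (∃ c, IsParent T r c v ∧ IsDesc T r x c ∧ (e : Sym2 V) = s(c, v)) ∨
    (¬ IsDesc T r x v ∧ ∃ p, IsParent T r v p ∧ (e : Sym2 V) = s(v, p))

omit h in
theorem exists_isTreeEdgeTowards (h : IsPreorderedSpanningTree G T r pre) {v x : V} (hx : x ≠ v) :
    ∃ e : G.edgeSet, IsTreeEdgeTowards T r v x e := by
  by_cases hd : IsDesc T r x v
  · obtain ⟨c, hc, hxc⟩ := hd.exists_child hx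
    exact ⟨edgeOf (h.le hc.1), .inl ⟨c, hc, hxc, rfl⟩⟩
  · obtain ⟨p, hp⟩ := exists_isParent h.isTree (v := v) (r := r)
      (fun e => hd (e ▸ isDesc_root h.isTree x))
    exact ⟨edgeOf (h.le hp.1), .inr ⟨hd, p, hp, rfl⟩⟩

theorem IsTreeEdgeTowards.unique {v x : V} {e f : G.edgeSet}
    (he : IsTreeEdgeTowards T r v x e) (hf : IsTreeEdgeTowards T r v x f) : e = f := by
  rcases he with ⟨c, hc, hxc, he⟩ | ⟨hx, p, hp, he⟩ <;>
    rcases hf with ⟨c', hc', hxc', hf⟩ | ⟨hx', p', hp', hf⟩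
  · rw [child_eq_of_isDesc h.isTree hc hc' hxc hxc'] at he
    exact Subtype.ext (he.trans hf.symm)
  · exact absurd (hxc.trans hc.isDesc) hx'
  · exact absurd (hxc'.trans hc'.isDesc) hx
  · rw [hp.unique h.isTree hp'] at he
    exact Subtype.ext (he.trans hf.symm)

/-- A tree edge at `v` is itself the edge towards its other end. A non-tree edge leaves the subtree
of a child of `v` or the subtree of `v`, and `eqvGen_of_leaves` applies. -/
theorem eqvGen_of_towards_of_adj [Finite V] {v u : V} (huv : G.Adj u v) {e : G.edgeSet}
    (he : IsTreeEdgeTowards T r v u e) :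
    Relation.EqvGen (Sim0 G T r pre) (edgeOf huv) e := by
  by_cases ht : T.Adj u v
  · have : e = edgeOf huv := by
      rcases isParent_or_of_adj h.isTree (r := r) ht with hp | hp
      · exact IsTreeEdgeTowards.unique h he (.inl ⟨u, hp, .refl _ _ _, rfl⟩)
      · exact IsTreeEdgeTowards.unique h he (.inr ⟨hp.not_isDesc, u, hp, Sym2.eq_swap⟩)
    rw [this]; exact .refl _
  · rcases he with ⟨c, hc, huc, he⟩ | ⟨hu, p, hp, he⟩
    · have := h.eqvGen_of_leaves huv ht huc hc.not_isDesc hc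
      rwa [show e = edgeOf (h.le hc.1) from Subtype.ext he]
    · have := h.eqvGen_of_leaves huv.symm (fun k => ht k.symm) (.refl _ _ _) hu hp
      rwa [edgeOf_comm huv, ← show e = edgeOf (h.le hp.1) from Subtype.ext he] at this

/-- One step of a walk in `G - v`. If it changes the branch at `v`, it uses a non-tree edge one end
of which lies below a child of `v`; this edge is equivalent to the tree edges towards both of its
ends. -/
theorem eqvGen_of_towards_of_towards [Finite V] {v x y : V} (hxy : G.Adj x y) (hx : x ≠ v)
    (hy : y ≠ v) {e f : G.edgeSet} (he : IsTreeEdgeTowards T r v x e)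
    (hf : IsTreeEdgeTowards T r v y f) : Relation.EqvGen (Sim0 G T r pre) e f := by
  -- either both ends lie on the same side of `v`, or the edge is equivalent to both tree edges
  have side : ∀ {x y : V} (hxy : G.Adj x y), x ≠ v → y ≠ v → ∀ {e : G.edgeSet},
      IsTreeEdgeTowards T r v x e → IsTreeEdgeTowards T r v y e ∨
        (¬ T.Adj x y ∧ ∃ c, IsParent T r c v ∧ IsDesc T r x c ∧ ¬ IsDesc T r y c ∧
          (e : Sym2 V) = s(c, v)) ∨
        (¬ T.Adj x y ∧ ¬ IsDesc T r x v ∧ IsDesc T r y v ∧ ∃ p, IsParent T r v p ∧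
          (e : Sym2 V) = s(v, p)) := by
    intro x y hxy hx hy e he
    rcases he with ⟨c, hc, hxc, he⟩ | ⟨hxv, p, hp, he⟩
    · by_cases hyc : IsDesc T r y c
      · exact .inl (.inl ⟨c, hc, hyc, he⟩)
      · refine .inr (.inl ⟨fun ht => ?_, c, hc, hxc, hyc, he⟩)
        rcases isParent_or_of_adj h.isTree (r := r) ht with k | k
        · by_cases hxc' : x = c
          · subst hxc'; exact hy (k.unique h.isTree hc)
          · exact hyc (hxc.of_parent h.isTree hxc' k)
        · exact hyc (k.isDesc.trans hxc)
    · by_cases hyv : IsDesc T r y v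
      · refine .inr (.inr ⟨fun ht => ?_, hxv, hyv, p, hp, he⟩)
        rcases isParent_or_of_adj h.isTree (r := r) ht with k | k
        · exact hxv (k.isDesc.trans hyv)
        · exact hxv (hyv.of_parent h.isTree hy k)
      · exact .inl (.inr ⟨hyv, p, hp, he⟩)
  -- a non-tree edge between different sides
  have leave : ∀ {x y : V} (hxy : G.Adj x y), ¬ T.Adj x y → ∀ {c : V}, IsParent T r c v →
      IsDesc T r x c → ¬ IsDesc T r y c → ∀ {e f : G.edgeSet}, (e : Sym2 V) = s(c, v) → y ≠ v →
      IsTreeEdgeTowards T r v y f → Relation.EqvGen (Sim0 G T r pre) e f := by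
    intro x y hxy ht c hc hxc hyc e f he hy hf
    have h1 := h.eqvGen_of_leaves hxy ht hxc hyc hc
    rw [← show e = edgeOf (h.le hc.1) from Subtype.ext he] at h1
    rcases hf with ⟨c', hc', hyc', hf⟩ | ⟨hyv, p, hp, hf⟩
    · have hxc' : ¬ IsDesc T r x c' := fun k =>
        hyc (child_eq_of_isDesc h.isTree hc hc' hxc k ▸ hyc')
      have h2 := h.eqvGen_of_leaves hxy.symm (fun k => ht k.symm) hyc' hxc' hc'
      rw [edgeOf_comm hxy, ← show f = edgeOf (h.le hc'.1) from Subtype.ext hf] at h2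
      exact .trans _ _ _ (.symm _ _ h1) h2
    · have h2 := h.eqvGen_of_leaves hxy ht (hxc.trans hc.isDesc) hyv hp
      rw [← show f = edgeOf (h.le hp.1) from Subtype.ext hf] at h2
      exact .trans _ _ _ (.symm _ _ h1) h2
  rcases side hxy hx hy he with h1 | ⟨ht, c, hc, hxc, hyc, hec⟩ | ⟨ht, hxv, hyv, p, hp, hep⟩
  · rw [IsTreeEdgeTowards.unique h h1 hf]; exact .refl _
  · exact leave hxy ht hc hxc hyc hec hy hf
  · obtain ⟨c, hc, hyc⟩ := hyv.exists_child hy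
    have hfc : (f : Sym2 V) = s(c, v) := by
      rw [IsTreeEdgeTowards.unique h hf (f := edgeOf (h.le hc.1)) (.inl ⟨c, hc, hyc, rfl⟩)]; rfl
    exact .symm _ _ (leave hxy.symm (fun k => ht k.symm) hc hyc
      (fun k => hxv (k.trans hc.isDesc)) hfc hx he)

/-- Along a walk from `u` in `G - v`, the edge `uv` stays equivalent to the tree edge at `v` towards
the current vertex; at `w` this tree edge is equivalent to `vw`. -/
theorem eqvGen_of_avoids [Finite V] {u v w : V} (a : G.Adj u v) (b : G.Adj v w)
    (hav : Avoids G v u w) : Relation.EqvGen (Sim0 G T r pre) (edgeOf a) (edgeOf b) := by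
  have key : ∀ {x}, Avoids G v u x → x ≠ v ∧ ∃ e, IsTreeEdgeTowards T r v x e ∧
      Relation.EqvGen (Sim0 G T r pre) (edgeOf a) e := by
    intro x hx
    induction hx with
    | refl =>
      obtain ⟨e, he⟩ := exists_isTreeEdgeTowards h a.ne
      exact ⟨a.ne, e, he, h.eqvGen_of_towards_of_adj a he⟩
    | tail _ hbc ih =>
      obtain ⟨hb, e, he, hae⟩ := ih
      obtain ⟨f, hf⟩ := exists_isTreeEdgeTowards h hbc.2.2
      exact ⟨hbc.2.2, f, hf, .trans _ _ _ hae (h.eqvGen_of_towards_of_towards hbc.1 hb hbc.2.2 he hf)⟩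
  obtain ⟨-, e, he, hae⟩ := key hav
  have := h.eqvGen_of_towards_of_adj b.symm he
  rw [edgeOf_comm b] at this
  exact .trans _ _ _ hae (.symm _ _ this)

theorem eqvGen_sim0_iff [Finite V] (e f : G.edgeSet) :
    Relation.EqvGen (Sim0 G T r pre) e f ↔ SameBlock G e f := by
  constructor
  · intro hef
    rw [← eqvGen_local_iff_sameBlock]
    exact hef.mono fun _ _ => h.exists_avoids_of_sim0
  · exact SameBlock.rel_of_local (Relation.EqvGen.is_equivalence _)
      fun _ _ _ a b hav => h.eqvGen_of_avoids a b hav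

theorem sameBlock_le_iff [Finite V] {R : G.edgeSet → G.edgeSet → Prop} (hR : Equivalence R) :
    (∀ e f, SameBlock G e f → R e f) ↔
      ∀ (u v w : V) (a : G.Adj u v) (b : G.Adj v w),
        Sim0 G T r pre (edgeOf a) (edgeOf b) → R (edgeOf a) (edgeOf b) := by
  constructor
  · exact fun hle u v w a b hab => hle _ _ ((h.eqvGen_sim0_iff _ _).1 (.rel _ _ hab))
  · intro hloc e f hef
    rw [← h.eqvGen_sim0_iff] at hef
    have := hef.mono (p := R) fun e f hef => by
      obtain ⟨u, v, w, a, b, rfl, rfl, -⟩ := h.exists_avoids_of_sim0 hef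
      exact hloc u v w a b hef
    exact (hR.eqvGen_iff).1 this

end IsPreorderedSpanningTree

/-- The generating relation of every preordered spanning tree relates only adjacent edges, generates
the block relation, and therefore locally decides whether the block relation refines another one. -/
theorem sim0_generates_blocks (V : Type*) [Finite V] (G T : SimpleGraph V) (r : V) (pre : V → ℕ)
    (h : IsPreorderedSpanningTree G T r pre) :
    (∀ e f : G.edgeSet, Sim0 G T r pre e f → ∃ v, v ∈ (e : Sym2 V) ∧ v ∈ (f : Sym2 V)) ∧
    (∀ e f : G.edgeSet, Relation.EqvGen (Sim0 G T r pre) e f ↔ SameBlock G e f) ∧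
    (∀ R : G.edgeSet → G.edgeSet → Prop, Equivalence R →
      ((∀ e f, SameBlock G e f → R e f) ↔
        ∀ (u v w : V) (h : G.Adj u v) (k : G.Adj v w),
          Sim0 G T r pre (edgeOf h) (edgeOf k) → R (edgeOf h) (edgeOf k))) := by
  refine ⟨fun e f hef => ?_, h.eqvGen_sim0_iff, fun R hR => h.sameBlock_le_iff hR⟩
  obtain ⟨u, v, w, a, b, rfl, rfl, -⟩ := h.exists_avoids_of_sim0 hef
  exact ⟨v, Sym2.mem_mk_right _ _, Sym2.mem_mk_left _ _⟩

end Tree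

/-! ### Messages with several independent channels -/

/-- The kinds of information that are exchanged. A message carries at most one number per channel,
so that the stages of an algorithm can be described independently of each other. -/
inductive Chan
  | flood | up | down | number | range | chunk | sum | label | labelX | ok | verdict

/-- The value 0 is reserved for an empty channel. -/
def slot (o : Option ℕ) : ℕ := o.elim 0 (· + 1)

theorem slot_injective : Function.Injective slot := by
  intro a b h
  cases a <;> cases b <;> simp_all [slot]

/-- The content of a message as one number. -/
def packNat (f : Chan → Option ℕ) : ℕ :=
  Nat.pair (slot (f .flood)) <| Nat.pair (slot (f .up)) <| Nat.pair (slot (f .down)) <|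
  Nat.pair (slot (f .number)) <| Nat.pair (slot (f .range)) <| Nat.pair (slot (f .chunk)) <|
  Nat.pair (slot (f .sum)) <| Nat.pair (slot (f .label)) <| Nat.pair (slot (f .labelX)) <|
  Nat.pair (slot (f .ok)) (slot (f .verdict))

theorem packNat_injective : Function.Injective packNat := by
  intro f g h
  simp only [packNat, Nat.pair_eq_pair, slot_injective.eq_iff] at h
  obtain ⟨h1, h2, h3, h4, h5, h6, h7, h8, h9, h10, h11⟩ := h
  funext c
  cases c <;> assumption

theorem pair_lt_sq {a b X : ℕ} (ha : a < X) (hb : b < X) : Nat.pair a b < X ^ 2 :=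
  (Nat.pair_lt_max_add_one_sq a b).trans_le (Nat.pow_le_pow_left (by omega) 2)

/-- Eleven channels need ten nested pairings, each of which at most squares the bound; hence the
factor `1024 = 2 ^ 10` in the exponent. -/
theorem packNat_lt {f : Chan → Option ℕ} {b : ℕ} (h : ∀ c, slot (f c) < 2 ^ b) :
    packNat f < 2 ^ (b * 1024) := by
  have step : ∀ {a x k : ℕ}, a < 2 ^ b → x < 2 ^ (b * k) → 1 ≤ k →
      Nat.pair a x < 2 ^ (b * (k * 2)) := by
    intro a x k ha hx hk
    rw [← mul_assoc, pow_mul]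
    exact pair_lt_sq (ha.trans_le (Nat.pow_le_pow_right two_pos (Nat.le_mul_of_pos_right b hk))) hx
  have := step (k := 512) (h .flood) (step (k := 256) (h .up) (step (k := 128) (h .down)
    (step (k := 64) (h .number) (step (k := 32) (h .range) (step (k := 16) (h .chunk)
    (step (k := 8) (h .sum) (step (k := 4) (h .label) (step (k := 2) (h .labelX)
    (step (k := 1) (h .ok) (by simpa using h .verdict) (by norm_num)) (by norm_num))
    (by norm_num)) (by norm_num)) (by norm_num)) (by norm_num)) (by norm_num)) (by norm_num))
    (by norm_num)) (by norm_num)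
  exact this

def pack (f : Chan → Option ℕ) : Message := (packNat f).bits

theorem bits_injective : Function.Injective Nat.bits := by
  intro a b h
  have key : ∀ n : ℕ, n.bits.foldr (fun b n => Nat.bit b n) 0 = n := by
    intro n
    induction n using Nat.binaryRec' with
    | zero => simp
    | bit b n hn ih => rw [Nat.bits_append_bit _ _ hn, List.foldr_cons, ih]
  rw [← key a, ← key b, h]

theorem pack_injective : Function.Injective pack :=
  fun _ _ h => packNat_injective (bits_injective h)

theorem length_pack_le {f : Chan → Option ℕ} {b : ℕ} (h : ∀ c, slot (f c) < 2 ^ b) :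
    (pack f).length ≤ b * 1024 := by
  rw [pack, Nat.size_eq_bits_len, Nat.size_le]
  exact packNat_lt h

open Classical in
/-- The message with the given content; no message is sent if there is no content. -/
noncomputable def toMsg (f : Chan → Option ℕ) : Option Message :=
  if f = fun _ => none then none else some (pack f)

noncomputable def ofMsg (m : Option Message) : Chan → Option ℕ :=
  m.elim (fun _ => none) (Function.invFun pack)

theorem ofMsg_toMsg (f : Chan → Option ℕ) : ofMsg (toMsg f) = f := by
  unfold toMsg
  split_ifs with h
  · rw [h]; rfl
  · exact Function.leftInverse_invFun pack_injective f

@[simp] theorem ofMsg_none : ofMsg none = fun _ => none := rfl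

theorem toMsg_isSome {f : Chan → Option ℕ} : (toMsg f).isSome ↔ ∃ c, (f c).isSome := by
  unfold toMsg
  split_ifs with h
  · simp [h]
  · simp only [Option.isSome_some, true_iff]
    by_contra hc
    push Not at hc
    exact h (funext fun c => by simpa using hc c)

/-! ### Programs with a global clock and complete memory -/

/-- What has been received: the content of a channel by round of sending and sender. -/
abbrev Hist := ℕ → ℕ → Chan → Option ℕ

/-- The knowledge of a vertex: its initial view, the number of the current round, everything it has
received, and all its coins so far. -/
structure Know where
  view : LocalView
  time : ℕ
  hist : Hist
  coin : ℕ → ℕ → Bool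

/-- A program: how many coins are tossed, and what is sent to which neighbour. -/
structure Program where
  toss : Know → ℕ
  send : Know → ℕ → Chan → Option ℕ

/-- Reading the messages of the previous round and tossing coins. -/
noncomputable def Know.listen (K : Know) (inb : ℕ → Option Message) (cs : List Bool) : Know where
  view := K.view
  time := K.time
  hist := Function.update K.hist (K.time - 1) fun j => ofMsg (inb j)
  coin := Function.update K.coin K.time fun i => cs.getD i false

namespace Program

/-- The distributed algorithm that runs a program until a halting rule applies. -/
noncomputable def alg (P : Program) {Out : Type} (halt : Know → Option Out) : DistAlg Out where
  State := Know
  init L := ⟨L, 0, fun _ _ _ => none, fun _ _ => false⟩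
  coins := P.toss
  step K inb cs :=
    ({ K.listen inb cs with time := K.time + 1 }, fun j => toMsg (P.send (K.listen inb cs) j))
  output := halt

variable {V : Type*} [Fintype V] [DecidableEq V] (P : Program) (G : SimpleGraph V)
  [DecidableRel G.Adj] (N : Network V) (ω : Coins V)

/-- The run of the program without halting. -/
noncomputable def ideal (t : ℕ) : DistConfig V Know :=
  (P.alg fun _ => (none : Option Unit)).config G N ω t

/-- The content of the message from `u` to `v` in round `t`. -/
noncomputable def sent (t : ℕ) (u v : V) : Chan → Option ℕ :=
  ofMsg ((P.ideal G N ω (t + 1)).msg u v)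

/-- What `v` has received in round `t`. -/
noncomputable def heard (t : ℕ) (v : V) : Hist := fun i j c =>
  if i < t then (Function.partialInv N.ident j).bind fun u => P.sent G N ω i u v c else none

/-- The coins of `v` up to round `t`. -/
noncomputable def tossed (t : ℕ) (v : V) : ℕ → ℕ → Bool := fun i x =>
  if i ≤ t ∧ x < P.toss ((P.ideal G N ω i).state v) then ω (v, i, x) else false

/-- The knowledge of `v` in round `t`. -/
noncomputable def know (t : ℕ) (v : V) : Know :=
  ⟨DistAlg.view G N v, t, P.heard G N ω t v, P.tossed G N ω t v⟩

theorem ideal_succ (t : ℕ) : P.ideal G N ω (t + 1) =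
    (P.alg fun _ => (none : Option Unit)).round G N (fun v i => ω (v, t, i)) (P.ideal G N ω t) :=
  rfl

theorem ideal_msg_of_not_adj (t : ℕ) {u v : V} (h : ¬ G.Adj u v) :
    (P.ideal G N ω t).msg u v = none := by
  cases t with
  | zero => rfl
  | succ t => rw [ideal_succ]; simp [DistAlg.round, h]

theorem state_succ_eq_listen (t : ℕ) (v : V) :
    (P.ideal G N ω (t + 1)).state v =
      { ((P.ideal G N ω t).state v).listen (DistAlg.inbox N (P.ideal G N ω t).msg v)
          ((List.range (P.toss ((P.ideal G N ω t).state v))).map fun i => ω (v, t, i)) with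
        time := ((P.ideal G N ω t).state v).time + 1 } := by
  rw [ideal_succ]; rfl

/-- This identifies the operational state with an explicit description: having read its inbox in
round `t`, a vertex knows exactly the messages of rounds before `t` and its coins up to round `t`.
-/
theorem listen_eq_know (t : ℕ) (v : V) :
    ((P.ideal G N ω t).state v).listen (DistAlg.inbox N (P.ideal G N ω t).msg v)
      ((List.range (P.toss ((P.ideal G N ω t).state v))).map fun i => ω (v, t, i)) =
        P.know G N ω t v ∧ ((P.ideal G N ω t).state v).time = t := by
  have hc : ∀ x, ((List.range (P.toss ((P.ideal G N ω t).state v))).map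
      fun i => ω (v, t, i)).getD x false =
        if x < P.toss ((P.ideal G N ω t).state v) then ω (v, t, x) else false := by
    intro x
    by_cases hx : x < P.toss ((P.ideal G N ω t).state v) <;> simp [List.getD, hx]
  induction t with
  | zero =>
    refine ⟨?_, rfl⟩
    -- In round 0 the index of the previous round is truncated to 0 as well. The entry written there
    -- is empty and is overwritten in round 1.
    have h0 : ((P.ideal G N ω 0).state v).time = 0 := rfl
    unfold Know.listen
    rw [h0]
    unfold know
    congr 1
    · funext i j c
      rw [Function.update_apply]
      split_ifs with hi
      · change ofMsg ((Function.partialInv N.ident j).bind fun _ => none) c = _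
        simp [heard]
      · simp [heard]; rfl
    · funext i x
      rw [Function.update_apply]
      unfold tossed
      split_ifs with hi hx hx
      · subst hi; exact (hc x).trans (if_pos hx.2)
      · subst hi; exact (hc x).trans (if_neg fun h => hx ⟨le_rfl, h⟩)
      · exact absurd (Nat.le_zero.1 hx.1) hi
      · rfl
  | succ t ih =>
    have ih := ih (fun x => by
      by_cases hx : x < P.toss ((P.ideal G N ω t).state v) <;> simp [List.getD, hx])
    have hs := P.state_succ_eq_listen G N ω t v
    rw [ih.1, ih.2] at hs
    have ht : ((P.ideal G N ω (t + 1)).state v).time = t + 1 := by rw [hs]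
    refine ⟨?_, ht⟩
    unfold Know.listen
    rw [ht]
    unfold know
    congr 1
    · rw [hs]; rfl
    · funext i j c
      rw [Function.update_apply]
      split_ifs with hi
      · subst hi
        simp only [heard, Nat.lt_succ_self, if_true, DistAlg.inbox]
        cases Function.partialInv N.ident j <;> simp [sent]
      · rw [hs]
        simp only [know, heard, Nat.add_sub_cancel] at hi ⊢
        by_cases h1 : i < t
        · rw [if_pos h1, if_pos (by omega)]
        · rw [if_neg h1, if_neg (by omega)]
    · funext i x
      rw [Function.update_apply]
      split_ifs with hi
      · subst hi
        exact (hc x).trans (by simp [tossed])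
      · have h1 : ((P.ideal G N ω (t + 1)).state v).coin i x = P.tossed G N ω t v i x := by
          rw [hs]; rfl
        rw [h1]
        unfold tossed
        congr 1
        simp only [eq_iff_iff, and_congr_left_iff]
        omega

theorem state_succ (t : ℕ) (v : V) : (P.ideal G N ω (t + 1)).state v =
    { P.know G N ω t v with time := t + 1 } := by
  rw [state_succ_eq_listen, (P.listen_eq_know G N ω t v).1, (P.listen_eq_know G N ω t v).2]

/-- A state precedes the reading of the last messages, hence the index `t - 1`. Halting rules see
states, so they work with this delay of one round. -/
theorem state_hist (t : ℕ) (v : V) :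
    ((P.ideal G N ω t).state v).hist = P.heard G N ω (t - 1) v := by
  cases t with
  | zero => funext i j c; simp [heard]; rfl
  | succ t => rw [state_succ]; rfl

theorem state_view (t : ℕ) (v : V) :
    ((P.ideal G N ω t).state v).view = DistAlg.view G N v := by
  cases t with
  | zero => rfl
  | succ t => rw [state_succ]; rfl

theorem state_time (t : ℕ) (v : V) : ((P.ideal G N ω t).state v).time = t :=
  (P.listen_eq_know G N ω t v).2

theorem msg_succ (t : ℕ) (u v : V) : (P.ideal G N ω (t + 1)).msg u v =
    if G.Adj u v then toMsg (P.send (P.know G N ω t u) (N.ident v)) else none := by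
  by_cases h : G.Adj u v
  · rw [if_pos h, ← (P.listen_eq_know G N ω t u).1, ideal_succ]
    simp [DistAlg.round, h, alg]
  · rw [if_neg h, ideal_msg_of_not_adj _ _ _ _ _ h]

theorem sent_of_adj (t : ℕ) {u v : V} (h : G.Adj u v) :
    P.sent G N ω t u v = P.send (P.know G N ω t u) (N.ident v) := by
  rw [sent, msg_succ, if_pos h, ofMsg_toMsg]

theorem sent_of_not_adj (t : ℕ) {u v : V} (h : ¬ G.Adj u v) (c : Chan) :
    P.sent G N ω t u v c = none := by
  rw [sent, msg_succ, if_neg h, ofMsg_none]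

theorem heard_ident (t i : ℕ) (u v : V) (c : Chan) :
    P.heard G N ω t v i (N.ident u) c = if i < t then P.sent G N ω i u v c else none := by
  unfold heard
  rw [Function.partialInv_left N.ident.injective]
  rfl

theorem exists_of_heard {t i j : ℕ} {v : V} {c : Chan} {x : ℕ}
    (h : P.heard G N ω t v i j c = some x) :
    i < t ∧ ∃ u, N.ident u = j ∧ G.Adj u v ∧ P.sent G N ω i u v c = some x := by
  unfold heard at h
  split_ifs at h with hi
  obtain ⟨u, hu, hx⟩ := Option.bind_eq_some_iff.1 h
  refine ⟨hi, u, (N.ident.injective.isPartialInv u j).1 hu, ?_, hx⟩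
  by_contra hadj
  rw [sent_of_not_adj _ _ _ _ _ hadj] at hx
  simp at hx

/-! #### Halting -/

variable {Out : Type} (halt : Know → Option Out)

/-- Until the first vertex halts, halting has no effect on the run. -/
theorem config_eq_ideal {t : ℕ}
    (h : ∀ s < t, ∀ v, halt ((P.ideal G N ω s).state v) = none) :
    (P.alg halt).config G N ω t = P.ideal G N ω t := by
  induction t with
  | zero => rfl
  | succ t ih =>
    have ih := ih fun s hs => h s (by omega)
    have ht := h t (by omega)
    rw [ideal_succ]
    change (P.alg halt).round G N (fun v i => ω (v, t, i)) ((P.alg halt).config G N ω t) = _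
    rw [ih]
    simp [DistAlg.round, alg, ht]

theorem config_halted {t s : ℕ} (hts : t ≤ s) {v : V} {o : Out}
    (h : halt (((P.alg halt).config G N ω t).state v) = some o) :
    ((P.alg halt).config G N ω s).state v = ((P.alg halt).config G N ω t).state v ∧
      (t < s → ∀ u, ((P.alg halt).config G N ω s).msg v u = none) := by
  induction s, hts using Nat.le_induction with
  | base => exact ⟨rfl, fun h => absurd h (lt_irrefl _)⟩
  | succ s hs ih =>
    have h1 : (P.alg halt).output (((P.alg halt).config G N ω s).state v) = some o := by
      rw [ih.1]; exact h
    refine ⟨?_, fun _ u => ?_⟩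
    · rw [← ih.1]
      change ((P.alg halt).round G N (fun v i => ω (v, s, i))
        ((P.alg halt).config G N ω s)).state v = _
      simp [DistAlg.round, h1]
    · change ((P.alg halt).round G N (fun v i => ω (v, s, i))
        ((P.alg halt).config G N ω s)).msg v u = _
      simp [DistAlg.round, h1]

variable {Q : ℕ → Prop} (hQ : ∀ t v, (halt ((P.ideal G N ω t).state v)).isSome ↔ Q t)
include hQ

/-- Whether a vertex halts depends on the round only, so all vertices halt together in the first
round satisfying `Q`. Until then the run is the ideal one, and afterwards the results are frozen. -/
theorem exists_of_haltsWith [Nonempty V] {t : ℕ} {out : V → Out}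
    (h : (P.alg halt).HaltsWith G N ω t out) :
    ∃ T ≤ t, Q T ∧ ∀ v, halt ((P.ideal G N ω T).state v) = some (out v) := by
  classical
  have hex : ∃ T, Q T := by
    by_contra hn
    push Not at hn
    obtain ⟨v⟩ := ‹Nonempty V›
    have h1 := h v
    rw [P.config_eq_ideal G N ω halt (t := t)] at h1
    · exact hn t ((hQ t v).1 (by rw [show halt _ = _ from h1]; rfl))
    · intro s _ u
      have := mt (hQ s u).1 (hn s)
      simpa using this
  have hmin : ∀ s < Nat.find hex, ∀ v, halt ((P.ideal G N ω s).state v) = none := by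
    intro s hs v
    have := mt (hQ s v).1 (Nat.find_min hex hs)
    simpa using this
  by_cases ht : t < Nat.find hex
  · obtain ⟨v⟩ := ‹Nonempty V›
    have h1 := h v
    rw [P.config_eq_ideal G N ω halt (fun s hs => hmin s (hs.trans ht))] at h1
    rw [show (P.alg halt).output _ = halt _ from rfl, hmin t ht v] at h1
    simp at h1
  · push Not at ht
    refine ⟨_, ht, Nat.find_spec hex, fun v => ?_⟩
    have h2 := (hQ _ v).2 (Nat.find_spec hex)
    obtain ⟨o, ho⟩ := Option.isSome_iff_exists.1 h2
    rw [← P.config_eq_ideal G N ω halt hmin] at ho ⊢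
    have h3 := (P.config_halted G N ω halt ht ho).1
    have h1 := h v
    rw [h3] at h1
    exact h1

omit hQ in
theorem exists_min_of_exists {T : ℕ} (hT : Q T) :
    ∃ T₀ ≤ T, Q T₀ ∧ ∀ s < T₀, ¬ Q s := by
  classical
  exact ⟨Nat.find ⟨T, hT⟩, Nat.find_min' _ hT, Nat.find_spec ⟨T, hT⟩, fun s => Nat.find_min _⟩

theorem haltsWith_of_min {T : ℕ} (hT : Q T) (hmin : ∀ s < T, ¬ Q s) :
    (P.alg halt).config G N ω T = P.ideal G N ω T ∧
      ∃ out, (P.alg halt).HaltsWith G N ω T out := by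
  have hc := P.config_eq_ideal G N ω halt (t := T) fun s hs v => by
    simpa using mt (hQ s v).1 (hmin s hs)
  refine ⟨hc, fun v => ((halt ((P.ideal G N ω T).state v)).get ((hQ T v).2 hT)), fun v => ?_⟩
  rw [hc]
  exact (Option.some_get _).symm

theorem time_le {T : ℕ} (hT : Q T) : (P.alg halt).time G N ω ≤ T := by
  obtain ⟨T₀, hle, hT₀, hmin⟩ := exists_min_of_exists hT
  refine (iInf₂_le T₀ (P.haltsWith_of_min G N ω halt hQ hT₀ hmin).2).trans ?_
  exact_mod_cast hle

open Classical in
-- The snapshot after `t + 1` rounds shows the messages of round `t`, the initial one shows none,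
-- and those after the common halting round are empty.
theorem messages_le {T : ℕ} (hT : Q T) : (P.alg halt).messages G N ω ≤
    ∑ t ∈ Finset.range T,
      ((Finset.univ.filter fun p : V × V => ∃ c, (P.sent G N ω t p.1 p.2 c).isSome).card :
        ℝ≥0∞) := by
  obtain ⟨T₀, hle, hT₀, hmin⟩ := exists_min_of_exists hT
  obtain ⟨hc, out, hout⟩ := P.haltsWith_of_min G N ω halt hQ hT₀ hmin
  have hideal : ∀ t ≤ T₀, (P.alg halt).config G N ω t = P.ideal G N ω t := fun t ht =>
    P.config_eq_ideal G N ω halt fun s hs v => by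
      simpa using mt (hQ s v).1 (hmin s (by omega))
  have hzero : ∀ t, t ∉ Finset.range (T₀ + 1) →
      ((Finset.univ.filter fun p : V × V =>
        (((P.alg halt).config G N ω t).msg p.1 p.2).isSome).card : ℝ≥0∞) = 0 := by
    intro t ht
    simp only [Finset.mem_range] at ht
    rw [Nat.cast_eq_zero, Finset.card_eq_zero, Finset.filter_eq_empty_iff]
    intro p _
    rw [(P.config_halted G N ω halt (t := T₀) (s := t) (by omega) (hout p.1)).2 (by omega)]
    simp
  unfold DistAlg.messages
  rw [tsum_eq_sum (s := Finset.range (T₀ + 1)) fun t ht => hzero t ht,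
    Finset.sum_range_succ']
  have h0 : ((Finset.univ.filter fun p : V × V =>
        (((P.alg halt).config G N ω 0).msg p.1 p.2).isSome).card : ℝ≥0∞) = 0 := by
    rw [Nat.cast_eq_zero, Finset.card_eq_zero, Finset.filter_eq_empty_iff]
    intro p _
    simp [DistAlg.config]
  rw [h0, add_zero]
  refine le_trans ?_ (Finset.sum_le_sum_of_subset (Finset.range_mono hle))
  refine Finset.sum_le_sum fun t ht => ?_
  rw [hideal (t + 1) (by have := Finset.mem_range.1 ht; omega)]
  refine Nat.cast_le.2 (Finset.card_le_card fun p hp => ?_)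
  simp only [Finset.mem_filter, Finset.mem_univ, true_and] at hp ⊢
  rw [msg_succ] at hp
  split_ifs at hp with hadj
  · obtain ⟨c, hcc⟩ := toMsg_isSome.1 hp
    exact ⟨c, by rwa [sent_of_adj _ _ _ _ _ hadj]⟩
  · simp at hp

open Classical in
/-- The number of messages, if every edge carries few messages in each direction. -/
theorem messages_le_of_card_le {T M : ℕ} (hT : Q T)
    (hM : ∀ u v, G.Adj u v →
      ((Finset.range T).filter fun t => ∃ c, (P.sent G N ω t u v c).isSome).card ≤ M) :
    (P.alg halt).messages G N ω ≤ 2 * G.edgeFinset.card * M := by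
  refine (P.messages_le G N ω halt hQ hT).trans ?_
  have hswap : ∑ t ∈ Finset.range T,
      (Finset.univ.filter fun p : V × V => ∃ c, (P.sent G N ω t p.1 p.2 c).isSome).card =
        ∑ p : V × V, ((Finset.range T).filter fun t =>
          ∃ c, (P.sent G N ω t p.1 p.2 c).isSome).card := by
    simp only [Finset.card_filter]
    exact Finset.sum_comm
  have hle : ∑ p : V × V, ((Finset.range T).filter fun t =>
      ∃ c, (P.sent G N ω t p.1 p.2 c).isSome).card ≤
        ∑ p : V × V, if G.Adj p.1 p.2 then M else 0 := by
    refine Finset.sum_le_sum fun p _ => ?_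
    split_ifs with hadj
    · exact hM _ _ hadj
    · simp only [nonpos_iff_eq_zero, Finset.card_eq_zero, Finset.filter_eq_empty_iff]
      rintro t - ⟨c, hc⟩
      rw [sent_of_not_adj _ _ _ _ _ hadj] at hc
      simp at hc
  have hdart : (∑ p : V × V, if G.Adj p.1 p.2 then M else 0) = 2 * G.edgeFinset.card * M := by
    rw [← SimpleGraph.sum_degrees_eq_twice_card_edges, Finset.sum_mul, Fintype.sum_prod_type]
    refine Finset.sum_congr rfl fun v _ => ?_
    rw [← Finset.sum_filter, Finset.sum_const, smul_eq_mul, ← SimpleGraph.card_neighborFinset_eq_degree]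
    congr 2
    ext u; simp
  rw [hdart] at hle
  rw [← Nat.cast_sum, hswap]
  exact_mod_cast hle

omit hQ in
-- Only messages of the ideal run occur. The bound is on `x + 1` because `slot` shifts the content
-- by one.
theorem messageSizeLE {b : ℕ}
    (hmin : ∀ ω : Coins V, ∃ Q : ℕ → Prop,
      ∀ t v, (halt ((P.ideal G N ω t).state v)).isSome ↔ Q t)
    (hb : ∀ (ω : Coins V) t u v c x, P.sent G N ω t u v c = some x → x + 1 < 2 ^ b) :
    (P.alg halt).MessageSizeLE G N ((b * 1024 : ℕ) : ℝ) := by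
  classical
  intro ω t u v m hm
  obtain ⟨Q, hQ⟩ := hmin ω
  refine Nat.cast_le.2 ?_
  have hideal : (P.ideal G N ω t).msg u v = some m := by
    by_cases hex : ∃ T, Q T ∧ T < t
    · obtain ⟨T, hT, hTt⟩ := hex
      obtain ⟨T₀, hle, hT₀, hmin⟩ := exists_min_of_exists hT
      obtain ⟨-, out, hout⟩ := P.haltsWith_of_min G N ω halt hQ hT₀ hmin
      rw [(P.config_halted G N ω halt (t := T₀) (s := t) (by omega) (hout u)).2 (by omega)] at hm
      simp at hm
    · push Not at hex
      rwa [P.config_eq_ideal G N ω halt fun s hs v => by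
        simpa using mt (hQ s v).1 (fun h => absurd (hex s h) (by omega))] at hm
  cases t with
  | zero => exact absurd hideal (by simp [ideal, DistAlg.config])
  | succ t =>
    have hs : ∀ c x, P.sent G N ω t u v c = some x → x + 1 < 2 ^ b := hb ω t u v
    rw [msg_succ] at hideal
    split_ifs at hideal with hadj
    rw [sent_of_adj _ _ _ _ _ hadj] at hs
    have : m = pack (P.send (P.know G N ω t u) (N.ident v)) := by
      unfold toMsg at hideal
      split_ifs at hideal
      exact (Option.some.inj hideal).symm
    rw [this]
    refine length_pack_le fun c => ?_
    cases hc : P.send (P.know G N ω t u) (N.ident v) c with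
    | none => exact Nat.two_pow_pos b
    | some x => exact hs c x hc

end Program

/-! ### The breadth-first search tree of a network -/

namespace BFS

set_option linter.unusedSectionVars false

variable {V : Type*} [Fintype V] (G : SimpleGraph V) (N : Network V)

noncomputable def depth (v : V) : ℕ := G.dist N.leader v

/-- The identifiers of the neighbours of `v` that are closer to the leader. -/
def parIds (v : V) : Set ℕ := {j | ∃ u, N.ident u = j ∧ G.Adj u v ∧ depth G N u + 1 = depth G N v}

open Classical in
/-- The neighbour of `v` of least identifier among those closer to the leader. -/
noncomputable def par (v : V) : V :=
  if h : (parIds G N v).Nonempty then (Nat.sInf_mem h).choose else v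

/-- The breadth-first search tree. -/
noncomputable def tree : SimpleGraph V :=
  SimpleGraph.fromRel fun u v => u ≠ N.leader ∧ par G N u = v

open Classical in
-- The leader is excluded because `par` sends it to itself by default.
noncomputable def kids (v : V) : Finset V :=
  Finset.univ.filter fun c => c ≠ N.leader ∧ par G N c = v

open Classical in
noncomputable def descs (v : V) : Finset V :=
  Finset.univ.filter fun w => IsDesc (tree G N) N.leader w v

noncomputable def size (v : V) : ℕ := (descs G N v).card

/-- The maximum depth in the subtree of `v`. -/
noncomputable def maxDep (v : V) : ℕ := (descs G N v).sup (depth G N)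

/-- The height of the tree. -/
noncomputable def height : ℕ := maxDep G N N.leader

open Classical in
-- The number of vertices visited after the parent of `c` and before `c`.
noncomputable def offset (c : V) : ℕ :=
  ∑ s ∈ (kids G N (par G N c)).filter (fun s => N.ident s < N.ident c), size G N s

/-- The first argument makes the recursion towards the root structural; it is meant to be the depth.
-/
noncomputable def preAux : ℕ → V → ℕ
  | 0, _ => 0
  | k + 1, v => preAux k (par G N v) + 1 + offset G N v

/-- The preorder numbering that visits siblings by increasing identifier. -/
noncomputable def pre (v : V) : ℕ := preAux G N (depth G N v) v

/-! ### Depths, parents and the tree property. -/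

variable {G N}

@[simp] theorem depth_leader : depth G N N.leader = 0 := SimpleGraph.dist_self

variable (hG : G.Connected)
include hG

theorem depth_eq_zero {v : V} : depth G N v = 0 ↔ v = N.leader := by
  unfold depth; rw [hG.dist_eq_zero_iff, eq_comm]

theorem depth_le_of_adj {u v : V} (h : G.Adj u v) : depth G N v ≤ depth G N u + 1 := by
  have := hG.dist_triangle (u := N.leader) (v := u) (w := v)
  rwa [SimpleGraph.dist_eq_one_iff_adj.2 h] at this

theorem parIds_nonempty {v : V} (hv : v ≠ N.leader) : (parIds G N v).Nonempty := by
  obtain ⟨P, hP⟩ := hG.exists_walk_length_eq_dist v N.leader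
  cases P with
  | nil => exact absurd rfl hv
  | @cons _ p _ h P =>
    refine ⟨_, p, rfl, h.symm, ?_⟩
    have h1 := SimpleGraph.dist_le P
    have h2 := depth_le_of_adj (N := N) hG h.symm
    rw [SimpleGraph.Walk.length_cons, SimpleGraph.dist_comm] at hP
    rw [SimpleGraph.dist_comm] at h1
    unfold depth at h2 ⊢
    omega

theorem par_spec {v : V} (hv : v ≠ N.leader) : N.ident (par G N v) = sInf (parIds G N v) ∧
    G.Adj (par G N v) v ∧ depth G N (par G N v) + 1 = depth G N v := by
  have h := parIds_nonempty hG hv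
  rw [par, dif_pos h]
  exact (Nat.sInf_mem h).choose_spec

theorem depth_par {v : V} (hv : v ≠ N.leader) : depth G N (par G N v) + 1 = depth G N v :=
  (par_spec hG hv).2.2

theorem adj_par {v : V} (hv : v ≠ N.leader) : G.Adj (par G N v) v := (par_spec hG hv).2.1

theorem par_ne {v : V} (hv : v ≠ N.leader) : par G N v ≠ v := (adj_par hG hv).ne

theorem tree_adj {u v : V} : (tree G N).Adj u v ↔
    (u ≠ N.leader ∧ par G N u = v) ∨ (v ≠ N.leader ∧ par G N v = u) := by
  unfold tree
  rw [SimpleGraph.fromRel_adj]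
  constructor
  · exact fun h => h.2
  · intro h
    refine ⟨?_, h⟩
    rintro rfl
    rcases h with h | h <;> exact par_ne hG h.1 h.2

theorem tree_adj_par {v : V} (hv : v ≠ N.leader) : (tree G N).Adj v (par G N v) :=
  (tree_adj hG).2 (.inl ⟨hv, rfl⟩)

theorem tree_le : tree G N ≤ G := by
  intro u v h
  rcases (tree_adj hG).1 h with ⟨h1, rfl⟩ | ⟨h1, rfl⟩
  · exact (adj_par hG h1).symm
  · exact adj_par hG h1

theorem exists_walk_leader (v : V) :
    ∃ p : (tree G N).Walk N.leader v, p.length = depth G N v := by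
  induction hn : depth G N v generalizing v with
  | zero => obtain rfl := (depth_eq_zero hG).1 hn; exact ⟨.nil, rfl⟩
  | succ n ih =>
    have hv : v ≠ N.leader := by rintro rfl; simp at hn
    obtain ⟨p, hp⟩ := ih (par G N v) (by have := depth_par hG hv; omega)
    exact ⟨p.concat (tree_adj_par hG hv).symm, by rw [SimpleGraph.Walk.length_concat, hp]⟩

theorem tree_connected : (tree G N).Connected := by
  have h : ∀ v, (tree G N).Reachable N.leader v := fun v => ⟨(exists_walk_leader hG v).choose⟩
  have : Nonempty V := ⟨N.leader⟩
  exact ⟨fun u v => (h u).symm.trans (h v)⟩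

theorem tree_dist (v : V) : (tree G N).dist N.leader v = depth G N v := by
  obtain ⟨p, hp⟩ := exists_walk_leader hG v
  refine le_antisymm (hp ▸ SimpleGraph.dist_le p) ?_
  exact SimpleGraph.Reachable.dist_anti (tree_le hG) ((tree_connected hG).preconnected _ _)

theorem isParent_iff {v p : V} :
    IsParent (tree G N) N.leader v p ↔ v ≠ N.leader ∧ par G N v = p := by
  unfold IsParent
  rw [tree_dist hG, tree_dist hG, tree_adj hG]
  constructor
  · rintro ⟨h | h, hd⟩
    · exact h
    · have := depth_par hG h.1
      rw [h.2] at this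
      omega
  · rintro ⟨hv, rfl⟩
    exact ⟨.inl ⟨hv, rfl⟩, (depth_par hG hv).symm⟩

theorem isParent_par {v : V} (hv : v ≠ N.leader) :
    IsParent (tree G N) N.leader v (par G N v) := (isParent_iff hG).2 ⟨hv, rfl⟩

theorem mem_kids {c v : V} : c ∈ kids G N v ↔ IsParent (tree G N) N.leader c v := by
  rw [isParent_iff hG]; simp [kids]

/-- The graph is connected, and every edge is the parent edge of some vertex other than the leader,
so there are at most `|V| - 1` edges. -/
theorem isTree : (tree G N).IsTree := by
  classical
  rw [SimpleGraph.isTree_iff_connected_and_card]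
  refine ⟨tree_connected hG, le_antisymm ?_ (tree_connected hG).card_vert_le_card_edgeSet_add_one⟩
  have h : Nat.card (tree G N).edgeSet ≤ Nat.card {v : V // v ≠ N.leader} := by
    refine Nat.card_le_card_of_surjective
      (fun v => ⟨s(v.1, par G N v.1), tree_adj_par hG v.2⟩) ?_
    rintro ⟨e, he⟩
    induction e with
    | h u v =>
      rcases (tree_adj hG).1 he with ⟨h1, h2⟩ | ⟨h1, h2⟩
      · exact ⟨⟨u, h1⟩, Subtype.ext (congrArg (fun x => s(u, x)) h2)⟩
      · exact ⟨⟨v, h1⟩, Subtype.ext ((congrArg (fun x => s(v, x)) h2).trans Sym2.eq_swap)⟩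
  have h2 : Nat.card {v : V // v ≠ N.leader} + 1 = Nat.card V := by
    rw [Nat.card_eq_fintype_card, Nat.card_eq_fintype_card, Fintype.card_subtype_compl,
      Fintype.card_subtype_eq]
    have : 0 < Fintype.card V := Fintype.card_pos_iff.2 ⟨N.leader⟩
    omega
  omega

omit hG in
theorem mem_descs {w v : V} : w ∈ descs G N v ↔ IsDesc (tree G N) N.leader w v := by
  simp [descs]

/-- In a breadth-first search tree, non-tree edges join unrelated vertices. -/
theorem not_isDesc_of_cross {x y : V} (h : G.Adj x y) (ht : ¬ (tree G N).Adj x y) :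
    ¬ IsDesc (tree G N) N.leader x y := by
  intro hd
  have hx : x ≠ N.leader := by
    rintro rfl
    rcases Relation.ReflTransGen.cases_head hd with h1 | ⟨p, hp, -⟩
    · exact h.ne h1
    · exact not_isParent_root hp
  have h1 := hd.of_parent (isTree hG) h.ne (isParent_par hG hx)
  have h2 := depth_le_of_adj (N := N) hG h.symm
  have h3 := depth_par hG hx
  have h4 := h1.eq_of_dist_le (by rw [tree_dist hG, tree_dist hG]; omega)
  exact ht (h4 ▸ tree_adj_par hG hx)

/-- The subtree of `v` consists of `v` and the disjoint subtrees of its children. This is the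
recursion behind the convergecasts of sizes and of random sums. -/
theorem sum_descs {M : Type*} [AddCommMonoid M] (f : V → M) (v : V) :
    ∑ x ∈ descs G N v, f x = f v + ∑ c ∈ kids G N v, ∑ x ∈ descs G N c, f x := by
  classical
  have h : descs G N v = insert v ((kids G N v).biUnion (descs G N)) := by
    ext w
    rw [Finset.mem_insert, Finset.mem_biUnion, mem_descs]
    constructor
    · intro hw
      by_cases hwv : w = v
      · exact .inl hwv
      · obtain ⟨c, hc, hwc⟩ := hw.exists_child hwv
        exact .inr ⟨c, (mem_kids hG).2 hc, mem_descs.2 hwc⟩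
    · rintro (rfl | ⟨c, hc, hwc⟩)
      · exact .refl _ _ _
      · exact (mem_descs.1 hwc).trans ((mem_kids hG).1 hc).isDesc
  rw [h, Finset.sum_insert, Finset.sum_biUnion]
  · intro a ha b hb hab
    rw [Function.onFun, Finset.disjoint_left]
    intro x hxa hxb
    exact hab (child_eq_of_isDesc (isTree hG) ((mem_kids hG).1 ha) ((mem_kids hG).1 hb)
      (mem_descs.1 hxa) (mem_descs.1 hxb))
  · rw [Finset.mem_biUnion]
    rintro ⟨c, hc, hv⟩
    exact ((mem_kids hG).1 hc).not_isDesc (mem_descs.1 hv)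

theorem size_eq (v : V) : size G N v = 1 + ∑ c ∈ kids G N v, size G N c := by
  simp only [size, Finset.card_eq_sum_ones]
  exact sum_descs hG _ v

theorem sup_descs (f : V → ℕ) (v : V) :
    (descs G N v).sup f = max (f v) ((kids G N v).sup fun c => (descs G N c).sup f) := by
  apply le_antisymm
  · refine Finset.sup_le fun w hw => ?_
    by_cases hwv : w = v
    · rw [hwv]; exact le_max_left _ _
    · obtain ⟨c, hc, hwc⟩ := (mem_descs.1 hw).exists_child hwv
      exact le_max_of_le_right ((Finset.le_sup (f := f) (mem_descs.2 hwc)).trans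
        (Finset.le_sup (f := fun c => (descs G N c).sup f) ((mem_kids hG).2 hc)))
  · refine max_le (Finset.le_sup (mem_descs.2 (.refl _ _ _))) (Finset.sup_le fun c hc =>
      Finset.sup_mono fun w hw => mem_descs.2 ?_)
    exact (mem_descs.1 hw).trans ((mem_kids hG).1 hc).isDesc

theorem maxDep_eq (v : V) :
    maxDep G N v = max (depth G N v) ((kids G N v).sup (maxDep G N)) := sup_descs hG _ v

omit hG in
theorem depth_le_maxDep (v : V) : depth G N v ≤ maxDep G N v :=
  Finset.le_sup (mem_descs.2 (.refl _ _ _))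

theorem maxDep_le_of_mem_kids {c v : V} (hc : c ∈ kids G N v) : maxDep G N c ≤ maxDep G N v := by
  rw [maxDep_eq hG v]
  exact le_max_of_le_right (Finset.le_sup hc)

theorem descs_leader : descs G N N.leader = Finset.univ := by
  ext w; simp [mem_descs, isDesc_root (isTree hG) w]

theorem maxDep_le_height (v : V) : maxDep G N v ≤ height G N := by
  unfold height maxDep
  rw [descs_leader hG]
  exact Finset.sup_mono (Finset.subset_univ _)

theorem depth_le_height (v : V) : depth G N v ≤ height G N :=
  (depth_le_maxDep v).trans (maxDep_le_height hG v)

theorem height_le_diam : height G N ≤ G.diam := by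
  have : Nonempty V := ⟨N.leader⟩
  refine Finset.sup_le fun v _ => ?_
  exact SimpleGraph.dist_le_diam (SimpleGraph.connected_iff_ediam_ne_top.1 hG)

theorem size_leader : size G N N.leader = Fintype.card V := by
  unfold size; rw [descs_leader hG, Finset.card_univ]

omit hG in
theorem size_pos (v : V) : 0 < size G N v :=
  Finset.card_pos.2 ⟨v, mem_descs.2 (.refl _ _ _)⟩

omit hG in
theorem size_eq_descCount (v : V) : size G N v = descCount (tree G N) N.leader v := by
  classical
  unfold size descCount descs
  rw [Set.ncard_eq_toFinset_card']
  congr 1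
  ext; simp

/-! ### The subtree of `v` occupies the interval from `pre v` to `pre v + size v`. -/

omit hG in
theorem pre_leader : pre G N N.leader = 0 := by
  unfold pre; rw [depth_leader]; rfl

theorem pre_eq {v : V} (hv : v ≠ N.leader) :
    pre G N v = pre G N (par G N v) + 1 + offset G N v := by
  unfold pre
  rw [← depth_par hG hv]; rfl

theorem pre_add_size_le {c : V} (hc : c ≠ N.leader) :
    pre G N c + size G N c ≤ pre G N (par G N c) + size G N (par G N c) := by
  classical
  rw [pre_eq hG hc, size_eq hG (par G N c)]
  have hmem : c ∈ kids G N (par G N c) := (mem_kids hG).2 (isParent_par hG hc)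
  have h : offset G N c + size G N c ≤ ∑ c ∈ kids G N (par G N c), size G N c := by
    unfold offset
    have h1 : c ∉ (kids G N (par G N c)).filter (fun s => N.ident s < N.ident c) := by simp
    rw [add_comm, ← Finset.sum_insert (f := size G N) h1]
    refine Finset.sum_le_sum_of_subset fun x hx => ?_
    rcases Finset.mem_insert.1 hx with rfl | hx
    · exact hmem
    · exact (Finset.mem_filter.1 hx).1
  omega

theorem pre_add_size_le_of_lt {a b v : V} (ha : a ∈ kids G N v) (hb : b ∈ kids G N v)
    (hab : N.ident a < N.ident b) : pre G N a + size G N a ≤ pre G N b := by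
  classical
  obtain ⟨ha1, rfl⟩ := (isParent_iff hG).1 ((mem_kids hG).1 ha)
  obtain ⟨hb1, hb2⟩ := (isParent_iff hG).1 ((mem_kids hG).1 hb)
  rw [pre_eq hG ha1, pre_eq hG hb1, hb2]
  have h : offset G N a + size G N a ≤ offset G N b := by
    unfold offset
    rw [hb2]
    have h1 : a ∉ (kids G N (par G N a)).filter (fun s => N.ident s < N.ident a) := by simp
    rw [add_comm, ← Finset.sum_insert (f := size G N) h1]
    refine Finset.sum_le_sum_of_subset fun x hx => ?_
    rcases Finset.mem_insert.1 hx with rfl | hx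
    · exact Finset.mem_filter.2 ⟨ha, hab⟩
    · exact Finset.mem_filter.2 ⟨(Finset.mem_filter.1 hx).1, (Finset.mem_filter.1 hx).2.trans hab⟩
  omega

theorem pre_interval {w v : V} (h : IsDesc (tree G N) N.leader w v) :
    pre G N v ≤ pre G N w ∧ pre G N w + size G N w ≤ pre G N v + size G N v := by
  induction h with
  | refl => exact ⟨le_rfl, le_rfl⟩
  | tail _ hc ih =>
    obtain ⟨hb, rfl⟩ := (isParent_iff hG).1 hc
    have h1 := pre_add_size_le hG hb
    have h2 := pre_eq hG hb
    omega

theorem pre_lt_card (v : V) : pre G N v < Fintype.card V := by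
  have h := (pre_interval (N := N) hG (isDesc_root (isTree hG) v)).2
  have := size_pos (G := G) (N := N) v
  rw [pre_leader, size_leader hG] at h
  omega

theorem pre_par_lt {v p : V} (h : IsParent (tree G N) N.leader v p) :
    pre G N p < pre G N v := by
  obtain ⟨hb, rfl⟩ := (isParent_iff hG).1 h
  have := pre_eq hG hb
  omega

/-- Descendants have larger numbers, and unrelated vertices lie below two different siblings, whose
intervals are disjoint. -/
theorem pre_injective : Function.Injective (pre G N) := by
  have hlt : ∀ {v w : V}, IsDesc (tree G N) N.leader w v → w ≠ v → pre G N v < pre G N w := by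
    intro v w h hne
    rcases Relation.ReflTransGen.cases_head h with h1 | ⟨p, hp, h1⟩
    · exact absurd h1 hne
    · exact (pre_interval hG h1).1.trans_lt (pre_par_lt hG hp)
  intro v w hvw
  by_contra hne
  by_cases hwv : IsDesc (tree G N) N.leader w v
  · exact (hlt hwv (Ne.symm hne)).ne hvw
  obtain ⟨z, p, hvz, hzp, hwz, hwp⟩ := exists_split (isTree hG) hwv
  by_cases hw : w = p
  · subst hw
    exact (hlt (hvz.trans hzp.isDesc) hne).ne hvw.symm
  obtain ⟨b, hb, hwb⟩ := hwp.exists_child hw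
  have hzb : N.ident z ≠ N.ident b := fun e => hwz (N.ident.injective e ▸ hwb)
  have h1 := pre_interval hG hvz
  have h2 := pre_interval hG hwb
  have h3 := size_pos (G := G) (N := N) v
  have h4 := size_pos (G := G) (N := N) w
  rcases hzb.lt_or_gt with h | h
  · have := pre_add_size_le_of_lt hG ((mem_kids hG).2 hzp) ((mem_kids hG).2 hb) h
    omega
  · have := pre_add_size_le_of_lt hG ((mem_kids hG).2 hb) ((mem_kids hG).2 hzp) h
    omega

theorem isPreorderedSpanningTree :
    IsPreorderedSpanningTree G (tree G N) N.leader (pre G N) where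
  le := tree_le hG
  isTree := isTree hG
  bijOn := by
    classical
    rw [Nat.card_eq_fintype_card]
    refine ⟨fun v _ => pre_lt_card hG v, (pre_injective hG).injOn, fun k hk => ?_⟩
    have : Finset.univ.image (pre G N) = Finset.range (Fintype.card V) := by
      refine Finset.eq_of_subset_of_card_le (fun x hx => ?_) ?_
      · obtain ⟨v, -, rfl⟩ := Finset.mem_image.1 hx
        exact Finset.mem_range.2 (pre_lt_card hG v)
      · rw [Finset.card_range, Finset.card_image_of_injective _ (pre_injective hG), Finset.card_univ]
    obtain ⟨v, -, hv⟩ := Finset.mem_image.1 (this ▸ Finset.mem_range.2 hk)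
    exact ⟨v, Set.mem_univ v, hv⟩
  parent_lt _ _ h := pre_par_lt hG h
  sibling_lt p a b ha hb hab w hw := by
    have ha' := (mem_kids hG).2 ha
    have hb' := (mem_kids hG).2 hb
    have hne : N.ident a ≠ N.ident b := fun e => hab.ne (by rw [N.ident.injective e])
    have h1 := pre_interval hG hw
    have h2 := size_pos (G := G) (N := N) w
    have h3 := size_pos (G := G) (N := N) b
    rcases hne.lt_or_gt with h | h
    · have := pre_add_size_le_of_lt hG ha' hb' h
      omega
    · have := pre_add_size_le_of_lt hG hb' ha' h
      omega

end BFS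

/-! ### The local program -/

/-- What a vertex eventually knows about its position in the breadth-first search tree, with
neighbours given by their identifiers. -/
structure Pos where
  lead : Bool
  depth : ℕ
  par : ℕ
  height : ℕ
  card : ℕ
  deg : ℕ
  pre : ℕ
  size : ℕ
  nbrs : Finset ℕ
  kids : Finset ℕ

namespace Local

section Early

variable (L : LocalView) (h : Hist)

open Classical in
/-- The content of a channel that is used only once. -/
noncomputable def got (c : Chan) (j : ℕ) : Option ℕ :=
  if e : ∃ x i, h i j c = some x then some e.choose else none

open Classical in
/-- The depth: the first round in which the flood arrives. -/
noncomputable def dep : Option ℕ :=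
  if L.isLeader then some 0
  else if e : ∃ i j, (h i j .flood).isSome then some (Nat.find e + 1) else none

/-- The least sender of the first flood. For the leader the set is empty and the value is 0. -/
noncomputable def parId : ℕ :=
  sInf {j | ∃ d, dep L h = some (d + 1) ∧ (h d j .flood).isSome}

/-- The flood carries the bit 1 exactly to the chosen parent, so each vertex learns its children
from its neighbours' floods. -/
noncomputable def kids : Finset ℕ := L.nbrs.filter fun j => got h .flood j = some 1

noncomputable def upMax (j : ℕ) : ℕ := ((got h .up j).getD 0).unpair.1
noncomputable def upSize (j : ℕ) : ℕ := ((got h .up j).getD 0).unpair.2.unpair.1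
noncomputable def upDeg (j : ℕ) : ℕ := ((got h .up j).getD 0).unpair.2.unpair.2

open Classical in
/-- Maximum depth, size, and maximum degree of the own subtree. -/
noncomputable def report : Option (ℕ × ℕ × ℕ) :=
  if (∀ j ∈ L.nbrs, (got h .flood j).isSome) ∧ ∀ j ∈ kids L h, (got h .up j).isSome then
    some (max ((dep L h).getD 0) ((kids L h).sup (upMax h)), 1 + ∑ j ∈ kids L h, upSize h j,
      max L.nbrs.card ((kids L h).sup (upDeg h)))
  else none

/-- Height, size and maximum degree of the tree, and the own preorder number. -/
noncomputable def info : Option (ℕ × ℕ × ℕ × ℕ) :=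
  if L.isLeader then (report L h).map fun x => (x.1, x.2.1, x.2.2, 0)
  else (got h .down (parId L h)).map fun x =>
    (x.unpair.1.unpair.1, x.unpair.1.unpair.2, x.unpair.2.unpair.1, x.unpair.2.unpair.2)

noncomputable def pos : Option Pos :=
  (info L h).map fun x =>
    { lead := L.isLeader
      depth := (dep L h).getD 0
      par := parId L h
      height := x.1
      card := x.2.1
      deg := x.2.2.1
      pre := x.2.2.2
      size := ((report L h).getD 0).2.1
      nbrs := L.nbrs
      kids := kids L h }

variable (t j : ℕ)

noncomputable def sendFlood : Option ℕ :=
  if dep L h = some t then some (if L.isLeader = false ∧ j = parId L h then 1 else 0) else none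

/-- The round is computable from the subtree alone. A child has larger depth and no larger maximum
depth, so it reports strictly before its parent. -/
noncomputable def sendUp : Option ℕ :=
  (report L h).bind fun x =>
    if L.isLeader = false ∧ j = parId L h ∧ t + (dep L h).getD 0 = 2 * x.1 + 2 then
      some (Nat.pair x.1 (Nat.pair x.2.1 x.2.2))
    else none

/-- The leader is ready by round `2 * height + 2`, and the broadcast descends one level per round.
The sizes reported by the earlier siblings determine the preorder number of `j`. -/
noncomputable def sendDown : Option ℕ :=
  (pos L h).bind fun p =>
    if j ∈ p.kids ∧ t = 2 * p.height + 2 + p.depth then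
      some (Nat.pair (Nat.pair p.height p.card) (Nat.pair p.deg
        (p.pre + 1 + ∑ s ∈ p.kids.filter (· < j), upSize h s)))
    else none

end Early

end Local

/-- An element of the field with two elements as given by a bit. -/
def bitVal (b : Bool) : ZMod 2 := if b then 1 else 0

/-- Bit `l` of a number that has been received. -/
def bitOf (x : Option ℕ) (l : ℕ) : ZMod 2 := bitVal ((x.getD 0).testBit l)

/-- The number with given bits. -/
def encBits (k : ℕ) (f : ℕ → ZMod 2) : ℕ := Nat.ofBits fun l : Fin k => decide (f l = 1)

theorem bitOf_encBits {k l : ℕ} (f : ℕ → ZMod 2) (hl : l < k) :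
    bitOf (some (encBits k f)) l = f l := by
  have : ∀ x : ZMod 2, bitVal (decide (x = 1)) = x := by decide
  simp [bitOf, encBits, Nat.testBit_ofBits_lt, hl, this]

theorem encBits_lt (k : ℕ) (f : ℕ → ZMod 2) : encBits k f < 2 ^ k := Nat.ofBits_lt_two_pow _

namespace Pos

variable (p : Pos)

/-- The other ends of the edges outside the tree. -/
def cross : Finset ℕ := p.nbrs.filter fun j => j ∉ p.kids ∧ ¬ (p.lead = false ∧ j = p.par)

/-- The round in which every vertex knows its position. -/
def base : ℕ := 3 * p.height + 2

/-- The round in which the first attempt starts. -/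
def start : ℕ := p.base + p.height + 3

/-- The number of random bits per message. -/
def width : ℕ := Nat.log 2 p.card + 1

/-- The number of messages with random bits per edge. -/
def chunks : ℕ := p.deg / p.width + 2

/-- The number of rounds of one attempt. -/
def period : ℕ := 2 * p.chunks + 4 * p.height + 6

def off (t : ℕ) : ℕ := (t - p.start) % p.period

/-- The start of the current attempt. -/
def beg (t : ℕ) : ℕ := t - p.off t

section Range

variable (h : Hist)

def num (j : ℕ) : ℕ := (h p.base j .number).getD 0

/-- The round is the one in which vertices of depth `p.depth + 1` send their ranges. -/
def kidRange (j : ℕ) : ℕ := (h (p.base + 1 + (p.height - (p.depth + 1))) j .range).getD 0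

noncomputable def low : ℕ :=
  sInf ({p.pre} ∪ p.num h '' p.cross ∪ (fun j => (p.kidRange h j).unpair.1) '' p.kids)

noncomputable def high : ℕ :=
  sSup ({p.pre} ∪ p.num h '' p.cross ∪ (fun j => (p.kidRange h j).unpair.2) '' p.kids)

/-- The subtree neighbourhood of the child `j` is not contained in the own subtree. -/
def Escapes (j : ℕ) : Prop :=
  (p.kidRange h j).unpair.1 < p.pre ∨ p.pre + p.size ≤ (p.kidRange h j).unpair.2

end Range

section Attempt

variable (h : Hist) (coin : ℕ → ℕ → Bool) (β : ℕ)

def kidSum (i l j : ℕ) : ZMod 2 :=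
  bitOf (h (β + p.chunks + (p.height - (p.depth + 1)) + i) j .sum) l

/-- The bit of a non-tree edge is the sum of one coin of each end, so both ends know the same bit
after exchanging their coins. -/
def acc (i l : ℕ) : ZMod 2 :=
  ∑ j ∈ p.cross, (bitVal (coin (β + i) (j * p.width + l)) + bitOf (h (β + i) j .chunk) l) +
    ∑ j ∈ p.kids, p.kidSum h β i l j

/-- A set of children whose random sums cancel. -/
def ZeroSum (S : Finset ℕ) : Prop :=
  S ⊆ p.kids ∧ ∀ i < p.chunks, ∀ l < p.width, ∑ j ∈ S, p.kidSum h β i l j = 0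

/-- In the absence of accidental zero sums, this says that the subtree of `j` can be left towards
the outside of the own subtree without using the own vertex. -/
def UpLink (j : ℕ) : Prop := ∀ S, p.ZeroSum h β S → j ∉ S

def Link (j k : ℕ) : Prop := ∀ S, p.ZeroSum h β S → (j ∈ S ↔ k ∈ S)

/-- The leader has no parent edge. Its value 0 is a placeholder: actual edge labels are preorder
numbers of other vertices. -/
def ownLabel : ℕ :=
  if p.lead then 0 else (h (β + 2 * p.chunks + p.height + 1 + (p.depth - 1)) p.par .label).getD 0

open Classical in
-- A child in the block of the parent edge inherits the label; otherwise the block is new, and its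
-- least child provides a common name.
noncomputable def kidLabel (j : ℕ) : ℕ :=
  if p.UpLink h β j then p.ownLabel h β else sInf (p.num h '' {k | k ∈ p.kids ∧ p.Link h β j k})

def nbrLabel (j : ℕ) : ℕ := (h (β + 2 * p.chunks + 2 * p.height + 2) j .labelX).getD 0

/-- The labels of the edges at a vertex respect the generating relation. -/
def Check : Prop :=
  (∀ j ∈ p.cross, p.nbrLabel h β j = p.ownLabel h β) ∧
    (p.lead = false → ∀ j ∈ p.kids, p.Escapes h j → p.nbrLabel h β j = p.ownLabel h β)

def AllOk : Prop :=
  p.Check h β ∧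
    ∀ j ∈ p.kids, h (β + 2 * p.chunks + 2 * p.height + 3 + (p.height - (p.depth + 1))) j .ok = some 1

def Verdict : Prop :=
  if p.lead then p.AllOk h β
  else h (β + 2 * p.chunks + 3 * p.height + 4 + (p.depth - 1)) p.par .verdict = some 1

end Attempt

open Classical in
/-- What is sent to the neighbour `j` in round `t`, once the position is known. -/
noncomputable def send (t : ℕ) (h : Hist) (coin : ℕ → ℕ → Bool) (j : ℕ) : Chan → Option ℕ
  | .number => if t = p.base then some p.pre else none
  | .range =>
    if p.lead = false ∧ j = p.par ∧ t = p.base + 1 + (p.height - p.depth) then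
      some (Nat.pair (p.low h) (p.high h))
    else none
  | .chunk =>
    if p.start ≤ t ∧ p.off t < p.chunks then
      some (encBits p.width fun l => bitVal (coin t (j * p.width + l)))
    else none
  | .sum =>
    if p.start ≤ t ∧ (p.lead = false ∧ j = p.par) ∧ p.chunks + (p.height - p.depth) ≤ p.off t ∧
        p.off t < p.chunks + (p.height - p.depth) + p.chunks then
      some (encBits p.width (p.acc h coin (p.beg t) (p.off t - (p.chunks + (p.height - p.depth)))))
    else none
  | .label =>
    if p.start ≤ t ∧ j ∈ p.kids ∧ p.off t = 2 * p.chunks + p.height + 1 + p.depth then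
      some (p.kidLabel h (p.beg t) j)
    else none
  | .labelX =>
    if p.start ≤ t ∧ p.off t = 2 * p.chunks + 2 * p.height + 2 then
      some (p.ownLabel h (p.beg t))
    else none
  | .ok =>
    if p.start ≤ t ∧ (p.lead = false ∧ j = p.par) ∧
        p.off t = 2 * p.chunks + 2 * p.height + 3 + (p.height - p.depth) then
      some (if p.AllOk h (p.beg t) then 1 else 0)
    else none
  | .verdict =>
    if p.start ≤ t ∧ j ∈ p.kids ∧ p.off t = 2 * p.chunks + 3 * p.height + 4 + p.depth then
      some (if p.Verdict h (p.beg t) then 1 else 0)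
    else none
  | _ => none

open Classical in
noncomputable def sim0Output (h : Hist) (i j : ℕ) : Bool :=
  decide ((p.lead = false ∧ j = p.par) ∧
    ((i ∈ p.cross ∧ (p.num h i < p.pre ∨ p.pre + p.size ≤ p.num h i)) ∨
      (i ∈ p.kids ∧ p.Escapes h i)))

/-- A non-tree edge shares the label of the parent edge, to which `Sim0` relates it. -/
def edgeLabel (h : Hist) (β : ℕ) (j : ℕ) : ℕ :=
  if j ∈ p.kids then p.nbrLabel h β j else p.ownLabel h β

open Classical in
noncomputable def blockOutput (h : Hist) (β : ℕ) : BlockOutput where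
  isCut := decide (∃ i ∈ p.nbrs, ∃ j ∈ p.nbrs, p.edgeLabel h β i ≠ p.edgeLabel h β j)
  label := p.edgeLabel h β

end Pos

/-- The program of both algorithms. -/
noncomputable def blockProgram : Program where
  -- Bit `l` for the neighbour with identifier `j` is coin number `j * width + l`, so the count must
  -- cover the largest identifier of a neighbour.
  toss K := ((Local.pos K.view K.hist).map fun p => (p.nbrs.sup id + 1) * p.width).getD 0
  send K j
    | .flood => Local.sendFlood K.view K.hist K.time j
    | .up => Local.sendUp K.view K.hist K.time j
    | .down => Local.sendDown K.view K.hist K.time j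
    | c => (Local.pos K.view K.hist).bind fun p => p.send K.time K.hist K.coin j c

open Classical in
noncomputable def haltSim0 (K : Know) : Option (ℕ → ℕ → Bool) :=
  (Local.pos K.view K.hist).bind fun p =>
    if p.start ≤ K.time then some (p.sim0Output K.hist) else none

open Classical in
-- The verdict on a trial takes effect at the beginning of the next one, when it has reached every
-- vertex.
noncomputable def haltBlocks (K : Know) : Option BlockOutput :=
  (Local.pos K.view K.hist).bind fun p =>
    if p.start < K.time ∧ p.off K.time = 0 ∧ p.Verdict K.hist (K.time - p.period) then
      some (p.blockOutput K.hist (K.time - p.period))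
    else none

/-! ### Construction of the tree -/

namespace BFS

set_option linter.unusedSectionVars false

local notation "bsent" => Program.sent blockProgram
local notation "bheard" => Program.heard blockProgram
local notation "view" => DistAlg.view

variable {V : Type*} [Fintype V] [DecidableEq V] (G : SimpleGraph V) [DecidableRel G.Adj]
  (N : Network V) (ω : Coins V)

/-- The maximum degree in the subtree of `v`. -/
noncomputable def maxDeg (v : V) : ℕ := (descs G N v).sup fun w => G.degree w

/-- The position of `v`. -/
noncomputable def gpos (v : V) : Pos where
  lead := decide (v = N.leader)
  depth := depth G N v
  par := if v = N.leader then 0 else N.ident (par G N v)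
  height := height G N
  card := Fintype.card V
  deg := maxDeg G N N.leader
  pre := pre G N v
  size := size G N v
  nbrs := (G.neighborFinset v).map N.ident
  kids := (kids G N v).map N.ident

variable {G N ω}

theorem heard_isSome_iff {t i j : ℕ} {v : V} {c : Chan} :
    (bheard G N ω t v i j c).isSome ↔
      i < t ∧ ∃ u, N.ident u = j ∧ G.Adj u v ∧ (bsent G N ω i u v c).isSome := by
  constructor
  · intro h
    obtain ⟨x, hx⟩ := Option.isSome_iff_exists.1 h
    obtain ⟨hi, u, hu, ha, hs⟩ := blockProgram.exists_of_heard G N ω hx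
    exact ⟨hi, u, hu, ha, by rw [hs]; rfl⟩
  · rintro ⟨hi, u, rfl, -, hs⟩
    rw [blockProgram.heard_ident, if_pos hi]
    exact hs

/-- If a channel is used in no round other than `τ`, and there exactly under condition `A`, then the
choice in `Local.got` is forced. -/
theorem got_heard {t : ℕ} {u v : V} {c : Chan} {τ x : ℕ} {A : Prop} [Decidable A]
    (h : ∀ i < t, bsent G N ω i u v c = if i = τ ∧ A then some x else none) :
    Local.got (bheard G N ω t v) c (N.ident u) = if τ < t ∧ A then some x else none := by
  unfold Local.got
  split_ifs with h1 h2 h2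
  · obtain ⟨i, hi⟩ := h1.choose_spec
    rw [blockProgram.heard_ident] at hi
    split_ifs at hi with hit
    rw [show bsent G N ω i u v c = _ from h i hit] at hi
    split_ifs at hi with h3
    exact hi.symm
  · exfalso
    obtain ⟨y, i, hi⟩ := h1
    rw [blockProgram.heard_ident] at hi
    split_ifs at hi with hit
    rw [show bsent G N ω i u v c = _ from h i hit] at hi
    split_ifs at hi with h3
    exact h2 ⟨h3.1 ▸ hit, h3.2⟩
  · exfalso
    refine h1 ⟨x, τ, ?_⟩
    rw [blockProgram.heard_ident, if_pos h2.1]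
    exact (h τ h2.1).trans (if_pos ⟨rfl, h2.2⟩)
  · rfl

theorem view_leader {v : V} : (view G N v).isLeader = decide (v = N.leader) := rfl

theorem view_leader_false {v : V} : (view G N v).isLeader = false ↔ v ≠ N.leader := by
  simp [view_leader]

theorem view_nbrs {v : V} : (view G N v).nbrs = (G.neighborFinset v).map N.ident := rfl

variable (hG : G.Connected)
include hG

/-! ### Flooding: depths and parents. -/

section Flood

variable {t : ℕ} (hF : ∀ i < t, ∀ u v, G.Adj u v → bsent G N ω i u v .flood =
  if i = depth G N u ∧ True then some (if u ≠ N.leader ∧ v = par G N u then 1 else 0) else none)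
include hF

omit hG in
theorem heard_flood_iff {i j : ℕ} {v : V} : (bheard G N ω t v i j .flood).isSome ↔
    i < t ∧ ∃ u, N.ident u = j ∧ G.Adj u v ∧ i = depth G N u := by
  rw [heard_isSome_iff]
  refine and_congr_right fun hi => exists_congr fun u => and_congr_right fun _ =>
    and_congr_right fun ha => ?_
  rw [hF i hi u v ha]
  split_ifs with h <;> simp_all

theorem dep_heard (v : V) : Local.dep (view G N v) (bheard G N ω t v) =
    if depth G N v ≤ t then some (depth G N v) else none := by
  classical
  unfold Local.dep
  by_cases hv : v = N.leader
  · subst hv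
    simp [view_leader]
  rw [if_neg (by simp [view_leader, hv])]
  have hp := depth_par hG hv
  by_cases ht : depth G N v ≤ t
  · have e : ∃ i j, (bheard G N ω t v i j .flood).isSome :=
      ⟨depth G N (par G N v), N.ident (par G N v), (heard_flood_iff hF).2
        ⟨by omega, _, rfl, adj_par hG hv, rfl⟩⟩
    rw [dif_pos e, if_pos ht]
    congr 1
    rw [← hp]
    congr 1
    rw [Nat.find_eq_iff]
    refine ⟨⟨N.ident (par G N v), (heard_flood_iff hF).2
        ⟨by omega, _, rfl, adj_par hG hv, rfl⟩⟩, ?_⟩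
    rintro n hn ⟨j, hj⟩
    obtain ⟨-, u, -, ha, rfl⟩ := (heard_flood_iff hF).1 hj
    have := depth_le_of_adj (N := N) hG ha
    omega
  · rw [dif_neg, if_neg ht]
    rintro ⟨i, j, hj⟩
    obtain ⟨hi, u, -, ha, rfl⟩ := (heard_flood_iff hF).1 hj
    have := depth_le_of_adj (N := N) hG ha
    omega

theorem parId_heard {v : V} (hv : v ≠ N.leader) (ht : depth G N v ≤ t) :
    Local.parId (view G N v) (bheard G N ω t v) = N.ident (par G N v) := by
  rw [(par_spec hG hv).1]
  unfold Local.parId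
  rw [dep_heard hG hF, if_pos ht]
  congr 1
  ext j
  simp only [Set.mem_ofPred_eq, parIds, heard_flood_iff hF]
  constructor
  · rintro ⟨d, hd, -, u, hu, ha, rfl⟩
    exact ⟨u, hu, ha, (Option.some.inj hd).symm⟩
  · rintro ⟨u, hu, ha, hd⟩
    exact ⟨depth G N u, by rw [hd], by omega, u, hu, ha, rfl⟩

end Flood

/-- Induction on the round: if all earlier floods left on schedule, the first flood reaches `u` from
the level above, so `u` forwards it in round `depth u`. -/
theorem sent_flood (t : ℕ) {u v : V} (huv : G.Adj u v) : bsent G N ω t u v .flood =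
    if t = depth G N u ∧ True then some (if u ≠ N.leader ∧ v = par G N u then 1 else 0)
    else none := by
  induction t using Nat.strong_induction_on generalizing u v with
  | _ t ih =>
    have hF : ∀ i < t, ∀ u v, G.Adj u v → bsent G N ω i u v .flood =
        if i = depth G N u ∧ True then some (if u ≠ N.leader ∧ v = par G N u then 1 else 0)
        else none := fun i hi u v h => ih i hi h
    rw [blockProgram.sent_of_adj _ _ _ _ huv]
    change Local.sendFlood (view G N u) (bheard G N ω t u) t (N.ident v) = _
    unfold Local.sendFlood
    rw [dep_heard hG hF]
    by_cases ht : t = depth G N u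
    · have h1 : (if depth G N u ≤ t then some (depth G N u) else none) = some t := by
        rw [if_pos ht.ge, ht]
      refine (if_pos h1).trans ?_
      refine Eq.trans ?_ (if_pos ⟨ht, trivial⟩).symm
      congr 1
      refine if_congr ?_ rfl rfl
      rw [view_leader_false]
      refine and_congr_right fun hu => ?_
      rw [parId_heard hG hF hu ht.ge, N.ident.injective.eq_iff]
    · rw [if_neg, if_neg (fun h => ht h.1)]
      split_ifs
      · exact fun h => ht (Option.some.inj h).symm
      · simp

theorem flood_spec (t : ℕ) : ∀ i < t, ∀ u v, G.Adj u v → bsent G N ω i u v .flood =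
    if i = depth G N u ∧ True then some (if u ≠ N.leader ∧ v = par G N u then 1 else 0)
    else none := fun i _ _ _ h => sent_flood hG i h

theorem dep_eq (t : ℕ) (v : V) : Local.dep (view G N v) (bheard G N ω t v) =
    if depth G N v ≤ t then some (depth G N v) else none := dep_heard hG (flood_spec hG t) v

theorem parId_eq {t : ℕ} {v : V} (hv : v ≠ N.leader) (ht : depth G N v ≤ t) :
    Local.parId (view G N v) (bheard G N ω t v) = N.ident (par G N v) :=
  parId_heard hG (flood_spec hG t) hv ht

theorem got_flood {t : ℕ} {u v : V} (h : G.Adj u v) :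
    Local.got (bheard G N ω t v) .flood (N.ident u) = if depth G N u < t ∧ True then
      some (if u ≠ N.leader ∧ v = par G N u then 1 else 0) else none :=
  got_heard fun i hi => flood_spec hG t i hi u v h

theorem mem_kids_adj {c v : V} (h : c ∈ kids G N v) : G.Adj c v :=
  tree_le hG ((mem_kids hG).1 h).1

theorem forall_got_flood {t : ℕ} {v : V} :
    (∀ j ∈ (view G N v).nbrs, (Local.got (bheard G N ω t v) .flood j).isSome) ↔
      ∀ u, G.Adj u v → depth G N u < t := by
  rw [view_nbrs]
  simp only [Finset.mem_map, SimpleGraph.mem_neighborFinset, forall_exists_index, and_imp]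
  constructor
  · intro h u hu
    have := h _ u hu.symm rfl
    change (Local.got _ _ (N.ident u)).isSome at this
    rw [got_flood hG hu] at this
    by_contra h1
    rw [if_neg fun h => h1 h.1] at this
    simp at this
  · rintro h _ u hu rfl
    change (Local.got _ _ (N.ident u)).isSome
    rw [got_flood hG hu.symm, if_pos ⟨h u hu.symm, trivial⟩]
    rfl

theorem kids_eq {t : ℕ} {v : V} (ht : ∀ u, G.Adj u v → depth G N u < t) :
    Local.kids (view G N v) (bheard G N ω t v) = (kids G N v).map N.ident := by
  ext j
  unfold Local.kids
  rw [view_nbrs, Finset.mem_filter, Finset.mem_map, Finset.mem_map]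
  constructor
  · rintro ⟨⟨u, hu, rfl⟩, h⟩
    refine ⟨u, (mem_kids hG).2 ((isParent_iff hG).2 ?_), rfl⟩
    have hu := (G.mem_neighborFinset v u).1 hu
    change Local.got _ _ (N.ident u) = _ at h
    rw [got_flood hG hu.symm, if_pos ⟨ht u hu.symm, trivial⟩] at h
    split_ifs at h with h1
    · exact ⟨h1.1, h1.2.symm⟩
    · simp at h
  · rintro ⟨u, hu, rfl⟩
    have ha := mem_kids_adj hG hu
    refine ⟨⟨u, (G.mem_neighborFinset v u).2 ha.symm, rfl⟩, ?_⟩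
    have h1 := (isParent_iff hG).1 ((mem_kids hG).1 hu)
    change Local.got _ _ (N.ident u) = _
    rw [got_flood hG ha, if_pos ⟨ht u ha, trivial⟩, if_pos ⟨h1.1, h1.2.symm⟩]

theorem depth_of_mem_kids {c v : V} (h : c ∈ kids G N v) : depth G N c = depth G N v + 1 := by
  obtain ⟨h1, rfl⟩ := (isParent_iff hG).1 ((mem_kids hG).1 h)
  exact (depth_par hG h1).symm

theorem depth_le_of_forall [Nontrivial V] {t : ℕ} {v : V}
    (ht : ∀ u, G.Adj u v → depth G N u < t) : depth G N v ≤ t := by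
  obtain ⟨u, hu⟩ := hG.preconnected.exists_adj_of_nontrivial v
  have := depth_le_of_adj (N := N) hG hu.symm
  have := ht u hu.symm
  omega

theorem maxDeg_eq (v : V) :
    maxDeg G N v = max (G.degree v) ((kids G N v).sup (maxDeg G N)) := sup_descs hG _ v

/-! ### Convergecast of maximum depth, size and maximum degree of subtrees. -/

section Up

variable [Nontrivial V] {t : ℕ} (hU : ∀ i < t, ∀ u v, G.Adj u v → bsent G N ω i u v .up =
  if i = 2 * maxDep G N u + 2 - depth G N u ∧ (u ≠ N.leader ∧ v = par G N u) then
    some (Nat.pair (maxDep G N u) (Nat.pair (size G N u) (maxDeg G N u))) else none)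
include hU

theorem report_heard {v : V} :
    ((Local.report (view G N v) (bheard G N ω t v)).isSome ↔ (∀ u, G.Adj u v → depth G N u < t) ∧
      ∀ c ∈ kids G N v, 2 * maxDep G N c + 2 - depth G N c < t) ∧
    ∀ x, Local.report (view G N v) (bheard G N ω t v) = some x →
      x = (maxDep G N v, size G N v, maxDeg G N v) := by
  have hgot : ∀ c ∈ kids G N v, Local.got (bheard G N ω t v) .up (N.ident c) =
      if 2 * maxDep G N c + 2 - depth G N c < t ∧ True then
        some (Nat.pair (maxDep G N c) (Nat.pair (size G N c) (maxDeg G N c))) else none := by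
    intro c hc
    have h1 := (isParent_iff hG).1 ((mem_kids hG).1 hc)
    refine got_heard fun i hi => ?_
    rw [hU i hi c v (mem_kids_adj hG hc)]
    refine if_congr ?_ rfl rfl
    simp only [and_true, and_iff_left_iff_imp]
    exact fun _ => ⟨h1.1, h1.2.symm⟩
  have hcond : ((∀ j ∈ (view G N v).nbrs, (Local.got (bheard G N ω t v) .flood j).isSome) ∧
      ∀ j ∈ Local.kids (view G N v) (bheard G N ω t v),
        (Local.got (bheard G N ω t v) .up j).isSome) ↔ (∀ u, G.Adj u v → depth G N u < t) ∧
      ∀ c ∈ kids G N v, 2 * maxDep G N c + 2 - depth G N c < t := by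
    rw [forall_got_flood hG]
    refine and_congr_right fun h1 => ?_
    rw [kids_eq hG h1]
    simp only [Finset.mem_map, forall_exists_index, and_imp, forall_apply_eq_imp_iff₂]
    refine forall₂_congr fun c hc => ?_
    change (Local.got _ _ (N.ident c)).isSome ↔ _
    rw [hgot c hc]
    split_ifs with h2 <;> simp_all
  unfold Local.report
  by_cases h2 : (∀ u, G.Adj u v → depth G N u < t) ∧
      ∀ c ∈ kids G N v, 2 * maxDep G N c + 2 - depth G N c < t
  · rw [if_pos (hcond.2 h2)]
    refine ⟨⟨fun _ => h2, fun _ => rfl⟩, fun x hx => ?_⟩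
    obtain rfl := (Option.some.inj hx).symm
    have h3 := h2.2
    rw [dep_eq hG, if_pos (depth_le_of_forall hG h2.1), maxDep_eq hG v, size_eq hG v,
      maxDeg_eq hG v, kids_eq hG h2.1, Finset.sup_map, Finset.sup_map, Finset.sum_map]
    refine Prod.ext ?_ (Prod.ext ?_ ?_)
    · simp only [Option.getD_some]
      congr 1
      refine Finset.sup_congr rfl fun c hc => ?_
      have := hgot c hc
      rw [if_pos ⟨h3 c hc, trivial⟩] at this
      change Local.upMax _ (N.ident c) = _
      rw [Local.upMax, this]
      simp
    · simp only
      congr 1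
      refine Finset.sum_congr rfl fun c hc => ?_
      have := hgot c hc
      rw [if_pos ⟨h3 c hc, trivial⟩] at this
      rw [Local.upSize, this]
      simp
    · simp only
      congr 1
      · rw [view_nbrs, Finset.card_map, SimpleGraph.card_neighborFinset_eq_degree]
      · refine Finset.sup_congr rfl fun c hc => ?_
        have := hgot c hc
        rw [if_pos ⟨h3 c hc, trivial⟩] at this
        change Local.upDeg _ (N.ident c) = _
        rw [Local.upDeg, this]
        simp
  · rw [if_neg (mt hcond.1 h2)]
    exact ⟨⟨fun h => by simp at h, fun h => absurd h h2⟩, fun x hx => by simp at hx⟩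

omit hU in
-- As `depth v ≤ maxDep v`, round `t` exceeds the depth of every neighbour. Passing to a child
-- raises the depth by one without raising the maximum depth, so its report left before round `t`.
theorem ready_of_le {v : V} (ht : 2 * maxDep G N v + 2 ≤ t + depth G N v) :
    (∀ u, G.Adj u v → depth G N u < t) ∧
      ∀ c ∈ kids G N v, 2 * maxDep G N c + 2 - depth G N c < t := by
  have h1 := depth_le_maxDep (G := G) (N := N) v
  refine ⟨fun u hu => ?_, fun c hc => ?_⟩
  · have := depth_le_of_adj (N := N) hG hu.symm
    omega
  · have := depth_of_mem_kids hG hc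
    have := maxDep_le_of_mem_kids hG hc
    omega

end Up

variable [Nontrivial V]

theorem sent_up (t : ℕ) {u v : V} (huv : G.Adj u v) : bsent G N ω t u v .up =
    if t = 2 * maxDep G N u + 2 - depth G N u ∧ (u ≠ N.leader ∧ v = par G N u) then
      some (Nat.pair (maxDep G N u) (Nat.pair (size G N u) (maxDeg G N u))) else none := by
  induction t using Nat.strong_induction_on generalizing u v with
  | _ t ih =>
    have hr := report_heard (ω := ω) hG (fun i hi u v h => ih i hi h) (v := u)
    rw [blockProgram.sent_of_adj _ _ _ _ huv]
    change Local.sendUp (view G N u) (bheard G N ω t u) t (N.ident v) = _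
    unfold Local.sendUp
    have hd := depth_le_maxDep (G := G) (N := N) u
    by_cases ht : t = 2 * maxDep G N u + 2 - depth G N u ∧ (u ≠ N.leader ∧ v = par G N u)
    · rw [if_pos ht]
      have h1 := ready_of_le (N := N) (t := t) hG (v := u) (by omega)
      obtain ⟨x, hx⟩ := Option.isSome_iff_exists.1 (hr.1.2 h1)
      obtain rfl := hr.2 x hx
      have hdt := depth_le_of_forall hG h1.1
      rw [hx, Option.bind_some, dep_eq hG, if_pos hdt, parId_eq hG ht.2.1 hdt, if_pos]
      exact ⟨view_leader_false.2 ht.2.1, by rw [ht.2.2], by simp only [Option.getD_some]; omega⟩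
    · rw [if_neg ht]
      cases hx : Local.report (view G N u) (bheard G N ω t u) with
      | none => rfl
      | some x =>
        have h1 := hr.1.1 (by rw [hx]; rfl)
        obtain rfl := hr.2 x hx
        have hdt := depth_le_of_forall hG h1.1
        rw [Option.bind_some, dep_eq hG, if_pos hdt, if_neg]
        rintro ⟨h2, h3, h4⟩
        rw [view_leader_false] at h2
        rw [parId_eq hG h2 hdt] at h3
        refine ht ⟨?_, h2, N.ident.injective h3⟩
        simp only [Option.getD_some] at h4
        omega

theorem report_eq_of_eq_some {t : ℕ} {v : V} {x}
    (h : Local.report (view G N v) (bheard G N ω t v) = some x) :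
    x = (maxDep G N v, size G N v, maxDeg G N v) ∧ ∀ u, G.Adj u v → depth G N u < t :=
  have hr := report_heard (ω := ω) hG (t := t) (fun i _ _ _ h => sent_up (N := N) hG i h) (v := v)
  ⟨hr.2 x h, (hr.1.1 (by rw [h]; rfl)).1⟩

theorem report_eq {t : ℕ} {v : V} (ht : 2 * maxDep G N v + 2 ≤ t + depth G N v) :
    Local.report (view G N v) (bheard G N ω t v) =
      some (maxDep G N v, size G N v, maxDeg G N v) := by
  have hr := report_heard (ω := ω) hG (t := t) (fun i _ _ _ h => sent_up (N := N) hG i h) (v := v)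
  obtain ⟨x, hx⟩ := Option.isSome_iff_exists.1 (hr.1.2 (ready_of_le hG ht))
  rw [hx, hr.2 x hx]

theorem upSize_eq {t : ℕ} {c v : V} (hc : c ∈ kids G N v)
    (ht : 2 * maxDep G N v + 2 ≤ t + depth G N v) :
    Local.upSize (bheard G N ω t v) (N.ident c) = size G N c := by
  have h1 := (isParent_iff hG).1 ((mem_kids hG).1 hc)
  have := got_heard (fun i (_ : i < t) => sent_up (N := N) (ω := ω) hG i (mem_kids_adj hG hc))
  unfold Local.upSize
  rw [this, if_pos ⟨(ready_of_le hG ht).2 c hc, h1.1, h1.2.symm⟩]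
  simp

/-! ### Broadcast of global parameters and preorder numbers. -/

section Down

variable {t : ℕ} (hD : ∀ i < t, ∀ u v, G.Adj u v → bsent G N ω i u v .down =
  if i = 2 * height G N + 2 + depth G N u ∧ v ∈ kids G N u then
    some (Nat.pair (Nat.pair (height G N) (Fintype.card V))
      (Nat.pair (maxDeg G N N.leader) (pre G N v))) else none)
include hD

theorem info_heard {v : V} :
    (2 * height G N + 2 + depth G N v ≤ t →
      (Local.info (view G N v) (bheard G N ω t v)).isSome) ∧
    ∀ x, Local.info (view G N v) (bheard G N ω t v) = some x →
      x = (height G N, Fintype.card V, maxDeg G N N.leader, pre G N v) ∧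
        (∀ u, G.Adj u v → depth G N u < t) ∧
        (v ≠ N.leader → 2 * height G N + 2 + depth G N v ≤ t) := by
  unfold Local.info
  by_cases hv : v = N.leader
  · subst hv
    rw [if_pos (by simp [view_leader])]
    constructor
    · intro ht
      rw [report_eq hG (by rw [depth_leader] at *; exact ht)]
      rfl
    · intro x hx
      obtain ⟨y, hy, rfl⟩ := Option.map_eq_some_iff.1 hx
      obtain ⟨rfl, h2⟩ := report_eq_of_eq_some hG hy
      refine ⟨?_, h2, fun h => absurd rfl h⟩
      simp only [height, size_leader hG, pre_leader]
  · rw [if_neg (by simp [view_leader, hv])]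
    have hpar := depth_par hG hv
    have hgot := got_heard (fun i (hi : i < t) => hD i hi _ v (adj_par hG hv))
    have hk : v ∈ kids G N (par G N v) := (mem_kids hG).2 (isParent_par hG hv)
    constructor
    · intro ht
      rw [parId_eq hG hv (by omega), hgot, if_pos ⟨by omega, hk⟩]
      rfl
    · intro x hx
      obtain ⟨y, hy, rfl⟩ := Option.map_eq_some_iff.1 hx
      by_cases hdt : depth G N v ≤ t
      · rw [parId_eq hG hv hdt, hgot] at hy
        split_ifs at hy with h1
        obtain rfl := (Option.some.inj hy).symm
        refine ⟨by simp, fun u hu => ?_, fun _ => by omega⟩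
        have := depth_le_of_adj (N := N) hG hu.symm
        omega
      -- Before the flood arrives, `parId` is meaningless, but no neighbour can have broadcast yet
      -- either.
      · exfalso
        unfold Local.got at hy
        split_ifs at hy with h1
        obtain ⟨z, i, hz⟩ := h1
        obtain ⟨hi, u, -, ha, hs⟩ := blockProgram.exists_of_heard G N ω hz
        rw [show bsent G N ω i u v .down = _ from hD i hi u v ha] at hs
        split_ifs at hs with h2
        have := depth_le_of_adj (N := N) hG ha
        omega

theorem pos_heard {v : V} :
    (2 * height G N + 2 + depth G N v ≤ t →
      Local.pos (view G N v) (bheard G N ω t v) = some (gpos G N v)) ∧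
    ∀ p, Local.pos (view G N v) (bheard G N ω t v) = some p → p = gpos G N v := by
  have hi := info_heard hG hD (v := v)
  have key : ∀ x, Local.info (view G N v) (bheard G N ω t v) = some x →
      Local.pos (view G N v) (bheard G N ω t v) = some (gpos G N v) := by
    intro x hx
    obtain ⟨rfl, h2, h3⟩ := hi.2 x hx
    have hm := maxDep_le_height (N := N) hG v
    have hrep : Local.report (view G N v) (bheard G N ω t v) =
        some (maxDep G N v, size G N v, maxDeg G N v) := by
      by_cases hv : v = N.leader
      · unfold Local.info at hx
        rw [if_pos (by simp [view_leader, hv])] at hx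
        obtain ⟨y, hy, -⟩ := Option.map_eq_some_iff.1 hx
        rw [hy, (report_eq_of_eq_some hG hy).1]
      · have := h3 hv
        exact report_eq hG (by omega)
    have hdt := depth_le_of_forall hG h2
    have hpar : Local.parId (view G N v) (bheard G N ω t v) = (gpos G N v).par := by
      by_cases hv : v = N.leader
      -- At the leader the default value `sInf ∅ = 0` agrees with the convention in `gpos`.
      · unfold gpos Local.parId
        rw [dep_eq hG, if_pos hdt]
        subst hv
        simp
      · rw [parId_eq hG hv hdt]
        simp [gpos, hv]
    unfold Local.pos
    rw [hx, Option.map_some, hrep, dep_eq hG, if_pos hdt, kids_eq hG h2, hpar]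
    rfl
  constructor
  · intro ht
    obtain ⟨x, hx⟩ := Option.isSome_iff_exists.1 (hi.1 ht)
    exact key x hx
  · intro p hp
    obtain ⟨x, hx, -⟩ := Option.map_eq_some_iff.1 hp
    exact (Option.some.inj ((key x hx).symm.trans hp)).symm

end Down

theorem sent_down (t : ℕ) {u v : V} (huv : G.Adj u v) : bsent G N ω t u v .down =
    if t = 2 * height G N + 2 + depth G N u ∧ v ∈ kids G N u then
      some (Nat.pair (Nat.pair (height G N) (Fintype.card V))
        (Nat.pair (maxDeg G N N.leader) (pre G N v))) else none := by
  classical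
  induction t using Nat.strong_induction_on generalizing u v with
  | _ t ih =>
    have hp := pos_heard (ω := ω) hG (fun i hi u v h => ih i hi h) (v := u)
    rw [blockProgram.sent_of_adj _ _ _ _ huv]
    change Local.sendDown (view G N u) (bheard G N ω t u) t (N.ident v) = _
    unfold Local.sendDown
    by_cases ht : t = 2 * height G N + 2 + depth G N u ∧ v ∈ kids G N u
    · rw [if_pos ht, hp.1 ht.1.ge, Option.bind_some,
        if_pos ⟨Finset.mem_map_of_mem _ ht.2, ht.1⟩]
      congr 3
      change pre G N u + 1 + ∑ s ∈ ((kids G N u).map N.ident).filter (· < N.ident v), _ = _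
      obtain ⟨h1, rfl⟩ := (isParent_iff hG).1 ((mem_kids hG).1 ht.2)
      rw [pre_eq hG h1, offset, Finset.filter_map, Finset.sum_map]
      congr 1
      have hm := maxDep_le_height (N := N) hG (par G N v)
      refine Finset.sum_congr rfl fun c hc => ?_
      exact upSize_eq hG (Finset.mem_filter.1 hc).1 (by omega)
    · rw [if_neg ht]
      cases hx : Local.pos (view G N u) (bheard G N ω t u) with
      | none => rfl
      | some p =>
        obtain rfl := hp.2 p hx
        rw [Option.bind_some, if_neg]
        rintro ⟨h1, h2⟩
        refine ht ⟨h2, ?_⟩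
        obtain ⟨c, hc, h3⟩ := Finset.mem_map.1 h1
        rwa [← N.ident.injective h3]

theorem pos_eq {t : ℕ} {v : V} (ht : 2 * height G N + 2 + depth G N v ≤ t) :
    Local.pos (view G N v) (bheard G N ω t v) = some (gpos G N v) :=
  (pos_heard hG (t := t) (fun i _ _ _ h => sent_down hG i h)).1 ht

theorem eq_of_pos_eq_some {t : ℕ} {v : V} {p : Pos}
    (h : Local.pos (view G N v) (bheard G N ω t v) = some p) : p = gpos G N v :=
  (pos_heard hG (t := t) (fun i _ _ _ h => sent_down hG i h)).2 p h

end BFS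

/-! ### Preorder numbers of neighbours and subtree ranges -/

theorem Pos.send_eq_none {p : Pos} {t : ℕ} (ht : t < p.base) (h : Hist) (coin : ℕ → ℕ → Bool)
    (j : ℕ) (c : Chan) : p.send t h coin j c = none := by
  have h1 : ¬ p.start ≤ t := by unfold Pos.start; omega
  cases c <;> simp [Pos.send, h1, ht.ne]; omega

/-- The generating relation on two edges at `v`. -/
theorem sim0_edgeOf_iff {V : Type*} {G T : SimpleGraph V} {r : V} {pre : V → ℕ}
    {u v w : V} (h : G.Adj u v) (k : G.Adj v w) :
    Sim0 G T r pre (edgeOf h) (edgeOf k) ↔ IsParent T r v w ∧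
      ((¬ T.Adj v u ∧ (pre u < pre v ∨ pre v + descCount T r v ≤ pre u)) ∨
        (IsParent T r u v ∧ (lowNum G T r pre u < pre v ∨
          pre v + descCount T r v ≤ highNum G T r pre u))) := by
  constructor
  · rintro (⟨w', v', p, he, hf, hp, ht, hw⟩ | ⟨v', p, q, he, hf, hp, hq, hlh⟩)
    · have he : s(u, v) = s(w', v') := he
      have hf : s(v, w) = s(v', p) := hf
      rw [Sym2.eq_iff] at he hf
      rcases he with ⟨rfl, rfl⟩ | ⟨rfl, rfl⟩ <;> rcases hf with ⟨h1, rfl⟩ | ⟨h1, h2⟩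
      · exact ⟨hp, .inl ⟨fun k => ht k.symm, hw⟩⟩
      · exact absurd (h1 ▸ hp.1) (SimpleGraph.irrefl _)
      · exact absurd h1.symm h.ne
      · exact absurd (h1 ▸ hp.1.symm) ht
    · have he : s(u, v) = s(v', p) := he
      have hf : s(v, w) = s(p, q) := hf
      rw [Sym2.eq_iff] at he hf
      have hd1 := hp.2
      have hd2 := hq.2
      rcases he with ⟨rfl, rfl⟩ | ⟨rfl, rfl⟩ <;> rcases hf with ⟨h1, h2⟩ | ⟨h1, h2⟩
      · subst h2; exact ⟨hq, .inr ⟨hp, hlh⟩⟩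
      · rw [← h1] at hd2; omega
      · exact absurd h1.symm h.ne
      · rw [← h1] at hd2; omega
  · rintro ⟨hp, ⟨ht, hw⟩ | ⟨hu, hlh⟩⟩
    · exact .inl ⟨u, v, w, rfl, rfl, hp, fun k => ht k.symm, hw⟩
    · exact .inr ⟨u, v, w, rfl, rfl, hu, hp, hlh⟩

namespace BFS

set_option linter.unusedSectionVars false

local notation "bsent" => Program.sent blockProgram
local notation "bheard" => Program.heard blockProgram
local notation "btossed" => Program.tossed blockProgram
local notation "view" => DistAlg.view

variable {V : Type*} [Fintype V] [DecidableEq V] {G : SimpleGraph V} [DecidableRel G.Adj]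
  {N : Network V} {ω : Coins V}

/-- The first round in which every vertex knows its position. -/
noncomputable def base (G : SimpleGraph V) (N : Network V) : ℕ := 3 * height G N + 2

open Classical in
/-- The neighbours of `v` along edges outside the tree. -/
noncomputable def cross (G : SimpleGraph V) (N : Network V) (v : V) : Finset V :=
  Finset.univ.filter fun u => G.Adj v u ∧ ¬ (tree G N).Adj v u

theorem mem_cross {u v : V} : u ∈ cross G N v ↔ G.Adj v u ∧ ¬ (tree G N).Adj v u := by
  simp [cross]

theorem mem_cross_comm {u v : V} : u ∈ cross G N v ↔ v ∈ cross G N u := by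
  rw [mem_cross, mem_cross, SimpleGraph.adj_comm, SimpleGraph.adj_comm (tree G N)]

/-- The least preorder number in the subtree neighbourhood. -/
noncomputable abbrev low (G : SimpleGraph V) (N : Network V) (v : V) : ℕ :=
  lowNum G (tree G N) N.leader (pre G N) v

/-- The greatest preorder number in the subtree neighbourhood. -/
noncomputable abbrev high (G : SimpleGraph V) (N : Network V) (v : V) : ℕ :=
  highNum G (tree G N) N.leader (pre G N) v

theorem gpos_base (v : V) : (gpos G N v).base = base G N := rfl
theorem gpos_lead (v : V) : (gpos G N v).lead = false ↔ v ≠ N.leader := by simp [gpos]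

theorem mem_gpos_kids {c v : V} : N.ident c ∈ (gpos G N v).kids ↔ c ∈ kids G N v := by
  unfold gpos; rw [Finset.mem_map' ]

variable (hG : G.Connected)
include hG

/-- The flag excludes the leader, whose default parent 0 may be the identifier of a neighbour. -/
theorem eq_par_iff {u v : V} : ((gpos G N u).lead = false ∧ N.ident v = (gpos G N u).par) ↔
    u ∈ kids G N v := by
  rw [mem_kids hG, isParent_iff hG, gpos_lead]
  refine and_congr_right fun h => ?_
  simp only [gpos, if_neg h]
  rw [N.ident.injective.eq_iff, eq_comm]

theorem gpos_cross (v : V) : (gpos G N v).cross = (cross G N v).map N.ident := by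
  classical
  ext j
  unfold Pos.cross
  rw [Finset.mem_filter, Finset.mem_map]
  constructor
  · rintro ⟨h1, h2, h3⟩
    obtain ⟨u, hu, rfl⟩ := Finset.mem_map.1 h1
    change N.ident u ∉ _ at h2
    change ¬ (_ ∧ N.ident u = _) at h3
    rw [mem_gpos_kids, mem_kids hG, isParent_iff hG] at h2
    rw [eq_par_iff hG, mem_kids hG, isParent_iff hG] at h3
    refine ⟨u, mem_cross.2 ⟨(G.mem_neighborFinset v u).1 hu, ?_⟩, rfl⟩
    rw [tree_adj hG]
    tauto
  · rintro ⟨u, hu, rfl⟩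
    obtain ⟨h1, h2⟩ := mem_cross.1 hu
    rw [tree_adj hG] at h2
    refine ⟨Finset.mem_map_of_mem _ ((G.mem_neighborFinset v u).2 h1), ?_, ?_⟩
    · change N.ident u ∉ _
      rw [mem_gpos_kids, mem_kids hG, isParent_iff hG]
      tauto
    · change ¬ (_ ∧ N.ident u = _)
      rw [eq_par_iff hG, mem_kids hG, isParent_iff hG]
      tauto

variable [Nontrivial V]

/-- After the construction of the tree, all vertices act according to their position. -/
theorem sent_late (t : ℕ) {u v : V} (huv : G.Adj u v) {c : Chan}
    (hc : c ≠ .flood ∧ c ≠ .up ∧ c ≠ .down) :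
    bsent G N ω t u v c =
      (gpos G N u).send t (bheard G N ω t u) (btossed G N ω t u) (N.ident v) c := by
  rw [blockProgram.sent_of_adj _ _ _ _ huv]
  have : blockProgram.send (blockProgram.know G N ω t u) (N.ident v) c =
      (Local.pos (view G N u) (bheard G N ω t u)).bind fun p =>
        p.send t (bheard G N ω t u) (btossed G N ω t u) (N.ident v) c := by
    cases c <;> first | rfl | simp at hc
  rw [this]
  have hd := depth_le_height (N := N) hG u
  cases hx : Local.pos (view G N u) (bheard G N ω t u) with
  -- A position is unknown only before round `base`, when `Pos.send` is silent anyway.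
  | none =>
    rw [Option.bind_none, Pos.send_eq_none]
    by_contra ht
    rw [gpos_base, base] at ht
    rw [pos_eq hG (by omega)] at hx
    simp at hx
  | some p => rw [eq_of_pos_eq_some hG hx, Option.bind_some]

theorem sent_number (t : ℕ) {u v : V} (huv : G.Adj u v) :
    bsent G N ω t u v .number = if t = base G N then some (pre G N u) else none :=
  sent_late hG t huv (by simp)

theorem num_eq {t : ℕ} {u v : V} (huv : G.Adj u v) (ht : base G N < t) :
    (gpos G N v).num (bheard G N ω t v) (N.ident u) = pre G N u := by
  rw [Pos.num, gpos_base, blockProgram.heard_ident, if_pos ht, sent_number hG _ huv, if_pos rfl]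
  rfl

omit [Nontrivial V] in
-- The recursion by which `low` and `high` are computed from the leaves upwards.
theorem subtreeNbhd_eq (v : V) : subtreeNbhd G (tree G N) N.leader v =
    {v} ∪ (cross G N v : Set V) ∪ ⋃ c ∈ kids G N v, subtreeNbhd G (tree G N) N.leader c := by
  ext x
  simp only [Set.mem_union, Set.mem_singleton_iff, Set.mem_iUnion, Finset.mem_coe, mem_cross,
    mem_kids hG]
  constructor
  · rintro (hx | ⟨d, hd, hdx⟩)
    · by_cases hxv : x = v
      · exact .inl (.inl hxv)
      · obtain ⟨c, hc, hxc⟩ := hx.exists_child hxv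
        exact .inr ⟨c, hc, .inl hxc⟩
    · by_cases hdv : d = v
      · subst hdv; exact .inl (.inr hdx)
      · obtain ⟨c, hc, hdc⟩ := hd.exists_child hdv
        exact .inr ⟨c, hc, .inr ⟨d, hdc, hdx⟩⟩
  · rintro ((rfl | hx) | ⟨c, hc, hx | ⟨d, hd, hdx⟩⟩)
    · exact .inl (.refl _ _ _)
    · exact .inr ⟨v, .refl _ _ _, hx⟩
    · exact .inl (hx.trans hc.isDesc)
    · exact .inr ⟨d, hd.trans hc.isDesc, hdx⟩

omit hG [Nontrivial V] in
theorem subtreeNbhd_nonempty (v : V) :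
    (pre G N '' subtreeNbhd G (tree G N) N.leader v).Nonempty :=
  ⟨_, Set.mem_image_of_mem _ (.inl (.refl _ _ _))⟩

omit [Nontrivial V] in
theorem low_eq (v : V) :
    sInf ({pre G N v} ∪ pre G N '' cross G N v ∪ low G N '' kids G N v) = low G N v := by
  have hne : ({pre G N v} ∪ pre G N '' cross G N v ∪ low G N '' kids G N v).Nonempty :=
    ⟨pre G N v, .inl (.inl rfl)⟩
  have hsub := subtreeNbhd_eq (N := N) hG v
  apply le_antisymm
  · refine le_csInf (subtreeNbhd_nonempty v) ?_
    rintro _ ⟨x, hx, rfl⟩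
    rw [hsub] at hx
    rcases hx with (rfl | hx) | hx
    · exact Nat.sInf_le (.inl (.inl rfl))
    · exact Nat.sInf_le (.inl (.inr ⟨x, hx, rfl⟩))
    · simp only [Set.mem_iUnion] at hx
      obtain ⟨c, hc, hx⟩ := hx
      exact (Nat.sInf_le (.inr ⟨c, hc, rfl⟩)).trans (Nat.sInf_le (Set.mem_image_of_mem _ hx))
  · refine le_csInf hne ?_
    rintro _ ((rfl | ⟨x, hx, rfl⟩) | ⟨c, hc, rfl⟩)
    · exact Nat.sInf_le ⟨v, .inl (.refl _ _ _), rfl⟩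
    · exact Nat.sInf_le ⟨x, by rw [hsub]; exact .inl (.inr hx), rfl⟩
    · refine csInf_le_csInf (OrderBot.bddBelow _) (subtreeNbhd_nonempty c)
        (Set.image_mono ?_)
      rw [hsub]
      intro x hx
      exact .inr (Set.mem_biUnion hc hx)

omit [Nontrivial V] in
theorem high_eq (v : V) :
    sSup ({pre G N v} ∪ pre G N '' cross G N v ∪ high G N '' kids G N v) = high G N v := by
  have hne : ({pre G N v} ∪ pre G N '' cross G N v ∪ high G N '' kids G N v).Nonempty :=
    ⟨pre G N v, .inl (.inl rfl)⟩
  have hb : BddAbove ({pre G N v} ∪ pre G N '' cross G N v ∪ high G N '' kids G N v) :=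
    (Set.toFinite _).bddAbove
  have hb' : ∀ c, BddAbove (pre G N '' subtreeNbhd G (tree G N) N.leader c) := fun c =>
    (Set.toFinite _).bddAbove
  have hsub := subtreeNbhd_eq (N := N) hG v
  apply le_antisymm
  · refine csSup_le hne ?_
    rintro _ ((rfl | ⟨x, hx, rfl⟩) | ⟨c, hc, rfl⟩)
    · exact le_csSup (hb' v) ⟨v, .inl (.refl _ _ _), rfl⟩
    · exact le_csSup (hb' v) ⟨x, by rw [hsub]; exact .inl (.inr hx), rfl⟩
    · refine csSup_le_csSup (hb' v) (subtreeNbhd_nonempty c) (Set.image_mono ?_)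
      rw [hsub]
      intro x hx
      exact .inr (Set.mem_biUnion hc hx)
  · refine csSup_le (subtreeNbhd_nonempty v) ?_
    rintro _ ⟨x, hx, rfl⟩
    rw [hsub] at hx
    rcases hx with (rfl | hx) | hx
    · exact le_csSup hb (.inl (.inl rfl))
    · exact le_csSup hb (.inl (.inr ⟨x, hx, rfl⟩))
    · simp only [Set.mem_iUnion] at hx
      obtain ⟨c, hc, hx⟩ := hx
      exact (le_csSup (hb' c) (Set.mem_image_of_mem _ hx)).trans (le_csSup hb (.inr ⟨c, hc, rfl⟩))

/-- The children of `u` send one round before `u`, and all preorder numbers were exchanged in round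
`base`. -/
theorem sent_range (t : ℕ) {u v : V} (huv : G.Adj u v) : bsent G N ω t u v .range =
    if u ∈ kids G N v ∧ t = base G N + 1 + (height G N - depth G N u) then
      some (Nat.pair (low G N u) (high G N u)) else none := by
  induction t using Nat.strong_induction_on generalizing u v with
  | _ t ih =>
    rw [sent_late hG t huv (by simp)]
    simp only [Pos.send, ← and_assoc, eq_par_iff hG]
    change (if u ∈ kids G N v ∧ t = base G N + 1 + (height G N - depth G N u) then _ else _) = _
    split_ifs with ht
    · have hb : base G N < t := by omega
      have hkid : ∀ c ∈ kids G N u, (gpos G N u).kidRange (bheard G N ω t u) (N.ident c) =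
          Nat.pair (low G N c) (high G N c) := by
        intro c hc
        have h1 := depth_of_mem_kids hG hc
        have h2 := depth_le_height (N := N) hG c
        have h3 : base G N + 1 + (height G N - depth G N c) < t := by omega
        change ((bheard G N ω t u) (base G N + 1 + (height G N - (depth G N u + 1)))
          (N.ident c) .range).getD 0 = _
        rw [← h1, blockProgram.heard_ident, if_pos h3, ih _ h3 (mem_kids_adj hG hc),
          if_pos ⟨hc, rfl⟩]
        rfl
      have hnum : (gpos G N u).num (bheard G N ω t u) '' (gpos G N u).cross =
          pre G N '' cross G N u := by
        rw [gpos_cross hG, Finset.coe_map, Set.image_image]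
        exact Set.image_congr fun x hx => num_eq hG (mem_cross.1 hx).1.symm hb
      have hlow : (gpos G N u).low (bheard G N ω t u) = low G N u := by
        rw [← low_eq hG u, Pos.low, hnum]
        congr 2
        change _ '' (((kids G N u).map N.ident : Finset ℕ) : Set ℕ) = _
        rw [Finset.coe_map, Set.image_image]
        exact Set.image_congr fun c hc => by rw [hkid c hc]; simp
      have hhigh : (gpos G N u).high (bheard G N ω t u) = high G N u := by
        rw [← high_eq hG u, Pos.high, hnum]
        congr 2
        change _ '' (((kids G N u).map N.ident : Finset ℕ) : Set ℕ) = _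
        rw [Finset.coe_map, Set.image_image]
        exact Set.image_congr fun c hc => by rw [hkid c hc]; simp
      rw [hlow, hhigh]
    · rfl

/-- The first round in which all subtree ranges are known. -/
noncomputable def start (G : SimpleGraph V) (N : Network V) : ℕ := base G N + height G N + 3

omit hG [Nontrivial V] in
theorem gpos_start (v : V) : (gpos G N v).start = start G N := rfl

/-- The bound `start ≤ t + 1` allows for the delay of one round between a state and the messages it
has read. -/
theorem escapes_iff {t : ℕ} {c v : V} (hc : c ∈ kids G N v) (ht : start G N ≤ t + 1) :
    (gpos G N v).Escapes (bheard G N ω t v) (N.ident c) ↔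
      (low G N c < pre G N v ∨
        pre G N v + descCount (tree G N) N.leader v ≤ high G N c) := by
  have h1 := depth_of_mem_kids hG hc
  have h3 : base G N + 1 + (height G N - depth G N c) < t := by unfold start at ht; omega
  have hkid : (gpos G N v).kidRange (bheard G N ω t v) (N.ident c) =
      Nat.pair (low G N c) (high G N c) := by
    change ((bheard G N ω t v) (base G N + 1 + (height G N - (depth G N v + 1)))
      (N.ident c) .range).getD 0 = _
    rw [← h1, blockProgram.heard_ident, if_pos h3, sent_range hG _ (mem_kids_adj hG hc),
      if_pos ⟨hc, rfl⟩]
    rfl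
  unfold Pos.Escapes
  rw [hkid, ← size_eq_descCount]
  simp [gpos]

/-- The children whose subtree neighbourhood is not contained in the subtree of the parent. -/
theorem escapes_iff_exists {t : ℕ} {c v : V} (hc : c ∈ kids G N v) (ht : start G N ≤ t + 1) :
    (gpos G N v).Escapes (bheard G N ω t v) (N.ident c) ↔
      ∃ x ∈ subtreeNbhd G (tree G N) N.leader c, ¬ IsDesc (tree G N) N.leader x v := by
  rw [escapes_iff hG hc ht, (isPreorderedSpanningTree hG).low_high_iff]

theorem sim0Output_iff {t : ℕ} (ht : start G N ≤ t + 1) {u v w : V} (h : G.Adj u v)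
    (k : G.Adj v w) :
    (gpos G N v).sim0Output (bheard G N ω t v) (N.ident u) (N.ident w) = true ↔
      Sim0 G (tree G N) N.leader (pre G N) (edgeOf h) (edgeOf k) := by
  classical
  have hb : base G N < t := by unfold start at ht; omega
  rw [sim0_edgeOf_iff, Pos.sim0Output, decide_eq_true_iff, eq_par_iff hG,
    mem_kids hG, mem_gpos_kids, num_eq hG h hb, gpos_cross hG]
  change _ ∧ ((N.ident u ∈ _ ∧ _) ∨ _) ↔ _
  rw [Finset.mem_map', mem_cross]
  change _ ∧ (_ ∧ (pre G N u < pre G N v ∨ pre G N v + size G N v ≤ pre G N u) ∨ _) ↔ _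
  rw [size_eq_descCount]
  refine and_congr_right fun _ => or_congr ?_ ?_
  · simp [h.symm]
  · rw [mem_kids hG]
    refine and_congr_right fun hu => ?_
    exact escapes_iff hG ((mem_kids hG).2 hu) ht

/-! ### Halting and correctness for the generating relation. -/

theorem state_pos_of_le {t : ℕ} (ht : start G N ≤ t) (v : V) :
    Local.pos ((blockProgram.ideal G N ω t).state v).view
      ((blockProgram.ideal G N ω t).state v).hist = some (gpos G N v) := by
  have := depth_le_height (N := N) hG v
  rw [blockProgram.state_view, blockProgram.state_hist]
  exact pos_eq hG (by unfold start base at ht; omega)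

theorem eq_of_state_pos {t : ℕ} {v : V} {p : Pos}
    (h : Local.pos ((blockProgram.ideal G N ω t).state v).view
      ((blockProgram.ideal G N ω t).state v).hist = some p) : p = gpos G N v := by
  rw [blockProgram.state_view, blockProgram.state_hist] at h
  exact eq_of_pos_eq_some hG h

theorem haltSim0_isSome_iff (t : ℕ) (v : V) :
    (haltSim0 ((blockProgram.ideal G N ω t).state v)).isSome ↔ start G N ≤ t := by
  unfold haltSim0
  constructor
  · intro h
    obtain ⟨o, ho⟩ := Option.isSome_iff_exists.1 h
    obtain ⟨p, hp, h1⟩ := Option.bind_eq_some_iff.1 ho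
    obtain rfl := eq_of_state_pos hG hp
    split_ifs at h1 with h2
    rwa [gpos_start, blockProgram.state_time] at h2
  · intro h
    rw [state_pos_of_le hG h, Option.bind_some, if_pos]
    · rfl
    · rwa [gpos_start, blockProgram.state_time]

theorem correctSim0Output {t : ℕ} {out : V → ℕ → ℕ → Bool}
    (h : (blockProgram.alg haltSim0).HaltsWith G N ω t out) : CorrectSim0Output G N out := by
  have : Nonempty V := ⟨N.leader⟩
  obtain ⟨T, -, hT, hout⟩ := blockProgram.exists_of_haltsWith G N ω haltSim0
    (haltSim0_isSome_iff hG) h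
  refine ⟨tree G N, pre G N, isPreorderedSpanningTree hG, fun u v w a b => ?_⟩
  have hv := hout v
  unfold haltSim0 at hv
  rw [state_pos_of_le hG hT, Option.bind_some] at hv
  split_ifs at hv
  rw [← Option.some.inj hv, blockProgram.state_hist]
  exact sim0Output_iff hG (by omega) a b

end BFS

/-! ### One attempt: random circulation, labels, verification -/

theorem encBits_congr {k : ℕ} {f g : ℕ → ZMod 2} (h : ∀ l < k, f l = g l) :
    encBits k f = encBits k g := by
  unfold encBits
  congr 1
  funext l
  rw [h l l.2]

namespace BFS

set_option linter.unusedSectionVars false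

local notation "bsent" => Program.sent blockProgram
local notation "bheard" => Program.heard blockProgram
local notation "btossed" => Program.tossed blockProgram

variable {V : Type*} [Fintype V] [DecidableEq V] (G : SimpleGraph V) [DecidableRel G.Adj]
  (N : Network V) (ω : Coins V)

/-- The number of random bits per message. -/
def width (V : Type*) [Fintype V] : ℕ := Nat.log 2 (Fintype.card V) + 1

/-- The number of messages with random bits per edge and attempt. -/
noncomputable def chunks : ℕ := maxDeg G N N.leader / width V + 2

/-- The number of rounds of one attempt. -/
noncomputable def period : ℕ := 2 * chunks G N + 4 * height G N + 6

/-- The first round of attempt `a`. -/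
noncomputable def beg (a : ℕ) : ℕ := start G N + a * period G N

/-- A random bit for the edge from `x` to `u`. -/
noncomputable def coinBit (a i l : ℕ) (x u : V) : ZMod 2 :=
  bitVal (ω (x, beg G N a + i, N.ident u * width V + l))

/-- A random bit of the edge from `v` to its parent: the sum of the bits of all non-tree edges
leaving the subtree of `v`. -/
noncomputable def flow (a i l : ℕ) (v : V) : ZMod 2 :=
  ∑ x ∈ descs G N v, ∑ u ∈ cross G N x, (coinBit G N ω a i l x u + coinBit G N ω a i l u x)

/-- A set of children of `v` whose random bits cancel. -/
def ZeroSum (a : ℕ) (v : V) (S : Finset V) : Prop :=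
  S ⊆ kids G N v ∧ ∀ i < chunks G N, ∀ l < width V, ∑ c ∈ S, flow G N ω a i l c = 0

def UpLink (a : ℕ) (v c : V) : Prop := ∀ S, ZeroSum G N ω a v S → c ∉ S

def Link (a : ℕ) (v b c : V) : Prop := ∀ S, ZeroSum G N ω a v S → (b ∈ S ↔ c ∈ S)

open Classical in
noncomputable def labAux (a : ℕ) : ℕ → V → ℕ
  | 0, _ => 0
  | k + 1, v => if UpLink G N ω a (par G N v) v then labAux a k (par G N v) else
      sInf (pre G N '' {c | c ∈ kids G N (par G N v) ∧ Link G N ω a (par G N v) v c})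

/-- The label of the edge from `v` to its parent in attempt `a`. -/
noncomputable def lab (a : ℕ) (v : V) : ℕ := labAux G N ω a (depth G N v) v

/-- The subtree neighbourhood of `c` is not contained in the subtree of `v`. -/
def Escapes (c v : V) : Prop :=
  ∃ x ∈ subtreeNbhd G (tree G N) N.leader c, ¬ IsDesc (tree G N) N.leader x v

/-- The labels at `v` respect the generating relation. -/
def Check (a : ℕ) (v : V) : Prop :=
  (∀ u ∈ cross G N v, lab G N ω a u = lab G N ω a v) ∧
    (v ≠ N.leader → ∀ c ∈ kids G N v, Escapes G N c v → lab G N ω a c = lab G N ω a v)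

variable {G N ω}

theorem gpos_beg {a o : ℕ} (ho : o < period G N) (v : V) :
    (gpos G N v).start ≤ beg G N a + o ∧ (gpos G N v).off (beg G N a + o) = o ∧
      (gpos G N v).beg (beg G N a + o) = beg G N a := by
  have h1 : (gpos G N v).off (beg G N a + o) = o := by
    change (start G N + a * period G N + o - start G N) % period G N = o
    rw [add_assoc, Nat.add_sub_cancel_left, add_comm, Nat.add_mul_mod_self_right,
      Nat.mod_eq_of_lt ho]
  refine ⟨?_, h1, ?_⟩
  · rw [gpos_start, beg]; omega
  · rw [Pos.beg, h1, Nat.add_sub_cancel]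

theorem exists_beg {t : ℕ} (ht : start G N ≤ t) :
    ∃ a o, o < period G N ∧ t = beg G N a + o := by
  have hp : 0 < period G N := by unfold period; omega
  refine ⟨(t - start G N) / period G N, (t - start G N) % period G N, Nat.mod_lt _ hp, ?_⟩
  have := Nat.div_add_mod (t - start G N) (period G N)
  rw [beg, mul_comm]
  omega

theorem gpos_chunks (v : V) : (gpos G N v).chunks = chunks G N := rfl
theorem gpos_width (v : V) : (gpos G N v).width = width V := rfl
theorem gpos_height (v : V) : (gpos G N v).height = height G N := rfl
theorem gpos_depth (v : V) : (gpos G N v).depth = depth G N v := rfl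
theorem gpos_period (v : V) : (gpos G N v).period = period G N := rfl
theorem gpos_kids (v : V) : (gpos G N v).kids = (kids G N v).map N.ident := rfl

theorem lab_leader (a : ℕ) : lab G N ω a N.leader = 0 := by
  rw [lab, depth_leader]; rfl

variable (hG : G.Connected)
include hG

theorem lab_eq {a : ℕ} {v : V}
    (hv : v ≠ N.leader) : lab G N ω a v =
      open Classical in if UpLink G N ω a (par G N v) v then lab G N ω a (par G N v) else
        sInf (pre G N '' {c | c ∈ kids G N (par G N v) ∧ Link G N ω a (par G N v) v c}) := by
  unfold lab
  rw [← depth_par hG hv]; rfl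

/-! ### Random bits and their pipelined summation. -/

variable [Nontrivial V]

theorem tossed_eq {t s : ℕ} {u v : V} (huv : G.Adj u v) (hs : start G N ≤ s) (hst : s ≤ t)
    {l : ℕ} (hl : l < width V) :
    btossed G N ω t u s (N.ident v * width V + l) = ω (u, s, N.ident v * width V + l) := by
  unfold Program.tossed
  rw [if_pos]
  refine ⟨hst, ?_⟩
  have key : ∀ K : Know, Local.pos K.view K.hist = some (gpos G N u) →
      blockProgram.toss K = ((gpos G N u).nbrs.sup id + 1) * width V := by
    intro K hK
    change (((Local.pos K.view K.hist).map _).getD 0) = _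
    rw [hK]
    rfl
  rw [key _ (state_pos_of_le hG hs u)]
  have h1 : N.ident v ≤ (gpos G N u).nbrs.sup id :=
    Finset.le_sup (f := id) (Finset.mem_map_of_mem _ ((G.mem_neighborFinset u v).2 huv))
  calc N.ident v * width V + l < N.ident v * width V + width V := by omega
    _ = (N.ident v + 1) * width V := by ring
    _ ≤ _ := Nat.mul_le_mul_right _ (by omega)

theorem sent_chunk {a i : ℕ} (hi : i < chunks G N) {u v : V} (huv : G.Adj u v) :
    bsent G N ω (beg G N a + i) u v .chunk =
      some (encBits (width V) fun l => coinBit G N ω a i l u v) := by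
  have hp := gpos_beg (G := G) (N := N) (a := a) (o := i) (by unfold period; omega) u
  rw [sent_late hG _ huv (by simp)]
  simp only [Pos.send, hp.2.1, gpos_chunks, gpos_width]
  rw [if_pos ⟨hp.1, hi⟩]
  congr 1
  refine encBits_congr fun l hl => ?_
  rw [tossed_eq hG huv hp.1 le_rfl hl]
  rfl

omit hG [Nontrivial V] in
/-- Reading a message of a neighbour. -/
theorem heard_eq {t i x : ℕ} {u v : V} {c : Chan} (h : bsent G N ω i u v c = some x) (hi : i < t) :
    bheard G N ω t v i (N.ident u) c = some x := by
  rw [blockProgram.heard_ident, if_pos hi, h]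

/-- The sums are pipelined: number `i` leaves depth `d` at offset `chunks + (height - d) + i`, one
round after the children have sent theirs. By offset `chunks` all random bits have been exchanged.
-/
theorem sent_sum {a i : ℕ} (hi : i < chunks G N) {u v : V} (huv : u ∈ kids G N v) :
    bsent G N ω (beg G N a + (chunks G N + (height G N - depth G N u) + i)) u v .sum =
      some (encBits (width V) fun l => flow G N ω a i l u) := by
  induction hn : height G N - depth G N u using Nat.strong_induction_on generalizing u v with
  | _ n ih =>
    have hadj := mem_kids_adj hG huv
    have hp := gpos_beg (G := G) (N := N) (a := a) (o := chunks G N + n + i)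
      (by unfold period; omega) u
    rw [sent_late hG _ hadj (by simp)]
    simp only [Pos.send, hp.2.1, hp.2.2, gpos_chunks, gpos_width, gpos_height, gpos_depth, hn,
      eq_par_iff hG]
    rw [if_pos ⟨hp.1, huv, by omega, by omega⟩]
    congr 1
    refine encBits_congr fun l hl => ?_
    rw [Nat.add_sub_cancel_left, flow, sum_descs hG]
    unfold Pos.acc
    rw [gpos_cross hG, gpos_kids, Finset.sum_map, Finset.sum_map]
    congr 1
    · refine Finset.sum_congr rfl fun x hx => ?_
      have hux := (mem_cross.1 hx).1
      change bitVal (btossed _ _ _ _ _ _ (N.ident x * width V + l)) +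
        bitOf (bheard _ _ _ _ _ _ (N.ident x) _) l = _
      rw [tossed_eq hG hux (by unfold beg; omega) (by omega) hl,
        heard_eq (sent_chunk hG hi hux.symm) (by omega), bitOf_encBits _ hl]
      rfl
    · refine Finset.sum_congr rfl fun c hc => ?_
      have h1 := depth_of_mem_kids hG hc
      have h2 := depth_le_height (N := N) hG c
      have h3 := ih (height G N - depth G N c) (by omega) hc rfl
      unfold Pos.kidSum
      rw [gpos_chunks, gpos_height, gpos_depth, ← h1]
      change bitOf (bheard _ _ _ _ _ _ (N.ident c) _) l = _
      rw [add_assoc (beg G N a), add_assoc (beg G N a), ← add_assoc, ← add_assoc,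
        add_assoc (beg G N a), add_assoc (beg G N a), heard_eq h3 (by omega),
        bitOf_encBits _ hl]
      rfl

theorem kidSum_eq {a i l t : ℕ} (hi : i < chunks G N) (hl : l < width V) {c v : V}
    (hc : c ∈ kids G N v)
    (ht : beg G N a + (2 * chunks G N + height G N) ≤ t) :
    (gpos G N v).kidSum (bheard G N ω t v) (beg G N a) i l (N.ident c) = flow G N ω a i l c := by
  have h1 := depth_of_mem_kids hG hc
  unfold Pos.kidSum
  rw [gpos_chunks, gpos_height, gpos_depth, ← h1,
    show beg G N a + chunks G N + (height G N - depth G N c) + i =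
      beg G N a + (chunks G N + (height G N - depth G N c) + i) by ring,
    heard_eq (sent_sum hG hi hc) (by omega), bitOf_encBits _ hl]

/-! ### Zero-sum sets and the labels of children. -/

section Sets

variable {a t : ℕ} {v : V} (ht : beg G N a + (2 * chunks G N + height G N) ≤ t)
include ht

theorem zeroSum_iff {S : Finset ℕ} :
    (gpos G N v).ZeroSum (bheard G N ω t v) (beg G N a) S ↔
      ∃ S' : Finset V, S'.map N.ident = S ∧ ZeroSum G N ω a v S' := by
  unfold Pos.ZeroSum ZeroSum
  rw [gpos_kids]
  have key : ∀ S' ⊆ kids G N v, ((∀ i < (gpos G N v).chunks, ∀ l < (gpos G N v).width,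
      ∑ j ∈ S'.map N.ident, (gpos G N v).kidSum (bheard G N ω t v) (beg G N a) i l j = 0) ↔
      ∀ i < chunks G N, ∀ l < width V, ∑ c ∈ S', flow G N ω a i l c = 0) := by
    intro S' hS
    rw [gpos_chunks, gpos_width]
    refine forall₂_congr fun i hi => forall₂_congr fun l hl => ?_
    rw [Finset.sum_map, Finset.sum_congr rfl fun c hc => kidSum_eq hG hi hl (hS hc) ht]
  constructor
  · rintro ⟨hS, h⟩
    obtain ⟨S', hS', rfl⟩ := Finset.subset_map_iff.1 hS
    exact ⟨S', rfl, hS', (key S' hS').1 h⟩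
  · rintro ⟨S', rfl, hS', h⟩
    exact ⟨Finset.map_subset_map.2 hS', (key S' hS').2 h⟩

theorem upLink_iff {c : V} : (gpos G N v).UpLink (bheard G N ω t v) (beg G N a) (N.ident c) ↔
    UpLink G N ω a v c := by
  unfold Pos.UpLink UpLink
  simp only [zeroSum_iff hG ht]
  constructor
  · exact fun h S hS hc => h _ ⟨S, rfl, hS⟩ (Finset.mem_map_of_mem _ hc)
  · rintro h _ ⟨S, rfl, hS⟩ hc
    exact h S hS ((Finset.mem_map' _).1 hc)

theorem link_iff {b c : V} :
    (gpos G N v).Link (bheard G N ω t v) (beg G N a) (N.ident b) (N.ident c) ↔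
      Link G N ω a v b c := by
  unfold Pos.Link Link
  simp only [zeroSum_iff hG ht]
  constructor
  · intro h S hS
    have := h _ ⟨S, rfl, hS⟩
    rwa [Finset.mem_map', Finset.mem_map'] at this
  · rintro h _ ⟨S, rfl, hS⟩
    rw [Finset.mem_map', Finset.mem_map']
    exact h S hS

theorem kidLabel_eq {c : V} (hc : c ∈ kids G N v)
    (hown : (gpos G N v).ownLabel (bheard G N ω t v) (beg G N a) = lab G N ω a v) :
    (gpos G N v).kidLabel (bheard G N ω t v) (beg G N a) (N.ident c) = lab G N ω a c := by
  classical
  obtain ⟨h1, h2⟩ := (isParent_iff hG).1 ((mem_kids hG).1 hc)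
  have hb : base G N < t := by unfold beg start at ht; omega
  rw [lab_eq hG h1, h2, Pos.kidLabel, hown]
  refine if_congr (upLink_iff hG ht) rfl ?_
  congr 1
  ext x
  constructor
  · rintro ⟨j, ⟨hj, hl⟩, rfl⟩
    obtain ⟨b, hb', rfl⟩ := Finset.mem_map.1 hj
    change Pos.Link _ _ _ (N.ident c) (N.ident b) at hl
    rw [link_iff hG ht] at hl
    exact ⟨b, ⟨hb', hl⟩, (num_eq hG (mem_kids_adj hG hb') hb).symm⟩
  · rintro ⟨b, ⟨hb', hl⟩, rfl⟩
    exact ⟨N.ident b, ⟨Finset.mem_map_of_mem _ hb', (link_iff hG ht).2 hl⟩,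
      num_eq hG (mem_kids_adj hG hb') hb⟩

end Sets

/-! ### Distribution of the labels. -/

theorem ownLabel_eq_of {a t : ℕ} {v : V}
    (h : v ≠ N.leader → bheard G N ω t v
      (beg G N a + (2 * chunks G N + height G N + 1 + depth G N (par G N v)))
      (N.ident (par G N v)) .label = some (lab G N ω a v)) :
    (gpos G N v).ownLabel (bheard G N ω t v) (beg G N a) = lab G N ω a v := by
  unfold Pos.ownLabel
  by_cases hv : v = N.leader
  · rw [if_pos (by simp [gpos, hv]), hv, lab_leader]
  · rw [if_neg (by simp [gpos, hv])]
    have h1 := h hv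
    have h2 := depth_par hG hv
    have h3 : (gpos G N v).par = N.ident (par G N v) := by simp [gpos, hv]
    have h4 : beg G N a + 2 * (gpos G N v).chunks + (gpos G N v).height + 1 +
        ((gpos G N v).depth - 1) =
          beg G N a + (2 * chunks G N + height G N + 1 + depth G N (par G N v)) := by
      rw [gpos_chunks, gpos_height, gpos_depth, ← h2]
      simp only [Nat.add_sub_cancel]
      ring
    rw [h3, h4, h1]
    rfl

theorem sent_label {a : ℕ} {u v : V} (huv : v ∈ kids G N u) :
    bsent G N ω (beg G N a + (2 * chunks G N + height G N + 1 + depth G N u)) u v .label =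
      some (lab G N ω a v) := by
  induction hn : depth G N u generalizing u v with
  | zero =>
    have hadj := (mem_kids_adj hG huv).symm
    have hp := gpos_beg (G := G) (N := N) (a := a) (o := 2 * chunks G N + height G N + 1 + 0)
      (by unfold period; omega) u
    rw [sent_late hG _ hadj (by simp)]
    simp only [Pos.send, hp.2.1, hp.2.2, gpos_chunks, gpos_height, gpos_depth, hn]
    rw [if_pos ⟨hp.1, mem_gpos_kids.2 huv, trivial⟩]
    congr 1
    refine kidLabel_eq hG (by omega) huv (ownLabel_eq_of hG fun h => ?_)
    exact absurd ((depth_eq_zero hG).1 hn) h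
  | succ n ih =>
    have hadj := (mem_kids_adj hG huv).symm
    have hd := depth_le_height (N := N) hG u
    have hp := gpos_beg (G := G) (N := N) (a := a)
      (o := 2 * chunks G N + height G N + 1 + (n + 1)) (by unfold period; omega) u
    rw [sent_late hG _ hadj (by simp)]
    simp only [Pos.send, hp.2.1, hp.2.2, gpos_chunks, gpos_height, gpos_depth, hn]
    rw [if_pos ⟨hp.1, mem_gpos_kids.2 huv, trivial⟩]
    congr 1
    refine kidLabel_eq hG (by omega) huv (ownLabel_eq_of hG fun h => ?_)
    have h1 := depth_par hG h
    have h2 : depth G N (par G N u) = n := by omega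
    rw [h2]
    exact heard_eq (ih ((mem_kids hG).2 (isParent_par hG h)) h2) (by omega)

theorem ownLabel_eq {a t : ℕ} {v : V}
    (ht : beg G N a + (2 * chunks G N + 2 * height G N + 1) ≤ t) :
    (gpos G N v).ownLabel (bheard G N ω t v) (beg G N a) = lab G N ω a v := by
  refine ownLabel_eq_of hG fun h => heard_eq
    (sent_label hG ((mem_kids hG).2 (isParent_par hG h))) ?_
  have h1 := depth_par hG h
  have hd := depth_le_height (N := N) hG v
  omega

theorem sent_labelX {a : ℕ} {u v : V} (huv : G.Adj u v) :
    bsent G N ω (beg G N a + (2 * chunks G N + 2 * height G N + 2)) u v .labelX =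
      some (lab G N ω a u) := by
  have hp := gpos_beg (G := G) (N := N) (a := a) (o := 2 * chunks G N + 2 * height G N + 2)
    (by unfold period; omega) u
  rw [sent_late hG _ huv (by simp)]
  simp only [Pos.send, hp.2.1, hp.2.2, gpos_chunks, gpos_height]
  rw [if_pos ⟨hp.1, trivial⟩, ownLabel_eq hG (by omega)]

theorem nbrLabel_eq {a t : ℕ} {u v : V} (huv : G.Adj u v)
    (ht : beg G N a + (2 * chunks G N + 2 * height G N + 3) ≤ t) :
    (gpos G N v).nbrLabel (bheard G N ω t v) (beg G N a) (N.ident u) = lab G N ω a u := by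
  unfold Pos.nbrLabel
  rw [gpos_chunks, gpos_height, add_assoc, add_assoc, ← add_assoc (2 * chunks G N),
    heard_eq (sent_labelX hG huv) (by omega)]
  rfl

/-! ### Verification and verdict. -/

theorem check_iff {a t : ℕ} {v : V}
    (ht : beg G N a + (2 * chunks G N + 2 * height G N + 3) ≤ t) :
    (gpos G N v).Check (bheard G N ω t v) (beg G N a) ↔ Check G N ω a v := by
  have hs : start G N ≤ t + 1 := by unfold beg at ht; omega
  unfold Pos.Check Check
  rw [gpos_cross hG, gpos_kids, gpos_lead, ownLabel_eq hG (by omega)]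
  simp only [Finset.mem_map, forall_exists_index, and_imp, forall_apply_eq_imp_iff₂]
  refine and_congr ?_ ?_
  · refine forall₂_congr fun u hu => ?_
    change (Pos.nbrLabel _ _ _ (N.ident u)) = _ ↔ _
    rw [nbrLabel_eq hG (mem_cross.1 hu).1.symm ht]
  · refine imp_congr_right fun _ => forall₂_congr fun c hc => ?_
    change (Pos.Escapes _ _ (N.ident c) → Pos.nbrLabel _ _ _ (N.ident c) = _) ↔ _
    rw [nbrLabel_eq hG (mem_kids_adj hG hc) ht, escapes_iff_exists hG hc hs]
    rfl

omit [Nontrivial V] in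
theorem forall_descs (P : V → Prop) (v : V) : (∀ x ∈ descs G N v, P x) ↔
    P v ∧ ∀ c ∈ kids G N v, ∀ x ∈ descs G N c, P x := by
  constructor
  · refine fun h => ⟨h v (mem_descs.2 (.refl _ _ _)), fun c hc x hx => h x (mem_descs.2 ?_)⟩
    exact (mem_descs.1 hx).trans ((mem_kids hG).1 hc).isDesc
  · rintro ⟨h1, h2⟩ x hx
    by_cases hxv : x = v
    · rwa [hxv]
    · obtain ⟨c, hc, hxc⟩ := (mem_descs.1 hx).exists_child hxv
      exact h2 c ((mem_kids hG).2 hc) x (mem_descs.2 hxc)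

theorem allOk_iff_of {a t : ℕ} {v : V}
    (ht : beg G N a + (2 * chunks G N + 2 * height G N + 3) ≤ t)
    (h : ∀ c ∈ kids G N v, bheard G N ω t v
      (beg G N a + (2 * chunks G N + 2 * height G N + 3 + (height G N - depth G N c)))
      (N.ident c) .ok = some (open Classical in if ∀ x ∈ descs G N c, Check G N ω a x then 1
        else 0)) :
    (gpos G N v).AllOk (bheard G N ω t v) (beg G N a) ↔ ∀ x ∈ descs G N v, Check G N ω a x := by
  rw [forall_descs hG]
  unfold Pos.AllOk
  rw [check_iff hG ht, gpos_kids]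
  simp only [Finset.mem_map, forall_exists_index, and_imp, forall_apply_eq_imp_iff₂]
  refine and_congr_right fun _ => forall₂_congr fun c hc => ?_
  have h1 := depth_of_mem_kids hG hc
  rw [gpos_chunks, gpos_height, gpos_depth, ← h1,
    show beg G N a + 2 * chunks G N + 2 * height G N + 3 + (height G N - depth G N c) =
      beg G N a + (2 * chunks G N + 2 * height G N + 3 + (height G N - depth G N c)) by ring]
  change bheard _ _ _ _ _ _ (N.ident c) _ = _ ↔ _
  rw [h c hc]
  split_ifs with h2
  · simpa using h2
  · simpa using h2

theorem sent_ok {a : ℕ} {u v : V} (huv : u ∈ kids G N v) :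
    bsent G N ω (beg G N a + (2 * chunks G N + 2 * height G N + 3 + (height G N - depth G N u)))
      u v .ok = some (open Classical in if ∀ x ∈ descs G N u, Check G N ω a x then 1 else 0) := by
  classical
  induction hn : height G N - depth G N u using Nat.strong_induction_on generalizing u v with
  | _ n ih =>
    have hadj := mem_kids_adj hG huv
    have hp := gpos_beg (G := G) (N := N) (a := a)
      (o := 2 * chunks G N + 2 * height G N + 3 + n) (by unfold period; omega) u
    rw [sent_late hG _ hadj (by simp)]
    simp only [Pos.send, hp.2.1, hp.2.2, gpos_chunks, gpos_height, gpos_depth, hn,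
      eq_par_iff hG]
    rw [if_pos ⟨hp.1, huv, trivial⟩]
    congr 1
    refine if_congr (allOk_iff_of hG (by omega) fun c hc => ?_) rfl rfl
    have h1 := depth_of_mem_kids hG hc
    have h2 := depth_le_height (N := N) hG c
    refine (heard_eq (ih (height G N - depth G N c) (by omega) hc rfl) (by omega)).trans ?_
    congr

theorem allOk_iff {a t : ℕ} {v : V}
    (ht : beg G N a + (2 * chunks G N + 3 * height G N + 4) ≤ t) :
    (gpos G N v).AllOk (bheard G N ω t v) (beg G N a) ↔ ∀ x ∈ descs G N v, Check G N ω a x :=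
  allOk_iff_of hG (by omega) fun _ hc => heard_eq (sent_ok hG hc) (by omega)

theorem verdict_iff_of {a t : ℕ} {v : V}
    (ht : beg G N a + (2 * chunks G N + 3 * height G N + 4) ≤ t)
    (h : v ≠ N.leader → bheard G N ω t v
      (beg G N a + (2 * chunks G N + 3 * height G N + 4 + depth G N (par G N v)))
      (N.ident (par G N v)) .verdict = some (open Classical in if ∀ x, Check G N ω a x then 1
        else 0)) :
    (gpos G N v).Verdict (bheard G N ω t v) (beg G N a) ↔ ∀ x, Check G N ω a x := by
  unfold Pos.Verdict
  by_cases hv : v = N.leader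
  · rw [if_pos (by simp [gpos, hv]), allOk_iff hG ht, hv, descs_leader hG]
    simp
  · rw [if_neg (by simp [gpos, hv])]
    have h1 := h hv
    have h2 := depth_par hG hv
    have h3 : (gpos G N v).par = N.ident (par G N v) := by simp [gpos, hv]
    have h4 : beg G N a + 2 * (gpos G N v).chunks + 3 * (gpos G N v).height + 4 +
        ((gpos G N v).depth - 1) =
          beg G N a + (2 * chunks G N + 3 * height G N + 4 + depth G N (par G N v)) := by
      rw [gpos_chunks, gpos_height, gpos_depth, ← h2]
      simp only [Nat.add_sub_cancel]
      ring
    rw [h3, h4, h1]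
    split_ifs with h5
    · simpa using h5
    · simpa using h5

theorem sent_verdict {a : ℕ} {u v : V} (huv : v ∈ kids G N u) :
    bsent G N ω (beg G N a + (2 * chunks G N + 3 * height G N + 4 + depth G N u)) u v .verdict =
      some (open Classical in if ∀ x, Check G N ω a x then 1 else 0) := by
  classical
  induction hn : depth G N u using Nat.strong_induction_on generalizing u v with
  | _ n ih =>
    have hadj := (mem_kids_adj hG huv).symm
    have hd := depth_le_height (N := N) hG u
    have hp := gpos_beg (G := G) (N := N) (a := a)
      (o := 2 * chunks G N + 3 * height G N + 4 + n) (by unfold period; omega) u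
    rw [sent_late hG _ hadj (by simp)]
    simp only [Pos.send, hp.2.1, hp.2.2, gpos_chunks, gpos_height, gpos_depth, hn]
    rw [if_pos ⟨hp.1, mem_gpos_kids.2 huv, trivial⟩]
    congr 1
    refine if_congr (verdict_iff_of hG (by omega) fun h => ?_) rfl rfl
    have h1 := depth_par hG h
    refine (heard_eq (ih (depth G N (par G N u)) (by omega)
      ((mem_kids hG).2 (isParent_par hG h)) rfl) (by omega)).trans ?_
    congr

theorem verdict_iff {a t : ℕ} {v : V}
    (ht : beg G N a + (2 * chunks G N + 4 * height G N + 4) ≤ t) :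
    (gpos G N v).Verdict (bheard G N ω t v) (beg G N a) ↔ ∀ x, Check G N ω a x := by
  refine verdict_iff_of hG (by omega) fun h => heard_eq
    (sent_verdict hG ((mem_kids hG).2 (isParent_par hG h))) ?_
  have h1 := depth_par hG h
  have h2 := depth_le_height (N := N) hG v
  omega

/-! ### Halting after a verified trial. -/

theorem haltBlocks_eq {a : ℕ} (h : ∀ x, Check G N ω a x) (v : V) :
    haltBlocks ((blockProgram.ideal G N ω (beg G N (a + 1))).state v) =
      some ((gpos G N v).blockOutput
        (bheard G N ω (beg G N a + (2 * chunks G N + 4 * height G N + 5)) v) (beg G N a)) := by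
  have hp : beg G N (a + 1) = beg G N a + period G N := by unfold beg; ring
  have h0 : (0 : ℕ) < period G N := by unfold period; omega
  have hs : start G N ≤ beg G N (a + 1) := by unfold beg; omega
  have hs' : start G N < beg G N (a + 1) := by rw [hp]; unfold beg; omega
  have hoff : (gpos G N v).off (beg G N (a + 1)) = 0 :=
    (gpos_beg (G := G) (N := N) (a := a + 1) h0 v).2.1
  -- The messages of the last round are unread. The last verdict leaves no later than offset `2 *
  -- chunks + 4 * height + 3`, so it has been read.
  have ht : beg G N (a + 1) - 1 = beg G N a + (2 * chunks G N + 4 * height G N + 5) := by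
    rw [hp]; unfold period; omega
  unfold haltBlocks
  rw [state_pos_of_le hG hs, Option.bind_some, blockProgram.state_time, blockProgram.state_hist,
    gpos_period, show beg G N (a + 1) - period G N = beg G N a by omega, ht, if_pos]
  exact ⟨hs', hoff, (verdict_iff hG (by omega)).2 h⟩

theorem haltBlocks_isSome_iff (t : ℕ) (v : V) :
    (haltBlocks ((blockProgram.ideal G N ω t).state v)).isSome ↔
      ∃ a, t = beg G N (a + 1) ∧ ∀ x, Check G N ω a x := by
  constructor
  · intro h
    obtain ⟨o, ho⟩ := Option.isSome_iff_exists.1 h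
    unfold haltBlocks at ho
    obtain ⟨p, hp, h1⟩ := Option.bind_eq_some_iff.1 ho
    obtain rfl := eq_of_state_pos hG hp
    split_ifs at h1 with h2
    rw [gpos_start, blockProgram.state_time] at h2
    obtain ⟨h2, h3, h4⟩ := h2
    obtain ⟨a, o', ho', rfl⟩ := exists_beg h2.le
    rw [(gpos_beg (G := G) (N := N) ho' v).2.1] at h3
    subst h3
    -- At the beginning of trial 0 there is no earlier trial to judge; the strict inequality in the
    -- halting rule excludes it.
    cases a with
    | zero => unfold beg at h2; omega
    | succ a =>
      refine ⟨a, rfl, ?_⟩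
      have hpe : beg G N (a + 1) + 0 = beg G N a + period G N := by unfold beg; ring
      rw [blockProgram.state_hist, gpos_period, hpe, Nat.add_sub_cancel] at h4
      exact (verdict_iff hG (by unfold period; omega)).1 h4
  · rintro ⟨a, rfl, h⟩
    rw [haltBlocks_eq hG h]
    rfl

end BFS

/-! ### Correctness of the labels -/

theorem exists_adj_avoids {V : Type*} {G : SimpleGraph V} {u v : V} (h : G.Reachable u v)
    (huv : u ≠ v) : ∃ n, G.Adj n v ∧ Avoids G v u n := by
  obtain ⟨p⟩ := h
  induction p with
  | nil => exact absurd rfl huv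
  | @cons a b c hab p ih =>
    by_cases hb : b = c
    · subst hb
      exact ⟨a, hab, .refl⟩
    · obtain ⟨n, h1, h2⟩ := ih hb
      exact ⟨n, h1, Relation.ReflTransGen.head ⟨hab, huv, hb⟩ h2⟩

namespace BFS

set_option linter.unusedSectionVars false

local notation "bheard" => Program.heard blockProgram

variable {V : Type*} [Fintype V] [DecidableEq V] (G : SimpleGraph V) [DecidableRel G.Adj]
  (N : Network V) (ω : Coins V)

/-- The subtrees of `S`, a set of children of `v`, are joined to no other vertex than `v`. -/
def Closed (v : V) (S : Finset V) : Prop :=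
  S ⊆ kids G N v ∧
    ∀ c ∈ S, ∀ x ∈ descs G N c, ∀ u ∈ cross G N x, ∃ d ∈ S, u ∈ descs G N d

/-- In attempt `a`, the random bits of a set of children cancel only if they have to. -/
def Good (a : ℕ) : Prop := ∀ v S, ZeroSum G N ω a v S → Closed G N v S

open Classical in
/-- The label of the edge from `v` to `u`. -/
noncomputable def edgeLab (a : ℕ) (v u : V) : ℕ :=
  if u ∈ kids G N v then lab G N ω a u else lab G N ω a v

variable {G N ω}

variable (hG : G.Connected)
include hG

/-- An edge with both ends in the union is counted from each end, and the two contributions cancel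
in characteristic two; only the boundary remains. -/
theorem sum_flow {v : V} {S : Finset V} (hS : S ⊆ kids G N v) (a i l : ℕ) :
    ∑ c ∈ S, flow G N ω a i l c =
      ∑ x ∈ S.biUnion (descs G N), ∑ u ∈ cross G N x \ S.biUnion (descs G N),
        (coinBit G N ω a i l x u + coinBit G N ω a i l u x) := by
  set U := S.biUnion (descs G N)
  have h1 : ∑ c ∈ S, flow G N ω a i l c = ∑ x ∈ U, ∑ u ∈ cross G N x,
      (coinBit G N ω a i l x u + coinBit G N ω a i l u x) := by
    rw [Finset.sum_biUnion]
    · rfl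
    · intro b hb c hc hbc
      rw [Function.onFun, Finset.disjoint_left]
      intro x hxb hxc
      exact hbc (child_eq_of_isDesc (isTree hG) ((mem_kids hG).1 (hS hb))
        ((mem_kids hG).1 (hS hc)) (mem_descs.1 hxb) (mem_descs.1 hxc))
  have h2 : ∑ x ∈ U, ∑ u ∈ cross G N x ∩ U,
      (coinBit G N ω a i l x u + coinBit G N ω a i l u x) = 0 := by
    simp only [Finset.sum_add_distrib]
    rw [Finset.sum_comm' (t' := U) (s' := fun u => cross G N u ∩ U), CharTwo.add_self_eq_zero]
    intro x y
    rw [Finset.mem_inter, Finset.mem_inter, mem_cross_comm]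
    tauto
  rw [h1, ← sub_zero (∑ x ∈ U, _), ← h2, ← Finset.sum_sub_distrib]
  refine Finset.sum_congr rfl fun x _ => ?_
  rw [← Finset.sum_inter_add_sum_sdiff (cross G N x) U, add_sub_cancel_left]

/-- Without boundary edges the sum is empty. This holds for all coins and makes the error one-sided.
-/
theorem Closed.zeroSum {a : ℕ} {v : V} {S : Finset V} (h : Closed G N v S) :
    ZeroSum G N ω a v S := by
  refine ⟨h.1, fun i _ l _ => ?_⟩
  rw [sum_flow hG h.1]
  refine Finset.sum_eq_zero fun x hx => ?_
  obtain ⟨c, hc, hxc⟩ := Finset.mem_biUnion.1 hx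
  rw [Finset.sdiff_eq_empty_iff_subset.2, Finset.sum_empty]
  intro u hu
  exact Finset.mem_biUnion.2 (h.2 c hc x hxc u hu)

open Classical in
-- A non-tree edge from such a subtree cannot end in `v`, an ancestor. So its other end stays in the
-- component, hence below another child of `v` in that component.
theorem closed_component {v c : V} (hc : c ∈ kids G N v)
    (h : ∀ u, Avoids G v c u → IsDesc (tree G N) N.leader u v) :
    Closed G N v ((kids G N v).filter fun d => Avoids G v c d) := by
  refine ⟨Finset.filter_subset _ _, fun d hd x hx u hu => ?_⟩
  obtain ⟨hd, hcd⟩ := Finset.mem_filter.1 hd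
  have hd := (mem_kids hG).1 hd
  have hx := mem_descs.1 hx
  obtain ⟨hxu, ht⟩ := mem_cross.1 hu
  have hxv : x ≠ v := by
    rintro rfl; exact hd.not_isDesc hx
  have huv : u ≠ v := by
    rintro rfl
    exact not_isDesc_of_cross hG hxu ht (hx.trans hd.isDesc)
  have hcu : Avoids G v c u := (hcd.trans (avoids_of_isDesc_child (tree_le hG) hd
    (.refl _ _ _) hx)).trans (.single ⟨hxu, hxv, huv⟩)
  obtain ⟨e, he, hue⟩ := (h u hcu).exists_child huv
  refine ⟨e, Finset.mem_filter.2 ⟨(mem_kids hG).2 he, hcu.trans ?_⟩, mem_descs.2 hue⟩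
  exact avoids_of_isDesc_child (tree_le hG) he hue (.refl _ _ _)

/-- If `b` and `c` are separated in `G - v`, the component of `b` must leave the subtree of `v`:
otherwise its children of `v` form a closed, hence zero-sum, set that contains `b` but not `c`. The
same holds for `c`, yet all non-descendants of `v` are joined in `G - v`. -/
theorem Link.avoids {a : ℕ} {v b c : V} (hb : b ∈ kids G N v) (hc : c ∈ kids G N v)
    (h : Link G N ω a v b c) : Avoids G v b c := by
  classical
  by_contra hbc
  have key : ∀ b' c', b' ∈ kids G N v → c' ∈ kids G N v → Link G N ω a v b' c' →
      ¬ Avoids G v b' c' → ∃ u, Avoids G v b' u ∧ ¬ IsDesc (tree G N) N.leader u v := by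
    intro b' c' hb' hc' hl hn
    by_contra! hcon
    have h1 := (hl _ ((closed_component hG hb' hcon).zeroSum hG)).1
      (Finset.mem_filter.2 ⟨hb', .refl⟩)
    exact hn (Finset.mem_filter.1 h1).2
  obtain ⟨u, h1, h2⟩ := key b c hb hc h hbc
  obtain ⟨w, h3, h4⟩ := key c b hc hb (fun S hS => (h S hS).symm) fun k => hbc k.symm
  exact hbc ((h1.trans (avoids_of_not_isDesc (isTree hG) (tree_le hG) h2 h4)).trans h3.symm)

theorem UpLink.exists_avoids {a : ℕ} {v c : V} (hc : c ∈ kids G N v)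
    (h : UpLink G N ω a v c) : ∃ u, Avoids G v c u ∧ ¬ IsDesc (tree G N) N.leader u v := by
  classical
  by_contra! hcon
  exact h _ ((closed_component hG hc hcon).zeroSum hG) (Finset.mem_filter.2 ⟨hc, .refl⟩)

/-- A label is inherited from the parent edge along an `UpLink` or named after a linked sibling, and
both steps stay in the block, for all coins. At the leader no child is `UpLink`, so the placeholder
0 is never inherited. -/
theorem exists_lab_eq_pre {a : ℕ} {v : V} (hv : v ≠ N.leader) :
    ∃ (w : V) (hw : w ≠ N.leader), lab G N ω a v = pre G N w ∧
      SameBlock G (edgeOf (adj_par hG hv)) (edgeOf (adj_par hG hw)) := by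
  classical
  induction hn : depth G N v generalizing v with
  | zero => exact absurd ((depth_eq_zero hG).1 hn) hv
  | succ n ih =>
    have hk : v ∈ kids G N (par G N v) := (mem_kids hG).2 (isParent_par hG hv)
    rw [lab_eq hG hv]
    split_ifs with hup
    · obtain ⟨u, h1, h2⟩ := hup.exists_avoids hG hk
      have hp : par G N v ≠ N.leader := by
        intro hp
        exact h2 (hp ▸ isDesc_root (isTree hG) u)
      have hd := depth_par hG hv
      obtain ⟨w, hw, h3, h4⟩ := ih hp (by omega)
      refine ⟨w, hw, h3, .trans ?_ h4⟩
      rw [← edgeOf_comm (adj_par hG hv), ← edgeOf_comm (adj_par hG hp), sameBlock_iff_avoids]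
      exact h1.trans (avoids_of_not_isDesc (isTree hG) (tree_le hG) h2
        (isParent_par hG hp).not_isDesc)
    · obtain ⟨c, ⟨hc, hl⟩, h1⟩ := Nat.sInf_mem (s := pre G N '' {c | c ∈ kids G N (par G N v) ∧
        Link G N ω a (par G N v) v c}) ⟨_, v, ⟨hk, fun _ _ => Iff.rfl⟩, rfl⟩
      obtain ⟨hcl, hcp⟩ := (isParent_iff hG).1 ((mem_kids hG).1 hc)
      refine ⟨c, hcl, h1.symm, ?_⟩
      have h2 := adj_par hG hcl
      rw [hcp] at h2
      rw [show edgeOf (adj_par hG hcl) = edgeOf h2 from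
        Subtype.ext (by simp only [edgeOf, hcp]), ← edgeOf_comm (adj_par hG hv),
        sameBlock_iff_avoids]
      exact hl.avoids hG hk hc

theorem exists_edgeLab_eq_pre {a : ℕ} {v u : V} (h : G.Adj v u) :
    ∃ (w : V) (hw : w ≠ N.leader), edgeLab G N ω a v u = pre G N w ∧
      SameBlock G (edgeOf h) (edgeOf (adj_par hG hw)) := by
  classical
  by_cases ht : (tree G N).Adj v u
  · have key : ∀ x y (k : G.Adj x y), x ∈ kids G N y → ∃ (w : V) (hw : w ≠ N.leader),
        lab G N ω a x = pre G N w ∧ SameBlock G (edgeOf k) (edgeOf (adj_par hG hw)) := by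
      intro x y k hx
      obtain ⟨hxl, rfl⟩ := (isParent_iff hG).1 ((mem_kids hG).1 hx)
      rw [← edgeOf_comm k]
      exact exists_lab_eq_pre hG hxl
    unfold edgeLab
    split_ifs with hu
    · rw [← edgeOf_comm h]
      exact key u v h.symm hu
    · refine key v u h ((mem_kids hG).2 ?_)
      exact (isParent_or_of_adj (isTree hG) ht).resolve_right fun k => hu ((mem_kids hG).2 k)
  · have hv : v ≠ N.leader := by
      rintro rfl
      exact not_isDesc_of_cross hG h.symm (fun k => ht k.symm) (isDesc_root (isTree hG) u)
    have hu : u ∉ kids G N v := fun k => ht ((mem_kids hG).1 k).1.symm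
    rw [edgeLab, if_neg hu]
    obtain ⟨w, hw, h1, h2⟩ := exists_lab_eq_pre (ω := ω) (a := a) hG hv
    refine ⟨w, hw, h1, .trans ?_ h2⟩
    rw [← edgeOf_comm (adj_par hG hv)]
    exact ((isPreorderedSpanningTree hG).eqvGen_sim0_iff _ _).1
      ((isPreorderedSpanningTree hG).eqvGen_of_leaves h ht (.refl _ _ _)
        (not_isDesc_of_cross hG h.symm fun k => ht k.symm) (isParent_par hG hv))

/-- A label is the preorder number of a vertex whose parent edge lies in the block, so it determines
the block. This holds without verification. -/
theorem sameBlock_of_edgeLab_eq {a : ℕ} {u v x y : V} (h : G.Adj u v) (k : G.Adj x y)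
    (he : edgeLab G N ω a u v = edgeLab G N ω a x y) : SameBlock G (edgeOf h) (edgeOf k) := by
  obtain ⟨w, hw, h1, h2⟩ := exists_edgeLab_eq_pre (ω := ω) (N := N) (a := a) hG h
  obtain ⟨z, hz, h3, h4⟩ := exists_edgeLab_eq_pre (ω := ω) (N := N) (a := a) hG k
  obtain rfl := pre_injective hG (h1.symm.trans (he.trans h3))
  exact h2.trans h4.symm

/-! ### Verified labels are constant on blocks. -/

section Check

variable {a : ℕ} (hc : ∀ x, Check G N ω a x)
include hc

theorem edgeLab_comm {u v : V} (h : G.Adj u v) :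
    edgeLab G N ω a u v = edgeLab G N ω a v u := by
  unfold edgeLab
  split_ifs with h1 h2 h2
  · exact absurd ((mem_kids hG).1 h2).isDesc ((mem_kids hG).1 h1).not_isDesc
  · rfl
  · rfl
  · refine (hc v).1 u (mem_cross.2 ⟨h.symm, fun k => ?_⟩)
    rcases isParent_or_of_adj (isTree hG) k with k | k
    · exact h1 ((mem_kids hG).2 k)
    · exact h2 ((mem_kids hG).2 k)

/-- The verification says that equality of labels contains the generating relation, so it contains
the block relation by `sameBlock_le_iff`. -/
theorem edgeLab_eq_of_sameBlock {u v x y : V} (h : G.Adj u v) (k : G.Adj x y)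
    (hb : SameBlock G (edgeOf h) (edgeOf k)) : edgeLab G N ω a u v = edgeLab G N ω a x y := by
  -- The maximum makes the label symmetric on all pairs; on edges both values agree by
  -- `edgeLab_comm`.
  let L : Sym2 V → ℕ := Sym2.lift ⟨fun u v => max (edgeLab G N ω a u v) (edgeLab G N ω a v u),
    fun _ _ => max_comm _ _⟩
  have hL : ∀ {u v : V} (h : G.Adj u v), L (edgeOf h) = edgeLab G N ω a u v := by
    intro u v h
    change max _ _ = _
    rw [edgeLab_comm hG hc h, max_self]
  have key := (isPreorderedSpanningTree (N := N) hG).sameBlock_le_iff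
    (R := fun e f => L e = L f) ⟨fun _ => rfl, Eq.symm, Eq.trans⟩
  rw [← hL h, ← hL k]
  refine key.2 ?_ _ _ hb
  intro u v w h k hs
  rw [sim0_edgeOf_iff] at hs
  obtain ⟨hp, hs⟩ := hs
  have hv : v ≠ N.leader := by
    rintro rfl; exact not_isParent_root hp
  change L (edgeOf h) = L (edgeOf k)
  rw [hL h, hL k, edgeLab_comm hG hc h, edgeLab, edgeLab,
    if_neg fun k => hp.not_isDesc ((mem_kids hG).1 k).isDesc]
  split_ifs with hu
  · rcases hs with ⟨ht, -⟩ | ⟨hu', hlh⟩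
    · exact absurd ((mem_kids hG).1 hu).1.symm ht
    · exact (hc v).2 hv u hu ((isPreorderedSpanningTree hG).low_high_iff.1 hlh)
  · rfl

end Check

/-! ### Good coins pass the verification. -/

section Good

variable {a : ℕ} (hg : Good G N ω a)
include hg

/-- The edge `xu` keeps `c` out of every closed set of children of `v`, hence out of every zero-sum
set when the coins are good. So `c` is `UpLink`. -/
theorem lab_eq_par {c v : V} (hcv : c ∈ kids G N v) {x u : V} (hx : x ∈ descs G N c)
    (hu : u ∈ cross G N x) (huv : ¬ IsDesc (tree G N) N.leader u v) :
    lab G N ω a c = lab G N ω a v := by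
  classical
  obtain ⟨h1, rfl⟩ := (isParent_iff hG).1 ((mem_kids hG).1 hcv)
  rw [lab_eq hG h1, if_pos]
  intro S hS hcS
  obtain ⟨hk, h2⟩ := hg _ S hS
  obtain ⟨d, hd, hud⟩ := h2 c hcS x hx u hu
  exact huv ((mem_descs.1 hud).trans ((mem_kids hG).1 (hk hd)).isDesc)

theorem lab_eq_of_isDesc {x y z : V} (hy : y ∈ cross G N x)
    (hxz : IsDesc (tree G N) N.leader x z) (hyz : ¬ IsDesc (tree G N) N.leader y z) :
    lab G N ω a x = lab G N ω a z := by
  induction hxz with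
  | refl => rfl
  | @tail b c hb hbc ih =>
    rw [ih fun k => hyz (k.trans hbc.isDesc)]
    exact lab_eq_par hG hg ((mem_kids hG).2 hbc) (mem_descs.2 hb) hy hyz

omit hg in
theorem lab_eq_of_link {v b c : V} (hb : b ∈ kids G N v) (hc : c ∈ kids G N v)
    (h : Link G N ω a v b c) : lab G N ω a b = lab G N ω a c := by
  classical
  obtain ⟨h1, rfl⟩ := (isParent_iff hG).1 ((mem_kids hG).1 hb)
  obtain ⟨h2, h3⟩ := (isParent_iff hG).1 ((mem_kids hG).1 hc)
  rw [lab_eq hG h1, lab_eq hG h2, h3]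
  refine if_congr (forall₂_congr fun S hS => not_congr (h S hS)) rfl ?_
  congr 2
  ext d
  refine and_congr_right fun _ => forall₂_congr fun S hS => ?_
  rw [h S hS]

/-- For a non-tree edge `xu`, let `z` and `y` be the children of the lowest common ancestor above
`x` and `u`. Labels do not change on the climb to `z` and to `y`, and a closed set contains both or
neither because of `xu`. The condition on escaping children is `lab_eq_par`. -/
theorem Good.check (x : V) : Check G N ω a x := by
  constructor
  · intro u hu
    have hux := mem_cross_comm.1 hu
    obtain ⟨ha, ht⟩ := mem_cross.1 hu
    have hxu := not_isDesc_of_cross hG ha ht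
    have hux' := not_isDesc_of_cross hG ha.symm fun k => ht k.symm
    obtain ⟨z, p, h1, h2, h3, h4⟩ := exists_split (isTree hG) hux'
    have hup : u ≠ p := by
      rintro rfl; exact hxu (h1.trans h2.isDesc)
    obtain ⟨y, h5, h6⟩ := h4.exists_child hup
    have h7 : ¬ IsDesc (tree G N) N.leader x y := fun k =>
      h3 (child_eq_of_isDesc (isTree hG) h2 h5 h1 k ▸ h6)
    rw [lab_eq_of_isDesc hG hg hu h1 h3, lab_eq_of_isDesc hG hg hux h6 h7]
    refine lab_eq_of_link hG ((mem_kids hG).2 h5) ((mem_kids hG).2 h2) fun S hS => ?_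
    obtain ⟨hk, h8⟩ := hg _ S hS
    constructor
    · intro hy
      obtain ⟨d, hd, h9⟩ := h8 y hy u (mem_descs.2 h6) x hux
      rwa [child_eq_of_isDesc (isTree hG) h2 ((mem_kids hG).1 (hk hd)) h1 (mem_descs.1 h9)]
    · intro hz
      obtain ⟨d, hd, h9⟩ := h8 z hz x (mem_descs.2 h1) u hu
      rwa [child_eq_of_isDesc (isTree hG) h5 ((mem_kids hG).1 (hk hd)) h6 (mem_descs.1 h9)]
  · rintro - c hc ⟨y, hy, hyx⟩
    have hcx := (mem_kids hG).1 hc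
    rcases hy with hy | ⟨d, hd, hdy, ht⟩
    · exact absurd (hy.trans hcx.isDesc) hyx
    · exact lab_eq_par hG hg hc (mem_descs.2 hd) (mem_cross.2 ⟨hdy, ht⟩) hyx

end Good

/-! ### Correctness of the local results. -/

theorem edgeLabel_eq [Nontrivial V] {a : ℕ} {v u : V} (h : G.Adj v u) {t : ℕ}
    (ht : beg G N a + (2 * chunks G N + 2 * height G N + 3) ≤ t) :
    (gpos G N v).edgeLabel (bheard G N ω t v) (beg G N a) (N.ident u) =
      edgeLab G N ω a v u := by
  unfold Pos.edgeLabel edgeLab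
  rw [nbrLabel_eq hG h.symm ht, ownLabel_eq hG (by omega)]
  exact if_congr mem_gpos_kids rfl rfl

theorem correctBlockOutput_of_check [Nontrivial V] {a t : ℕ} (hc : ∀ x, Check G N ω a x)
    (ht : beg G N a + (2 * chunks G N + 2 * height G N + 3) ≤ t) :
    CorrectBlockOutput G N fun v => (gpos G N v).blockOutput (bheard G N ω t v) (beg G N a) := by
  have key : ∀ {u v x y : V} (h : G.Adj u v) (k : G.Adj x y),
      (gpos G N u).edgeLabel (bheard G N ω t u) (beg G N a) (N.ident v) =
        (gpos G N x).edgeLabel (bheard G N ω t x) (beg G N a) (N.ident y) ↔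
      SameBlock G (edgeOf h) (edgeOf k) := by
    intro u v x y h k
    rw [edgeLabel_eq hG h ht, edgeLabel_eq hG k ht]
    exact ⟨sameBlock_of_edgeLab_eq hG h k, edgeLab_eq_of_sameBlock hG hc h k⟩
  refine ⟨fun v => ?_, fun u v x y h k => key h k⟩
  rw [isCutVertex_iff]
  change decide _ = true ↔ _
  rw [decide_eq_true_iff]
  change (∃ i ∈ (G.neighborFinset v).map N.ident, ∃ j ∈ (G.neighborFinset v).map N.ident, _) ↔ _
  have key' : ∀ {u w : V} (h : G.Adj v u) (k : G.Adj v w),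
      (gpos G N v).edgeLabel (bheard G N ω t v) (beg G N a) (N.ident u) =
        (gpos G N v).edgeLabel (bheard G N ω t v) (beg G N a) (N.ident w) ↔ Avoids G v u w := by
    intro u w h k
    rw [key h k, ← edgeOf_comm h, sameBlock_iff_avoids]
  constructor
  · rintro ⟨_, hi, _, hj, hne⟩
    obtain ⟨u, hu, rfl⟩ := Finset.mem_map.1 hi
    obtain ⟨w, hw, rfl⟩ := Finset.mem_map.1 hj
    rw [SimpleGraph.mem_neighborFinset] at hu hw
    exact ⟨u, w, hu.ne', hw.ne', fun k => hne ((key' hu hw).2 k)⟩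
  · rintro ⟨u, w, hu, hw, huw⟩
    -- Separated vertices are replaced by neighbours of `v` in the same components of `G - v`, where
    -- the labels can be compared.
    obtain ⟨m, hm, h1⟩ := exists_adj_avoids (hG.preconnected u v) hu
    obtain ⟨n, hn, h2⟩ := exists_adj_avoids (hG.preconnected w v) hw
    refine ⟨_, Finset.mem_map_of_mem _ ((G.mem_neighborFinset v m).2 hm.symm), _,
      Finset.mem_map_of_mem _ ((G.mem_neighborFinset v n).2 hn.symm), fun k => huw ?_⟩
    exact (h1.trans ((key' hm.symm hn.symm).1 k)).trans h2.symm

theorem correctBlockOutput [Nontrivial V] {t : ℕ} {out : V → BlockOutput}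
    (h : (blockProgram.alg haltBlocks).HaltsWith G N ω t out) : CorrectBlockOutput G N out := by
  obtain ⟨T, -, ⟨a, rfl, hc⟩, hout⟩ := blockProgram.exists_of_haltsWith G N ω haltBlocks
    (haltBlocks_isSome_iff hG) h
  convert correctBlockOutput_of_check (ω := ω) hG hc
    (t := beg G N a + (2 * chunks G N + 4 * height G N + 5)) (by omega) using 1
  funext v
  have := hout v
  rw [haltBlocks_eq hG hc] at this
  exact (Option.some.inj this).symm

end BFS

/-! ### Sums of independent random bits -/

section Parity

variable {ι : Type*}

/-- The distribution of independent fair coins. -/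
noncomputable abbrev fairCoins (ι : Type*) : Measure (ι → Bool) :=
  Measure.infinitePi fun _ => (PMF.uniformOfFintype Bool).toMeasure

theorem map_not_uniform :
    (PMF.uniformOfFintype Bool).toMeasure.map not = (PMF.uniformOfFintype Bool).toMeasure := by
  rw [PMF.toMeasure_map _ _ .of_discrete]
  congr 1
  ext b
  rw [PMF.map_apply, tsum_fintype]
  cases b <;> simp

open Classical in
/-- Turning over one coin. -/
noncomputable def flipCoin (i : ι) (ω : ι → Bool) : ι → Bool :=
  fun j => (if j = i then not else id) (ω j)

theorem measurable_flip (i : ι) : Measurable (flipCoin i) :=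
  measurable_pi_lambda _ fun j => Measurable.of_discrete.comp (measurable_pi_apply j)

theorem measurePreserving_flip (i : ι) : MeasurePreserving (flipCoin i) (fairCoins ι) (fairCoins ι) := by
  classical
  refine ⟨measurable_flip i, ?_⟩
  have := Measure.infinitePi_map_pi (fun _ : ι => (PMF.uniformOfFintype Bool).toMeasure)
    (f := fun j => if j = i then not else id) fun _ => .of_discrete
  unfold flipCoin
  convert this using 2
  funext j
  by_cases hj : j = i
  · simp only [hj, if_true]; exact map_not_uniform.symm
  · simp only [hj, if_false]; exact Measure.map_id.symm

theorem sum_flip {s : Finset ι} {i : ι} (hi : i ∈ s) (ω : ι → Bool) :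
    ∑ j ∈ s, bitVal (flipCoin i ω j) = ∑ j ∈ s, bitVal (ω j) + 1 := by
  classical
  have : ∀ b : Bool, bitVal (!b) = bitVal b + 1 := by decide
  rw [← Finset.add_sum_erase s _ hi, ← Finset.add_sum_erase s _ hi]
  rw [show flipCoin i ω i = !ω i by simp [flipCoin], this, add_right_comm]
  congr 2
  refine Finset.sum_congr rfl fun j hj => ?_
  simp [flipCoin, Finset.ne_of_mem_erase hj]

theorem sum_flip_of_notMem {s : Finset ι} {i : ι} (hi : i ∉ s) (ω : ι → Bool) :
    ∑ j ∈ s, bitVal (flipCoin i ω j) = ∑ j ∈ s, bitVal (ω j) := by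
  refine Finset.sum_congr rfl fun j hj => ?_
  have : j ≠ i := fun k => hi (k ▸ hj)
  simp [flipCoin, this]

theorem measurableSet_sum_eq (s : Finset ι) (x : ZMod 2) :
    MeasurableSet {ω : ι → Bool | ∑ j ∈ s, bitVal (ω j) = x} := by
  have : MeasurableAdd₂ (ZMod 2) := ⟨.of_discrete⟩
  have h : Measurable fun ω : ι → Bool => ∑ j ∈ s, bitVal (ω j) :=
    Finset.measurable_sum _ fun j _ =>
      (Measurable.of_discrete (f := bitVal)).comp (measurable_pi_apply j)
  exact h (measurableSet_singleton x)

/-- Sums over disjoint nonempty sets of fair coins are independent and uniform. -/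
theorem measure_sums_eq_zero_le {κ : Type*} (J : Finset κ) {s : κ → Finset ι}
    (hne : ∀ j ∈ J, (s j).Nonempty)
    (hd : ∀ j ∈ J, ∀ k ∈ J, ∀ i, i ∈ s j → i ∈ s k → j = k) :
    fairCoins ι {ω | ∀ j ∈ J, ∑ i ∈ s j, bitVal (ω i) = 0} ≤ 2⁻¹ ^ J.card := by
  classical
  induction J using Finset.induction_on with
  | empty => simp
  | @insert k J hk ih =>
    have ih := ih (fun j hj => hne j (Finset.mem_insert_of_mem hj)) fun j hj k hk =>
      hd j (Finset.mem_insert_of_mem hj) k (Finset.mem_insert_of_mem hk)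
    obtain ⟨i, hi⟩ := hne k (Finset.mem_insert_self k J)
    set B := {ω : ι → Bool | ∀ j ∈ J, ∑ i ∈ s j, bitVal (ω i) = 0} with hB
    set Z := {ω : ι → Bool | ∑ i ∈ s k, bitVal (ω i) = 0} with hZ
    have hZm : MeasurableSet Z := measurableSet_sum_eq _ _
    have hBm : MeasurableSet B := by
      have : B = ⋂ j ∈ J, {ω : ι → Bool | ∑ i ∈ s j, bitVal (ω i) = 0} := by
        ext ω; simp [hB]
      rw [this]
      exact Finset.measurableSet_biInter J fun j _ => measurableSet_sum_eq _ _
    have hset : {ω : ι → Bool | ∀ j ∈ insert k J, ∑ i ∈ s j, bitVal (ω i) = 0} = B ∩ Z := by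
      ext ω
      simp [hB, hZ, and_comm]
    -- Turning over a coin that occurs only in the new sum changes that sum and no other. So the new
    -- condition holds on exactly half of `B`.
    have hpre : flipCoin i ⁻¹' (B ∩ Z) = B ∩ Zᶜ := by
      ext ω
      have h1 : ∀ j ∈ J, ∑ x ∈ s j, bitVal (flipCoin i ω x) = ∑ x ∈ s j, bitVal (ω x) :=
        fun j hj => sum_flip_of_notMem (fun k' => hk ((hd k (Finset.mem_insert_self k J) j
          (Finset.mem_insert_of_mem hj) i hi k') ▸ hj)) ω
      have h2 : ∀ x : ZMod 2, x + 1 = 0 ↔ ¬ x = 0 := by decide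
      simp only [hB, hZ, Set.mem_preimage, Set.mem_inter_iff, Set.mem_ofPred_eq, Set.mem_compl_iff,
        sum_flip hi, h2]
      exact and_congr_left fun _ => forall₂_congr fun j hj => by rw [h1 j hj]
    have h1 : fairCoins ι (B ∩ Zᶜ) = fairCoins ι (B ∩ Z) := by
      rw [← hpre]
      exact (measurePreserving_flip i).measure_preimage (hBm.inter hZm).nullMeasurableSet
    have h2 : fairCoins ι (B ∩ Z) + fairCoins ι (B ∩ Zᶜ) = fairCoins ι B := by
      rw [← Set.sdiff_eq]
      exact measure_inter_add_sdiff B hZm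
    rw [hset, Finset.card_insert_of_notMem hk, pow_succ]
    rw [h1, ← two_mul] at h2
    calc fairCoins ι (B ∩ Z) = (2 * fairCoins ι (B ∩ Z)) * 2⁻¹ := by
          rw [mul_comm 2, mul_assoc, ENNReal.mul_inv_cancel two_ne_zero ENNReal.ofNat_ne_top,
            mul_one]
      _ ≤ _ := by rw [h2]; gcongr

end Parity

/-- The expected cost of repeated attempts that fail with probability at most one half. -/
theorem lintegral_attempts_le {Ω : Type*} [MeasurableSpace Ω] {μ : Measure Ω}
    [IsProbabilityMeasure μ] {Q : ℕ → Ω → Prop}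
    (hQ : ∀ A, μ {ω | ∀ a < A, ¬ Q a ω} ≤ 2⁻¹ ^ A) {F : Ω → ℝ≥0∞} {s p : ℝ≥0∞} (hp : p ≠ 0)
    (hF : ∀ ω a, Q a ω → (∀ b < a, ¬ Q b ω) → F ω ≤ s + (a + 1) * p) :
    ∫⁻ ω, F ω ∂μ ≤ s + 2 * p := by
  classical
  -- The failure events need not be measurable; measurable hulls have the same measure.
  set E : ℕ → Set Ω := fun A => toMeasurable μ {ω | ∀ a < A, ¬ Q a ω}
  have hE : ∀ A ω, (∀ a < A, ¬ Q a ω) → ω ∈ E A := fun A ω h => subset_toMeasurable _ _ h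
  have hm : ∀ A, MeasurableSet (E A) := fun A => measurableSet_toMeasurable _ _
  have h1 : ∀ ω, F ω ≤ s + ∑' A, (E A).indicator (fun _ => p) ω := by
    intro ω
    by_cases hex : ∃ a, Q a ω
    · have hmin : ∀ b < Nat.find hex, ¬ Q b ω := fun b => Nat.find_min hex
      refine (hF ω _ (Nat.find_spec hex) hmin).trans (add_le_add_right ?_ s)
      refine le_trans ?_ (ENNReal.sum_le_tsum (Finset.range (Nat.find hex + 1)))
      rw [Finset.sum_congr rfl fun A hA => Set.indicator_of_mem (hE A ω fun a ha => hmin a (by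
        have := Finset.mem_range.1 hA; omega)) _]
      simp
    -- If no trial ever succeeds, every summand equals `p ≠ 0` and the bound is infinite.
    · push Not at hex
      have : ∀ A, (E A).indicator (fun _ => p) ω = p := fun A =>
        Set.indicator_of_mem (hE A ω fun a _ => hex a) _
      simp only [this, ENNReal.tsum_const_eq_top_of_ne_zero hp]
      simp
  calc ∫⁻ ω, F ω ∂μ ≤ ∫⁻ ω, (s + ∑' A, (E A).indicator (fun _ => p) ω) ∂μ := lintegral_mono h1
    _ = s + ∑' A, p * μ (E A) := by
      rw [lintegral_add_left measurable_const, lintegral_const, measure_univ, mul_one,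
        lintegral_tsum fun A => (measurable_const.indicator (hm A)).aemeasurable]
      simp only [lintegral_indicator_const (hm _)]
    _ ≤ s + ∑' A, p * 2⁻¹ ^ A := by
      gcongr with A
      rw [measure_toMeasurable]
      exact hQ A
    _ = s + 2 * p := by
      rw [ENNReal.tsum_mul_left, ENNReal.tsum_geometric_two, mul_comm]

/-! ### The probability that attempts fail -/

namespace BFS

set_option linter.unusedSectionVars false

variable {V : Type*} [Fintype V] [DecidableEq V] (G : SimpleGraph V) [DecidableRel G.Adj]
  (N : Network V) (ω : Coins V)

/-- The neighbours of `x` along non-tree edges that leave a set of subtrees or enter it. -/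
noncomputable def crossing (S : Finset V) (x : V) : Finset V :=
  if x ∈ S.biUnion (descs G N) then cross G N x \ S.biUnion (descs G N)
  else cross G N x ∩ S.biUnion (descs G N)

/-- The coins that are added up for a set of children, for a single random bit. -/
noncomputable def coinSet (S : Finset V) (a i l : ℕ) : Finset (V × ℕ × ℕ) :=
  (Finset.univ.sigma (crossing G N S)).image fun d : Σ _ : V, V =>
    (d.1, beg G N a + i, N.ident d.2 * width V + l)

variable {G N ω}

theorem width_pos : 0 < width V := Nat.succ_pos _

theorem coinSet_index_eq {u u' : V} {l l' : ℕ} (hl : l < width V) (hl' : l' < width V)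
    (h : N.ident u * width V + l = N.ident u' * width V + l') : u = u' ∧ l = l' := by
  have h1 := congrArg (· % width V) h
  have h2 := congrArg (· / width V) h
  simp only [Nat.mul_add_mod_self_right, Nat.mod_eq_of_lt hl, Nat.mod_eq_of_lt hl'] at h1
  rw [h1] at h
  refine ⟨N.ident.injective (Nat.eq_of_mul_eq_mul_right (width_pos (V := V)) ?_), h1⟩
  omega

theorem beg_add_eq {a a' i i' : ℕ} (hi : i < period G N) (hi' : i' < period G N)
    (h : beg G N a + i = beg G N a' + i') : a = a' ∧ i = i' := by
  unfold beg at h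
  have h0 : a * period G N + i = a' * period G N + i' := by omega
  have h1 := congrArg (· % period G N) h0
  simp only [Nat.mul_add_mod_self_right, Nat.mod_eq_of_lt hi, Nat.mod_eq_of_lt hi'] at h1
  rw [h1] at h0
  exact ⟨Nat.eq_of_mul_eq_mul_right (by omega) (by omega : a * period G N = a' * period G N), h1⟩

/-- A coin determines the trial, the message and the bit by division with remainder. The coin sets
of different bits are therefore disjoint, which provides independence within and between trials. -/
theorem eq_of_mem_coinSet {S S' : Finset V} {a a' i i' l l' : ℕ} (hi : i < chunks G N)
    (hi' : i' < chunks G N) (hl : l < width V) (hl' : l' < width V) {x : V × ℕ × ℕ}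
    (h : x ∈ coinSet G N S a i l) (h' : x ∈ coinSet G N S' a' i' l') :
    a = a' ∧ i = i' ∧ l = l' := by
  obtain ⟨d, -, rfl⟩ := Finset.mem_image.1 h
  obtain ⟨d', -, hd⟩ := Finset.mem_image.1 h'
  simp only [Prod.mk.injEq] at hd
  have h1 := beg_add_eq (by unfold period; omega) (by unfold period; omega) hd.2.1.symm
  exact ⟨h1.1, h1.2, (coinSet_index_eq hl hl' hd.2.2.symm).2⟩

theorem sum_coinSet (S : Finset V) {a i l : ℕ} (hl : l < width V) :
    ∑ x ∈ coinSet G N S a i l, bitVal (ω x) =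
      ∑ x, ∑ u ∈ crossing G N S x, coinBit G N ω a i l x u := by
  rw [coinSet, Finset.sum_image, Finset.sum_sigma]
  · rfl
  · rintro ⟨x, u⟩ - ⟨x', u'⟩ - h
    simp only [Prod.mk.injEq] at h
    obtain ⟨rfl, -, h⟩ := h
    obtain ⟨rfl, -⟩ := coinSet_index_eq hl hl h
    rfl

variable (hG : G.Connected)
include hG

/-- Every boundary edge contributes one coin of each end; the coins of the outer ends are regrouped
by the vertex that tosses them. -/
theorem sum_flow_eq_sum_coinSet {v : V} {S : Finset V} (hS : S ⊆ kids G N v) {a i l : ℕ}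
    (hl : l < width V) :
    ∑ c ∈ S, flow G N ω a i l c = ∑ x ∈ coinSet G N S a i l, bitVal (ω x) := by
  rw [sum_flow hG hS, sum_coinSet S hl]
  simp only [Finset.sum_add_distrib]
  set U := S.biUnion (descs G N)
  rw [← Finset.sum_add_sum_compl U]
  congr 1
  · refine Finset.sum_congr rfl fun x hx => ?_
    rw [crossing, if_pos hx]
  · rw [Finset.sum_comm' (t' := Uᶜ) (s' := fun u => cross G N u ∩ U)]
    · refine Finset.sum_congr rfl fun x hx => ?_
      rw [crossing, if_neg (Finset.mem_compl.1 hx)]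
    · intro x y
      rw [Finset.mem_inter, Finset.mem_sdiff, Finset.mem_compl, mem_cross_comm]
      tauto

omit hG in
theorem coinSet_nonempty {v : V} {S : Finset V} (hS : S ⊆ kids G N v) (hc : ¬ Closed G N v S)
    (a i l : ℕ) : (coinSet G N S a i l).Nonempty := by
  refine Finset.Nonempty.image ?_ _
  by_contra hemp
  refine hc ⟨hS, fun c hc x hx u hu => ?_⟩
  by_contra hn
  have hxU : x ∈ S.biUnion (descs G N) := Finset.mem_biUnion.2 ⟨c, hc, hx⟩
  refine hemp ⟨⟨x, u⟩, Finset.mem_sigma.2 ⟨Finset.mem_univ _, ?_⟩⟩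
  rw [crossing, if_pos hxU, Finset.mem_sdiff, Finset.mem_biUnion]
  exact ⟨hu, hn⟩

/-! ### Union bound over the open sets. -/

open Classical in
/-- The sets of siblings whose random bits need not cancel. -/
noncomputable def openSets (G : SimpleGraph V) [DecidableRel G.Adj] (N : Network V) :
    Finset (Σ _ : V, Finset V) :=
  (Finset.univ.sigma fun v => (kids G N v).powerset).filter fun d => ¬ Closed G N d.1 d.2

theorem card_kids_le (v : V) : (kids G N v).card ≤ maxDeg G N N.leader := by
  have h1 : kids G N v ⊆ G.neighborFinset v := fun c hc =>
    (G.mem_neighborFinset v c).2 (mem_kids_adj hG hc).symm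
  refine (Finset.card_le_card h1).trans ?_
  rw [maxDeg, descs_leader hG]
  exact Finset.le_sup (f := fun w => G.degree w) (Finset.mem_univ v)

theorem card_openSets_le :
    (openSets G N).card ≤ Fintype.card V * 2 ^ maxDeg G N N.leader := by
  classical
  refine (Finset.card_filter_le _ _).trans ?_
  rw [Finset.card_sigma]
  refine (Finset.sum_le_card_nsmul _ _ (2 ^ maxDeg G N N.leader) fun v _ => ?_).trans_eq ?_
  · rw [Finset.card_powerset]
    exact Nat.pow_le_pow_right two_pos (card_kids_le hG v)
  · rw [smul_eq_mul, Finset.card_univ]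

/-- With `Δ` the maximum degree, `(Δ / width + 2) * width ≥ Δ + width + 1`. This exponent pays for
the `2 ^ Δ` sets at a vertex, for the fewer than `2 ^ width` vertices and for the factor 2; hence
the summand 2 in `chunks`. -/
theorem two_mul_card_openSets_le : 2 * (openSets G N).card ≤ 2 ^ (chunks G N * width V) := by
  have h1 : Fintype.card V < 2 ^ width V := Nat.lt_pow_succ_log_self one_lt_two _
  have h2 : maxDeg G N N.leader + width V + 1 ≤ chunks G N * width V := by
    have := Nat.div_add_mod (maxDeg G N N.leader) (width V)
    have := Nat.mod_lt (maxDeg G N N.leader) (width_pos (V := V))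
    rw [chunks, add_mul, mul_comm (_ / _)]
    omega
  calc 2 * (openSets G N).card
      ≤ 2 * (2 ^ width V * 2 ^ maxDeg G N N.leader) := by
        gcongr
        exact (card_openSets_le hG).trans (Nat.mul_le_mul_right _ h1.le)
    _ = 2 ^ (maxDeg G N N.leader + width V + 1) := by ring
    _ ≤ _ := Nat.pow_le_pow_right two_pos h2

/-- One open set is prescribed for each trial. All bits of all trials are then sums over disjoint
nonempty sets of coins. -/
theorem measure_zeroSum_le {A : ℕ} {f : Fin A → Σ _ : V, Finset V}
    (hf : ∀ a, f a ∈ openSets G N) :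
    coinMeasure V {ω | ∀ a : Fin A, ZeroSum G N ω a (f a).1 (f a).2} ≤
      (2⁻¹ ^ (chunks G N * width V)) ^ A := by
  classical
  have hf' : ∀ a, (f a).2 ⊆ kids G N (f a).1 ∧ ¬ Closed G N (f a).1 (f a).2 := fun a => by
    simpa [openSets] using hf a
  let s : Fin A × Fin (chunks G N) × Fin (width V) → Finset (V × ℕ × ℕ) := fun j =>
    coinSet G N (f j.1).2 j.1 j.2.1 j.2.2
  have key := measure_sums_eq_zero_le Finset.univ (s := s)
    (fun j _ => coinSet_nonempty (hf' j.1).1 (hf' j.1).2 _ _ _) fun j _ k _ x hj hk => by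
      obtain ⟨h1, h2, h3⟩ := eq_of_mem_coinSet j.2.1.2 k.2.1.2 j.2.2.2 k.2.2.2 hj hk
      exact Prod.ext (Fin.ext h1) (Prod.ext (Fin.ext h2) (Fin.ext h3))
  rw [Finset.card_univ, Fintype.card_prod, Fintype.card_prod, Fintype.card_fin, Fintype.card_fin,
    Fintype.card_fin, mul_comm, pow_mul] at key
  refine (measure_mono fun ω hω => ?_).trans key
  rintro ⟨a, i, l⟩ -
  change ∑ x ∈ coinSet G N (f a).2 a i l, bitVal (ω x) = 0
  rw [← sum_flow_eq_sum_coinSet hG (hf' a).1 l.2]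
  exact (hω a).2 i i.2 l l.2

/-- A single union bound over all prescriptions of an open set per trial gives a power with exponent
`A`, so independence of the failure events themselves is not needed. -/
theorem measure_not_good_le (A : ℕ) :
    coinMeasure V {ω | ∀ a < A, ¬ Good G N ω a} ≤ 2⁻¹ ^ A := by
  classical
  have hsub : {ω | ∀ a < A, ¬ Good G N ω a} ⊆
      ⋃ f ∈ Fintype.piFinset fun _ : Fin A => openSets G N,
        {ω | ∀ a : Fin A, ZeroSum G N ω a (f a).1 (f a).2} := by
    intro ω hω
    have : ∀ a : Fin A, ∃ d ∈ openSets G N, ZeroSum G N ω a d.1 d.2 := by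
      intro a
      have := hω a a.2
      unfold Good at this
      push Not at this
      obtain ⟨v, S, hS, hc⟩ := this
      refine ⟨⟨v, S⟩, ?_, hS⟩
      simpa [openSets] using And.intro hS.1 hc
    choose f hf hz using this
    simp only [Set.mem_iUnion]
    exact ⟨f, Fintype.mem_piFinset.2 hf, hz⟩
  have hcount : ((openSets G N).card : ℝ≥0∞) * 2⁻¹ ^ (chunks G N * width V) ≤ 2⁻¹ := by
    have h1 : (2 * (openSets G N).card : ℝ≥0∞) ≤ 2 ^ (chunks G N * width V) := by
      exact_mod_cast two_mul_card_openSets_le hG (N := N)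
    have h2 : (2 : ℝ≥0∞) ^ (chunks G N * width V) ≠ 0 := pow_ne_zero _ two_ne_zero
    have h3 : (2 : ℝ≥0∞) ^ (chunks G N * width V) ≠ ∞ := ENNReal.pow_ne_top ENNReal.ofNat_ne_top
    rw [← ENNReal.inv_pow, ← div_eq_mul_inv, ENNReal.div_le_iff h2 h3]
    calc ((openSets G N).card : ℝ≥0∞) = 2⁻¹ * (2 * (openSets G N).card) := by
          rw [← mul_assoc, ENNReal.inv_mul_cancel two_ne_zero ENNReal.ofNat_ne_top, one_mul]
      _ ≤ _ := by gcongr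
  calc coinMeasure V {ω | ∀ a < A, ¬ Good G N ω a}
      ≤ ∑ f ∈ Fintype.piFinset fun _ : Fin A => openSets G N,
          coinMeasure V {ω | ∀ a : Fin A, ZeroSum G N ω a (f a).1 (f a).2} :=
        (measure_mono hsub).trans (measure_biUnion_finset_le _ _)
    _ ≤ ∑ f ∈ Fintype.piFinset fun _ : Fin A => openSets G N,
          (2⁻¹ ^ (chunks G N * width V)) ^ A :=
        Finset.sum_le_sum fun f hf => measure_zeroSum_le hG (Fintype.mem_piFinset.1 hf)
    _ = ((openSets G N).card * 2⁻¹ ^ (chunks G N * width V)) ^ A := by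
        rw [Finset.sum_const, Fintype.card_piFinset, Finset.prod_const, Finset.card_univ,
          Fintype.card_fin, nsmul_eq_mul, Nat.cast_pow, ← mul_pow]
    _ ≤ 2⁻¹ ^ A := by gcongr

theorem measure_not_check_le (A : ℕ) :
    coinMeasure V {ω | ∀ a < A, ¬ ∀ x, Check G N ω a x} ≤ 2⁻¹ ^ A :=
  (measure_mono fun ω (hω : ∀ a < A, ¬ ∀ x, Check G N ω a x) a ha (hg : Good G N ω a) =>
    hω a ha (hg.check hG)).trans (measure_not_good_le hG A)

end BFS

/-! ### Size and number of messages -/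

namespace BFS

set_option linter.unusedSectionVars false

local notation "bsent" => Program.sent blockProgram

theorem card_lt_two_pow_width {V : Type*} [Fintype V] : Fintype.card V < 2 ^ width V :=
  Nat.lt_pow_succ_log_self one_lt_two _

variable {V : Type*} [Fintype V] [DecidableEq V] {G : SimpleGraph V} [DecidableRel G.Adj]
  {N : Network V} {ω : Coins V}

/-- The rounds in which `u` may send messages before the first attempt. -/
noncomputable def earlyRounds (G : SimpleGraph V) (N : Network V) (u : V) : Finset ℕ :=
  {depth G N u, 2 * maxDep G N u + 2 - depth G N u, 2 * height G N + 2 + depth G N u, base G N,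
    base G N + 1 + (height G N - depth G N u)}

/-- The rounds of an attempt in which `u` may send messages. -/
noncomputable def attemptRounds (G : SimpleGraph V) [DecidableRel G.Adj] (N : Network V) (u : V) :
    Finset ℕ :=
  Finset.range (chunks G N) ∪
    (Finset.range (chunks G N)).image (chunks G N + (height G N - depth G N u) + ·) ∪
    {2 * chunks G N + height G N + 1 + depth G N u, 2 * chunks G N + 2 * height G N + 2,
      2 * chunks G N + 2 * height G N + 3 + (height G N - depth G N u),
      2 * chunks G N + 3 * height G N + 4 + depth G N u}

theorem card_earlyRounds_le (u : V) : (earlyRounds G N u).card ≤ 5 := Finset.card_le_five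

theorem card_attemptRounds_le (u : V) : (attemptRounds G N u).card ≤ 2 * chunks G N + 4 := by
  refine (Finset.card_union_le _ _).trans (add_le_add ?_ Finset.card_le_four)
  refine (Finset.card_union_le _ _).trans ?_
  have := Finset.card_image_le (s := Finset.range (chunks G N))
    (f := (chunks G N + (height G N - depth G N u) + ·))
  rw [Finset.card_range] at *
  omega

variable (hG : G.Connected)
include hG

theorem depth_lt_card (v : V) : depth G N v < Fintype.card V := by
  obtain ⟨p, hp, hl⟩ := hG.exists_path_of_dist N.leader v
  rw [depth, ← hl]
  exact hp.length_lt

theorem maxDep_lt_card (v : V) : maxDep G N v < Fintype.card V := by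
  rw [maxDep, Finset.sup_lt_iff (bot_lt_iff_ne_bot.2 (Fintype.card_pos_iff.2 ⟨v⟩).ne')]
  exact fun w _ => depth_lt_card hG w

omit hG in
theorem maxDeg_lt_card (v : V) : maxDeg G N v < Fintype.card V := by
  rw [maxDeg, Finset.sup_lt_iff (bot_lt_iff_ne_bot.2 (Fintype.card_pos_iff.2 ⟨v⟩).ne')]
  exact fun w _ => G.degree_lt_card_verts w

omit hG in
theorem maxDeg_le_maxDegree : maxDeg G N N.leader ≤ G.maxDegree :=
  Finset.sup_le fun w _ => G.degree_le_maxDegree w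

theorem lab_lt_card (a : ℕ) (v : V) : lab G N ω a v < Fintype.card V := by
  by_cases hv : v = N.leader
  · rw [hv, lab_leader]
    exact Fintype.card_pos_iff.2 ⟨v⟩
  · obtain ⟨w, -, h, -⟩ := exists_lab_eq_pre (ω := ω) (a := a) hG hv
    rw [h]
    exact pre_lt_card hG w

variable [Nontrivial V]

theorem low_lt_card (v : V) : low G N v < Fintype.card V := by
  obtain ⟨x, -, h⟩ := Nat.sInf_mem (subtreeNbhd_nonempty (G := G) (N := N) v)
  exact h.symm.trans_lt (pre_lt_card hG x)

theorem high_lt_card (v : V) : high G N v < Fintype.card V := by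
  obtain ⟨x, -, h⟩ := Nat.sSup_mem (subtreeNbhd_nonempty (G := G) (N := N) v)
    (Set.toFinite _).bddAbove
  exact h.symm.trans_lt (pre_lt_card hG x)

theorem height_pos : 0 < height G N := by
  obtain ⟨v, hv⟩ := exists_ne N.leader
  have h1 := depth_par hG hv
  have h2 := depth_le_height (N := N) hG v
  omega

/-- All messages of the algorithm: their rounds and their sizes. -/
theorem sent_spec {t x : ℕ} {u v : V} (huv : G.Adj u v) {c : Chan}
    (h : bsent G N ω t u v c = some x) :
    x < 2 ^ (4 * width V) ∧ (t ∈ earlyRounds G N u ∨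
      ∃ a, ∃ o ∈ attemptRounds G N u, t = beg G N a + o) := by
  have hw := card_lt_two_pow_width (V := V)
  have hlt : ∀ y k, y < 2 ^ (k * width V) → k ≤ 4 → y < 2 ^ (4 * width V) := fun y k hy hk =>
    hy.trans_le (Nat.pow_le_pow_right two_pos (Nat.mul_le_mul_right _ hk))
  have hcard : ∀ y, y < Fintype.card V → y < 2 ^ (4 * width V) := fun y hy =>
    hlt y 1 (by rw [one_mul]; omega) (by norm_num)
  have hbit : ∀ y, y ≤ 1 → y < 2 ^ (4 * width V) := fun y hy => hcard y
    (hy.trans_lt Fintype.one_lt_card)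
  have hpair : ∀ y z, y ≤ Fintype.card V → z ≤ Fintype.card V →
      Nat.pair y z < 2 ^ (2 * width V) := fun y z hy hz => by
    rw [mul_comm, pow_mul]
    exact pair_lt_sq (hy.trans_lt hw) (hz.trans_lt hw)
  -- The longest messages contain up to four numbers not exceeding `|V|`, hence `4 * width` bits.
  have hpair' : ∀ y z, y < 2 ^ (2 * width V) → z < 2 ^ (2 * width V) →
      Nat.pair y z < 2 ^ (4 * width V) := fun y z hy hz => by
    rw [show 4 * width V = 2 * width V * 2 by ring, pow_mul]
    exact pair_lt_sq hy hz
  have hsize : ∀ w, size G N w ≤ Fintype.card V := fun w => Finset.card_le_univ _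
  have h0 := h
  cases c with
  | flood =>
    rw [sent_flood hG t huv] at h
    split_ifs at h with h1 h2
    · exact ⟨hbit _ (by have := Option.some.inj h; omega), .inl (by simp [earlyRounds, h1.1])⟩
    · exact ⟨hbit _ (by have := Option.some.inj h; omega), .inl (by simp [earlyRounds, h1.1])⟩
  | up =>
    rw [sent_up hG t huv] at h
    split_ifs at h with h1
    obtain rfl := Option.some.inj h
    exact ⟨hpair' _ _ ((maxDep_lt_card hG u).trans (hw.trans_le (Nat.pow_le_pow_right two_pos (by omega)))) (hpair _ _ (hsize u) (maxDeg_lt_card u).le),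
      .inl (by simp [earlyRounds, h1.1])⟩
  | down =>
    rw [sent_down hG t huv] at h
    split_ifs at h with h1
    obtain rfl := Option.some.inj h
    exact ⟨hpair' _ _ (hpair _ _ (maxDep_lt_card hG _).le le_rfl)
      (hpair _ _ (maxDeg_lt_card _).le (pre_lt_card hG v).le),
      .inl (by simp [earlyRounds, h1.1])⟩
  | number =>
    rw [sent_number hG t huv] at h
    split_ifs at h with h1
    obtain rfl := Option.some.inj h
    exact ⟨hcard _ (pre_lt_card hG u), .inl (by simp [earlyRounds, h1])⟩
  | range =>
    rw [sent_range hG t huv] at h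
    split_ifs at h with h1
    obtain rfl := Option.some.inj h
    exact ⟨hlt _ 2 (hpair _ _ (low_lt_card hG u).le (high_lt_card hG u).le) (by norm_num),
      .inl (by simp [earlyRounds, h1.2])⟩
  | chunk =>
    rw [sent_late hG t huv (by simp)] at h
    simp only [Pos.send] at h
    split_ifs at h with h1
    obtain ⟨a, o, ho, rfl⟩ := exists_beg h1.1
    rw [(gpos_beg ho u).2.1, gpos_chunks] at h1
    obtain rfl := Option.some.inj h
    exact ⟨hlt _ 1 (by rw [one_mul]; exact encBits_lt _ _) (by norm_num),
      .inr ⟨a, o, by simp [attemptRounds, h1.2], rfl⟩⟩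
  | sum =>
    rw [sent_late hG t huv (by simp)] at h
    simp only [Pos.send] at h
    split_ifs at h with h1
    obtain ⟨a, o, ho, rfl⟩ := exists_beg h1.1
    rw [(gpos_beg ho u).2.1, gpos_chunks, gpos_height, gpos_depth] at h1
    obtain rfl := Option.some.inj h
    refine ⟨hlt _ 1 (by rw [one_mul]; exact encBits_lt _ _) (by norm_num), .inr ⟨a, o, ?_, rfl⟩⟩
    refine Finset.mem_union_left _ (Finset.mem_union_right _ (Finset.mem_image.2
      ⟨o - (chunks G N + (height G N - depth G N u)), Finset.mem_range.2 ?_, ?_⟩))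
    · omega
    · omega
  | label =>
    rw [sent_late hG t huv (by simp)] at h
    simp only [Pos.send] at h
    split_ifs at h with h1
    obtain ⟨a, o, ho, rfl⟩ := exists_beg h1.1
    rw [(gpos_beg ho u).2.1, gpos_chunks, gpos_height, gpos_depth] at h1
    obtain ⟨-, h2, rfl⟩ := h1
    rw [sent_label hG (mem_gpos_kids.1 h2)] at h0
    obtain rfl := Option.some.inj h0
    exact ⟨hcard _ (lab_lt_card hG a v), .inr ⟨a, _, by simp [attemptRounds], rfl⟩⟩
  | labelX =>
    rw [sent_late hG t huv (by simp)] at h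
    simp only [Pos.send] at h
    split_ifs at h with h1
    obtain ⟨a, o, ho, rfl⟩ := exists_beg h1.1
    rw [(gpos_beg ho u).2.1, gpos_chunks, gpos_height] at h1
    obtain ⟨-, rfl⟩ := h1
    rw [sent_labelX hG huv] at h0
    obtain rfl := Option.some.inj h0
    exact ⟨hcard _ (lab_lt_card hG a u), .inr ⟨a, _, by simp [attemptRounds], rfl⟩⟩
  | ok =>
    rw [sent_late hG t huv (by simp)] at h
    simp only [Pos.send] at h
    split_ifs at h with h1 h2
    all_goals
      obtain ⟨a, o, ho, rfl⟩ := exists_beg h1.1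
      rw [(gpos_beg ho u).2.1, gpos_chunks, gpos_height, gpos_depth] at h1
      obtain ⟨-, -, rfl⟩ := h1
      exact ⟨hbit _ (by have := Option.some.inj h; omega), .inr ⟨a, _, by simp [attemptRounds], rfl⟩⟩
  | verdict =>
    rw [sent_late hG t huv (by simp)] at h
    simp only [Pos.send] at h
    split_ifs at h with h1 h2
    all_goals
      obtain ⟨a, o, ho, rfl⟩ := exists_beg h1.1
      rw [(gpos_beg ho u).2.1, gpos_chunks, gpos_height, gpos_depth] at h1
      obtain ⟨-, -, rfl⟩ := h1
      exact ⟨hbit _ (by have := Option.some.inj h; omega), .inr ⟨a, _, by simp [attemptRounds], rfl⟩⟩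

end BFS

/-! ### Complexity -/

namespace BFS

set_option linter.unusedSectionVars false

local notation "bsent" => Program.sent blockProgram

/-! ### Bit widths and natural logarithms. -/

section Numeric

theorem natCast_le_ofReal {n : ℕ} {x : ℝ} (h : (n : ℝ) ≤ x) : (n : ℝ≥0∞) ≤ ENNReal.ofReal x := by
  rw [← ENNReal.ofReal_natCast]
  exact ENNReal.ofReal_le_ofReal h

theorem log_le_width (V : Type*) [Fintype V] [Nontrivial V] :
    Real.log (Fintype.card V) ≤ width V := by
  have h0 : (0 : ℝ) < Fintype.card V := by exact_mod_cast Fintype.card_pos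
  have h1 : (Fintype.card V : ℝ) ≤ 2 ^ width V := by
    exact_mod_cast (card_lt_two_pow_width (V := V)).le
  calc Real.log (Fintype.card V) ≤ Real.log (2 ^ width V) := Real.log_le_log h0 h1
    _ = width V * Real.log 2 := Real.log_pow _ _
    _ ≤ width V * 1 := by
        gcongr
        exact Real.log_two_lt_d9.le.trans (by norm_num)
    _ = width V := mul_one _

theorem half_le_log (V : Type*) [Fintype V] [Nontrivial V] :
    1 / 2 ≤ Real.log (Fintype.card V) := by
  have h1 : (2 : ℝ) ≤ Fintype.card V := by exact_mod_cast Fintype.one_lt_card (α := V)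
  have h2 := Real.log_le_log two_pos h1
  have h3 := Real.log_two_gt_d9
  linarith

theorem width_le_log (V : Type*) [Fintype V] [Nontrivial V] :
    (width V : ℝ) ≤ 4 * Real.log (Fintype.card V) := by
  have h0 : (2 : ℝ) ^ Nat.log 2 (Fintype.card V) ≤ Fintype.card V := by
    exact_mod_cast Nat.pow_log_le_self 2 Fintype.card_ne_zero
  have h1 := Real.log_le_log (by positivity) h0
  rw [Real.log_pow] at h1
  have h2 := Real.log_two_gt_d9
  have h3 := half_le_log V
  have h4 : (0 : ℝ) ≤ Nat.log 2 (Fintype.card V) := Nat.cast_nonneg _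
  have h5 : (width V : ℝ) = Nat.log 2 (Fintype.card V) + 1 := by
    unfold width; push_cast; ring
  rw [h5]
  nlinarith

end Numeric

variable {V : Type*} [Fintype V] [DecidableEq V] [Nontrivial V] {G : SimpleGraph V}
  [DecidableRel G.Adj] {N : Network V} (hG : G.Connected)
include hG

theorem chunks_le : (chunks G N : ℝ) ≤ 2 + G.maxDegree / Real.log (Fintype.card V) := by
  have h1 := half_le_log V
  have h2 := log_le_width V
  have h3 : ((maxDeg G N N.leader / width V : ℕ) : ℝ) ≤ maxDeg G N N.leader / width V :=
    Nat.cast_div_le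
  have h4 : (maxDeg G N N.leader : ℝ) / width V ≤
      G.maxDegree / Real.log (Fintype.card V) := by
    gcongr
    exact maxDeg_le_maxDegree
  unfold chunks
  push_cast
  linarith

/-- The content has `4 * width` bits, `slot` costs one more, and packing multiplies by 1024. As
`width ≤ 4 * log |V|` and `1 ≤ 2 * log |V|`, the total is at most `(16 + 2) * 1024 * log |V|`. -/
theorem messageSizeLE {Out : Type} (halt : Know → Option Out)
    (hmin : ∀ ω : Coins V, ∃ Q : ℕ → Prop,
      ∀ t v, (halt ((blockProgram.ideal G N ω t).state v)).isSome ↔ Q t) :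
    (blockProgram.alg halt).MessageSizeLE G N (18432 * Real.log (Fintype.card V)) := by
  intro ω t u v m hm
  refine (blockProgram.messageSizeLE G N halt (b := 4 * width V + 1) hmin ?_ ω t u v m hm).trans ?_
  · intro ω t u v c x hx
    by_cases huv : G.Adj u v
    · have := (sent_spec hG huv hx).1
      rw [pow_succ]
      omega
    · rw [blockProgram.sent_of_not_adj _ _ _ _ huv] at hx
      simp at hx
  · have h1 := half_le_log V
    have h2 := width_le_log V
    push_cast
    linarith

open Classical in
-- Each direction of an edge is used in at most five rounds before the trials and in `2 * chunks +
-- 4` rounds of each trial. Waiting for the tree levels costs time but no messages.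
theorem card_rounds_le (ω : Coins V) {u v : V} (huv : G.Adj u v) (a : ℕ) :
    ((Finset.range (beg G N a)).filter fun t => ∃ c, (bsent G N ω t u v c).isSome).card ≤
      5 + a * (2 * chunks G N + 4) := by
  have hsub : ((Finset.range (beg G N a)).filter fun t => ∃ c, (bsent G N ω t u v c).isSome) ⊆
      earlyRounds G N u ∪ (Finset.range a ×ˢ attemptRounds G N u).image
        fun d => beg G N d.1 + d.2 := by
    intro t ht
    obtain ⟨ht, c, hc⟩ := Finset.mem_filter.1 ht
    obtain ⟨x, hx⟩ := Option.isSome_iff_exists.1 hc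
    rcases (sent_spec hG huv hx).2 with h | ⟨b, o, ho, rfl⟩
    · exact Finset.mem_union_left _ h
    · refine Finset.mem_union_right _ (Finset.mem_image.2 ⟨(b, o), ?_, rfl⟩)
      refine Finset.mem_product.2 ⟨Finset.mem_range.2 ?_, ho⟩
      by_contra hba
      have hab : a * period G N ≤ b * period G N := Nat.mul_le_mul_right _ (not_lt.1 hba)
      have : beg G N b + o < beg G N a := Finset.mem_range.1 ht
      unfold beg at this
      omega
  refine (Finset.card_le_card hsub).trans ((Finset.card_union_le _ _).trans ?_)
  refine add_le_add (card_earlyRounds_le u) (Finset.card_image_le.trans ?_)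
  rw [Finset.card_product, Finset.card_range]
  exact Nat.mul_le_mul_left _ (card_attemptRounds_le u)

/-- The value is `4 * height + 5`, and the height is positive and at most the diameter. -/
theorem start_le : start G N ≤ 9 * G.diam := by
  have h1 := height_pos (N := N) hG
  have h2 := height_le_diam (N := N) hG
  unfold start base
  omega

theorem edgeFinset_card_pos : 0 < G.edgeFinset.card := by
  obtain ⟨v, hv⟩ := exists_ne (Classical.arbitrary V)
  obtain ⟨n, hn, -⟩ := exists_adj_avoids (hG.preconnected v (Classical.arbitrary V)) hv
  exact Finset.card_pos.2 ⟨s(n, _), SimpleGraph.mem_edgeFinset.2 hn⟩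

/-! ### Time and message bounds. -/

theorem time_sim0_le (ω : Coins V) :
    (blockProgram.alg haltSim0).time G N ω ≤ ENNReal.ofReal (18432 * G.diam) := by
  refine (blockProgram.time_le G N ω haltSim0 (haltSim0_isSome_iff hG) (le_refl (start G N))).trans
    (natCast_le_ofReal ?_)
  have h1 : (start G N : ℝ) ≤ 9 * G.diam := by exact_mod_cast start_le hG
  have h2 : (0 : ℝ) ≤ G.diam := Nat.cast_nonneg _
  linarith

theorem messages_sim0_le (ω : Coins V) :
    (blockProgram.alg haltSim0).messages G N ω ≤ ENNReal.ofReal (18432 * G.edgeFinset.card) := by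
  have h := blockProgram.messages_le_of_card_le G N ω haltSim0 (haltSim0_isSome_iff hG)
    (le_refl (start G N)) (M := 5) fun u v huv => by
      simpa [beg] using card_rounds_le hG ω huv 0
  refine h.trans ?_
  have h2 : (0 : ℝ) ≤ G.edgeFinset.card := Nat.cast_nonneg _
  have := natCast_le_ofReal (n := 2 * G.edgeFinset.card * 5) (x := 18432 * G.edgeFinset.card)
    (by push_cast; linarith)
  exact_mod_cast this

theorem expectedTime_blocks_le :
    (blockProgram.alg haltBlocks).expectedTime G N ≤
      ENNReal.ofReal (18432 * (G.diam + G.maxDegree / Real.log (Fintype.card V))) := by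
  have : IsProbabilityMeasure (coinMeasure V) := by unfold coinMeasure; infer_instance
  have h := lintegral_attempts_le (measure_not_check_le (N := N) hG)
    (F := (blockProgram.alg haltBlocks).time G N) (s := (start G N : ℝ≥0∞))
    (p := (period G N : ℝ≥0∞)) (by unfold period; simp) fun ω a ha _ => by
      have := blockProgram.time_le G N ω haltBlocks (haltBlocks_isSome_iff hG)
        (T := beg G N (a + 1)) ⟨a, rfl, ha⟩
      exact_mod_cast this
  refine h.trans ?_
  have h1 := chunks_le (N := N) hG
  have h2 : (height G N : ℝ) ≤ G.diam := by exact_mod_cast height_le_diam hG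
  have h3 : (start G N : ℝ) ≤ 9 * G.diam := by exact_mod_cast start_le hG
  have h4 : (1 : ℝ) ≤ height G N := by exact_mod_cast height_pos hG
  have h5 : (0 : ℝ) ≤ G.maxDegree / Real.log (Fintype.card V) :=
    div_nonneg (Nat.cast_nonneg _) (by linarith [half_le_log V])
  have := natCast_le_ofReal (n := start G N + 2 * period G N)
    (x := 18432 * (G.diam + G.maxDegree / Real.log (Fintype.card V)))
    (by unfold period; push_cast; linarith)
  exact_mod_cast this

theorem expectedMessages_blocks_le :
    (blockProgram.alg haltBlocks).expectedMessages G N ≤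
      ENNReal.ofReal (18432 *
        (G.edgeFinset.card * (1 + G.maxDegree / Real.log (Fintype.card V)))) := by
  have : IsProbabilityMeasure (coinMeasure V) := by unfold coinMeasure; infer_instance
  have hE := edgeFinset_card_pos hG
  have h := lintegral_attempts_le (measure_not_check_le (N := N) hG)
    (F := (blockProgram.alg haltBlocks).messages G N)
    (s := ((2 * G.edgeFinset.card * 5 : ℕ) : ℝ≥0∞))
    (p := ((2 * G.edgeFinset.card * (2 * chunks G N + 4) : ℕ) : ℝ≥0∞))
    (by rw [Nat.cast_ne_zero]; positivity) fun ω a ha _ => by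
      have := blockProgram.messages_le_of_card_le G N ω haltBlocks (haltBlocks_isSome_iff hG)
        (T := beg G N (a + 1)) ⟨a, rfl, ha⟩ fun u v huv => card_rounds_le hG ω huv (a + 1)
      refine this.trans_eq ?_
      push_cast
      ring
  refine h.trans ?_
  have h1 := chunks_le (N := N) hG
  have h2 : (0 : ℝ) ≤ G.edgeFinset.card := Nat.cast_nonneg _
  have h5 : (0 : ℝ) ≤ G.maxDegree / Real.log (Fintype.card V) :=
    div_nonneg (Nat.cast_nonneg _) (by linarith [half_le_log V])
  have := natCast_le_ofReal
    (n := 2 * G.edgeFinset.card * 5 + 2 * (2 * G.edgeFinset.card * (2 * chunks G N + 4)))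
    (x := 18432 * (G.edgeFinset.card * (1 + G.maxDegree / Real.log (Fintype.card V)))) (by
      calc (((2 * G.edgeFinset.card * 5 + 2 * (2 * G.edgeFinset.card * (2 * chunks G N + 4)) : ℕ)) :
            ℝ) = G.edgeFinset.card * (26 + 8 * chunks G N) := by push_cast; ring
        _ ≤ G.edgeFinset.card * (18432 * (1 + G.maxDegree / Real.log (Fintype.card V))) := by
            gcongr
            linarith
        _ = _ := by ring)
  exact_mod_cast this

end BFS

theorem mainTheorem9 :
    -- the Las Vegas algorithm for cut vertices and blocks
    (∃ A : DistAlg BlockOutput, ∀ k : ℕ, ∃ C : ℝ,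
      ∀ (V : Type*) [Fintype V] [DecidableEq V] [Nontrivial V]
        (G : SimpleGraph V) [DecidableRel G.Adj] (N : Network V),
        G.Connected → (∀ v, N.ident v ≤ Fintype.card V ^ k) →
        A.MessageSizeLE G N (C * Real.log (Fintype.card V)) ∧
        (∀ (ω : Coins V) (t : ℕ) (out : V → BlockOutput),
          A.HaltsWith G N ω t out → CorrectBlockOutput G N out) ∧
        A.expectedTime G N ≤
          ENNReal.ofReal (C * (G.diam + G.maxDegree / Real.log (Fintype.card V))) ∧
        A.expectedMessages G N ≤
          ENNReal.ofReal
            (C * (G.edgeFinset.card * (1 + G.maxDegree / Real.log (Fintype.card V))))) ∧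
    -- the generating relation of the verifier
    (∀ (V : Type*) [Finite V] (G T : SimpleGraph V) (r : V) (pre : V → ℕ),
      IsPreorderedSpanningTree G T r pre →
      (∀ e f : G.edgeSet, Sim0 G T r pre e f → ∃ v, v ∈ (e : Sym2 V) ∧ v ∈ (f : Sym2 V)) ∧
      (∀ e f : G.edgeSet, Relation.EqvGen (Sim0 G T r pre) e f ↔ SameBlock G e f) ∧
      (∀ R : G.edgeSet → G.edgeSet → Prop, Equivalence R →
        ((∀ e f, SameBlock G e f → R e f) ↔
          ∀ (u v w : V) (h : G.Adj u v) (k : G.Adj v w),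
            Sim0 G T r pre (edgeOf h) (edgeOf k) → R (edgeOf h) (edgeOf k)))) ∧
    -- the distributed computation of the generating relation
    (∃ A : DistAlg (ℕ → ℕ → Bool), ∀ k : ℕ, ∃ C : ℝ,
      ∀ (V : Type*) [Fintype V] [DecidableEq V] [Nontrivial V]
        (G : SimpleGraph V) [DecidableRel G.Adj] (N : Network V),
        G.Connected → (∀ v, N.ident v ≤ Fintype.card V ^ k) →
        A.MessageSizeLE G N (C * Real.log (Fintype.card V)) ∧
        ∀ ω : Coins V,
          (∀ (t : ℕ) (out : V → ℕ → ℕ → Bool),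
            A.HaltsWith G N ω t out → CorrectSim0Output G N out) ∧
          A.time G N ω ≤ ENNReal.ofReal (C * G.diam) ∧
          A.messages G N ω ≤ ENNReal.ofReal (C * G.edgeFinset.card)) := by
  -- The constant `18432 = 18 * 1024` comes from the message size and is ample for the other bounds.
  -- Identifiers are never sent, so it works for every `k`.
  refine ⟨⟨blockProgram.alg haltBlocks, fun _ => ⟨18432, fun V _ _ _ G _ N hG _ => ⟨?_, ?_, ?_, ?_⟩⟩⟩,
    sim0_generates_blocks, ⟨blockProgram.alg haltSim0, fun _ => ⟨18432, fun V _ _ _ G _ N hG _ =>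
      ⟨?_, fun ω => ⟨fun _ _ h => BFS.correctSim0Output hG h, BFS.time_sim0_le hG ω,
        BFS.messages_sim0_le hG ω⟩⟩⟩⟩⟩
  · exact BFS.messageSizeLE hG _ fun _ => ⟨_, BFS.haltBlocks_isSome_iff hG⟩
  · exact fun _ _ _ h => BFS.correctBlockOutput hG h
  · exact BFS.expectedTime_blocks_le hG
  · exact BFS.expectedMessages_blocks_le hG
  · exact BFS.messageSizeLE hG _ fun _ => ⟨_, BFS.haltSim0_isSome_iff hG⟩
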